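/- Let $\mathcal N\subset\mathbb R^m$ be a compact smooth embedded submanifold without boundary, with the induced metric, and let $G\subset O(m)$ be a closed subgroup that maps $\mathcal N$ to itself and acts transitively on it (for instance, $\mathcal N$ a closed homogeneous Riemannian manifold, embedded isometrically and equivariantly, and $G=\operatorname{Isom}(\mathcal N)$). Let $\mathfrak g\subset\mathfrak{so}(m)$ be the Lie algebra of $G$ and $L=\dim\mathfrak g$. For an orthonormal basis $A^1,\dots,A^L$ of $\mathfrak g$ (with respect to the inner product of $\mathbb R^{m\times m}$), a frame associated with it is a family of smooth tangent vector fields $Y^1,\dots,Y^L$ on $\mathcal N$ such that $$X=\sum_{i=1}^L\langle A^iq,X\rangle\,Y^i(q)\qquad\text{for all } q\in\mathcal N,\ X\in T_q\mathcal N .$$ Let $(\Sigma,h)$ be a closed smooth Riemannian surface, $p>2$, and let $u\in W^{1,p}(\Sigma;\mathcal N)$ be a $p$-harmonic map, i.e. a critical point of $E_p(u)=\int_\Sigma(1+|\nabla u|^2)^{p/2}\,dvol_\Sigma$ with respect to smooth variations in the target $\mathcal N$. Put $$V^i=-(1+|\nabla u|^2)^{\frac p2-1}\langle\nabla u,A^iu\rangle,\qquad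 \Upsilon^i=Y^i\circ u .$$ Then $\Upsilon^i\in W^{1,p}(\Sigma;\mathbb R^m)$, and: 1. Each $V^i$ is divergence free on $\Sigma$ in the sense of distributions, and on every coordinate disc of $\Sigma$ there is a function $B^i\in W^{1,1}_{loc}$ with $V^i=\nabla^\perp B^i$. Accordingly one writes $\nabla^\perp B^i$ for $V^i$ (the functions $B^i$ are in general defined only locally). 2. In the sense of distributions on $\Sigma$, $$-\operatorname{div}\big((1+|\nabla u|^2)^{\frac p2-1}\nabla u\big)=\sum_{i=1}^L\nabla^\perp B^i\cdot\nabla\Upsilon^i .$$ 3. There is a constant $C>0$ such that, almost everywhere, $$|\nabla B^i|\le C(1+|\nabla u|^2)^{\frac p2-1}|\nabla u|,\qquad |\nabla\Upsilon^i|\le C|\nabla u| .$$ Here, for every orthonormal basis $A^1,\dots,A^L$ and every associated frame $Y^1,\dots,Y^L$, the constant $C$ depends only on $\mathcal N$, $G$ and the chosen basis and frame, and not on $\Sigma$, $h$, $p$ or $u$. Moreover, for every orthonormal basis there is an associated frame for which all of this holds with a constant $C$ that depends only on $\mathcal N$ and $G$. -/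

import Mathlib

open MeasureTheory Set
open scoped ContDiff Manifold RealInnerProductSpace

universe u

noncomputable section

namespace PHarm

/-- The coordinate plane `ℝ²`. -/
abbrev Plane : Type := EuclideanSpace ℝ (Fin 2)

/-- The standard basis of `ℝ²`. -/
def e (i : Fin 2) : Plane := EuclideanSpace.single i 1

section Target

variable {m : ℕ}

/-- Action of an `m × m` matrix on a vector of `ℝᵐ`. -/
def act (A : Matrix (Fin m) (Fin m) ℝ) (q : EuclideanSpace ℝ (Fin m)) :
    EuclideanSpace ℝ (Fin m) :=
  WithLp.toLp 2 (A.mulVec q.ofLp)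

/-- `N ⊆ ℝᵐ` is a smooth embedded `n`-dimensional submanifold (without boundary): locally it is the
zero set of a smooth submersion to `ℝᵏ`, with `n + k = m`. -/
def IsSubmanifold (n : ℕ) (N : Set (EuclideanSpace ℝ (Fin m))) : Prop :=
  ∀ q ∈ N, ∃ (k : ℕ) (U : Set (EuclideanSpace ℝ (Fin m)))
    (f : EuclideanSpace ℝ (Fin m) → EuclideanSpace ℝ (Fin k)),
    n + k = m ∧ IsOpen U ∧ q ∈ U ∧ ContDiffOn ℝ ∞ f U ∧
    (∀ y ∈ U, Function.Surjective (fderiv ℝ f y)) ∧ ∀ y ∈ U, (y ∈ N ↔ f y = 0)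

/-- The tangent space of `N` at `q`: velocities at time `0` of curves in `N` through `q`. -/
def tangent (N : Set (EuclideanSpace ℝ (Fin m))) (q : EuclideanSpace ℝ (Fin m)) :
    Set (EuclideanSpace ℝ (Fin m)) :=
  {X | ∃ γ : ℝ → EuclideanSpace ℝ (Fin m), (∀ t, γ t ∈ N) ∧ γ 0 = q ∧ HasDerivAt γ X 0}

/-- `G ≤ O(m)` maps `N` into itself and acts transitively on `N`. -/
def ActsTransitively (G : Subgroup (Matrix.orthogonalGroup (Fin m) ℝ))
    (N : Set (EuclideanSpace ℝ (Fin m))) : Prop :=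
  (∀ Q ∈ G, ∀ q ∈ N, act (Q : Matrix (Fin m) (Fin m) ℝ) q ∈ N) ∧
  ∀ q₁ ∈ N, ∀ q₂ ∈ N, ∃ Q ∈ G, act (Q : Matrix (Fin m) (Fin m) ℝ) q₁ = q₂

/-- The Lie algebra of a closed matrix group `G ≤ O(m)`: the matrices generating one-parameter
subgroups of `G`. -/
def lieAlg (G : Subgroup (Matrix.orthogonalGroup (Fin m) ℝ)) : Set (Matrix (Fin m) (Fin m) ℝ) :=
  {A | ∀ t : ℝ, ∃ Q ∈ G, (Q : Matrix (Fin m) (Fin m) ℝ) = NormedSpace.exp (t • A)}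

/-- `A¹, …, Aᴸ` is a basis of the Lie algebra of `G`, orthonormal for the inner product
`∑ⱼₖ AⱼₖBⱼₖ` of `ℝ^{m × m}`. -/
def IsLieOrthonormalBasis (G : Subgroup (Matrix.orthogonalGroup (Fin m) ℝ)) {L : ℕ}
    (A : Fin L → Matrix (Fin m) (Fin m) ℝ) : Prop :=
  (∀ i i', ∑ j, ∑ k, A i j k * A i' j k = if i = i' then 1 else 0) ∧
  (Submodule.span ℝ (Set.range A) : Set (Matrix (Fin m) (Fin m) ℝ)) = lieAlg G

/-- `Y¹, …, Yᴸ` are smooth tangent vector fields on `N` with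
`X = ∑ᵢ ⟨Aⁱ q, X⟩ Yⁱ(q)` for `q ∈ N`, `X ∈ T_q N`. (A smooth vector field on the closed
submanifold `N` is given here by a smooth extension to `ℝᵐ`.) -/
def IsFrame (N : Set (EuclideanSpace ℝ (Fin m))) {L : ℕ} (A : Fin L → Matrix (Fin m) (Fin m) ℝ)
    (Y : Fin L → EuclideanSpace ℝ (Fin m) → EuclideanSpace ℝ (Fin m)) : Prop :=
  (∀ i, ContDiff ℝ ∞ (Y i)) ∧
  (∀ i, ∀ q ∈ N, Y i q ∈ tangent N q) ∧
  ∀ q ∈ N, ∀ X ∈ tangent N q, X = ∑ i, ⟪act (A i) q, X⟫ • Y i q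

end Target

section Pointwise

variable {F : Type*} [NormedAddCommGroup F] [InnerProductSpace ℝ F]

/-- The contraction `α · D` of a covector `α` and an `F`-valued covector `D`, for the inner product
on the plane with Gram matrix `g`. -/
def pairing (g : Matrix (Fin 2) (Fin 2) ℝ) (α : Plane →L[ℝ] ℝ) (D : Plane →L[ℝ] F) : F :=
  ∑ i, ∑ j, (g⁻¹ i j * α (e i)) • D (e j)

/-- The squared (Hilbert–Schmidt) norm `|D|²` of an `F`-valued covector, for the inner product on
the plane with Gram matrix `g`. -/
def normSq (g : Matrix (Fin 2) (Fin 2) ℝ) (D : Plane →L[ℝ] F) : ℝ :=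
  ∑ i, ∑ j, g⁻¹ i j * ⟪D (e i), D (e j)⟫

/-- If `η = dB` then `perp g η` is the covector of the vector
`∇^⊥ B = (det g)^{-1/2} (-∂₂B, ∂₁B)`. -/
def perp (g : Matrix (Fin 2) (Fin 2) ℝ) (η : Plane →L[ℝ] ℝ) (v : Plane) : ℝ :=
  (√g.det)⁻¹ * ∑ j, v j * (g j 0 * (-η (e 1)) + g j 1 * η (e 0))

/-- `f'` is the weak (distributional) differential of `f` on the open set `U ⊆ ℝ²`. -/
def HasWeakDerivOn (U : Set Plane) (f : Plane → F) (f' : Plane → Plane →L[ℝ] F) : Prop :=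
  LocallyIntegrableOn f U ∧ LocallyIntegrableOn f' U ∧
  ∀ φ : Plane → ℝ, ContDiff ℝ ∞ φ → HasCompactSupport φ → tsupport φ ⊆ U → ∀ v : Plane,
    ∫ y, (fderiv ℝ φ y v) • f y = -∫ y, φ y • f' y v

end Pointwise

section Surface

variable {S : Type u} [TopologicalSpace S] [ChartedSpace Plane S] [IsManifold 𝓘(ℝ, Plane) ∞ S]

/-- Smooth Riemannian metrics on the surface `S`. -/
abbrev Metric2 (S : Type u) [TopologicalSpace S] [ChartedSpace Plane S]
    [IsManifold 𝓘(ℝ, Plane) ∞ S] : Type u :=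
  Bundle.ContMDiffRiemannianMetric 𝓘(ℝ, Plane) ∞ Plane
    (fun x : S => TangentSpace 𝓘(ℝ, Plane) x)

/-- The tangent space at a point of `S` is, by construction, the model space `ℝ²`; this is
`(e 0, e 1)` as a basis of it. -/
def te (x : S) (i : Fin 2) : TangentSpace 𝓘(ℝ, Plane) x := e i

/-- Gram matrix of the metric at `x` in the basis `te x`. -/
def gram (h : Metric2 S) (x : S) : Matrix (Fin 2) (Fin 2) ℝ :=
  Matrix.of fun i j => h.inner x (te x i) (te x j)

/-- The coordinate vectors of the (inverse) chart `c.symm`, i.e. the differential of `c.symm`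
at `y`. -/
def chartD (c : OpenPartialHomeomorph S Plane) (y : Plane) :
    Plane →L[ℝ] TangentSpace 𝓘(ℝ, Plane) (c.symm y) :=
  mfderiv 𝓘(ℝ, Plane) 𝓘(ℝ, Plane) c.symm y

/-- The metric coefficients `h_{ij}` in the chart `c`. -/
def chartGram (h : Metric2 S) (c : OpenPartialHomeomorph S Plane) (y : Plane) :
    Matrix (Fin 2) (Fin 2) ℝ :=
  Matrix.of fun i j => h.inner (c.symm y) (chartD c y (e i)) (chartD c y (e j))

/-- The smooth charts of `S`. -/
abbrev charts (S : Type u) [TopologicalSpace S] [ChartedSpace Plane S] :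
    Set (OpenPartialHomeomorph S Plane) :=
  IsManifold.maximalAtlas 𝓘(ℝ, Plane) ∞ S

/-- The measure `√det(h_{ij}) dy` on the domain of the chart `c`. -/
def chartVolume [MeasurableSpace S] (h : Metric2 S) (c : OpenPartialHomeomorph S Plane) :
    Measure S :=
  ((volume.restrict c.target).withDensity
    (fun y => ENNReal.ofReal √(chartGram h c y).det)).map c.symm

/-- The Riemannian volume. The chart measures agree on overlaps of charts, and their least upper
bound is the measure obtained by gluing them. -/
def vol [MeasurableSpace S] (h : Metric2 S) : Measure S :=
  ⨆ c ∈ charts S, chartVolume h c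

variable {F : Type*} [NormedAddCommGroup F] [InnerProductSpace ℝ F]

/-- (Not necessarily continuous) `F`-valued one-forms on `S`. -/
abbrev OneForm (S : Type u) [TopologicalSpace S] [ChartedSpace Plane S] (F : Type*)
    [NormedAddCommGroup F] [InnerProductSpace ℝ F] : Type _ :=
  ∀ x : S, TangentSpace 𝓘(ℝ, Plane) x →L[ℝ] F

/-- Coordinate representation (pullback by the inverse chart) of a one-form. -/
def chartRep (c : OpenPartialHomeomorph S Plane) (D : OneForm S F) (y : Plane) : Plane →L[ℝ] F :=
  (D (c.symm y)).comp (chartD c y)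

/-- `D` is the weak differential of `f : S → F`: it is so in every chart. -/
def IsWeakDifferential (f : S → F) (D : OneForm S F) : Prop :=
  ∀ c ∈ charts S, HasWeakDerivOn c.target (f ∘ c.symm) (chartRep c D)

open Classical in
/-- The weak differential of `f` (unique almost everywhere), or `0` if there is none. -/
def wd (f : S → F) : OneForm S F :=
  if H : ∃ D : OneForm S F, IsWeakDifferential f D then H.choose else 0

/-- `|D|²` of a one-form, as a function on `S`. -/
def formNormSq (h : Metric2 S) (D : OneForm S F) (x : S) : ℝ :=
  normSq (gram h x) (D x)

/-- The contraction of a scalar and an `F`-valued one-form, as a function on `S`. -/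
def formPairing (h : Metric2 S) (α : OneForm S ℝ) (D : OneForm S F) (x : S) : F :=
  pairing (gram h x) (α x) (D x)

/-- The differential of a smooth function on `S`. -/
def smoothD (ψ : S → ℝ) : OneForm S ℝ := fun x =>
  (mfderiv 𝓘(ℝ, Plane) 𝓘(ℝ, ℝ) ψ x : TangentSpace 𝓘(ℝ, Plane) x →L[ℝ] ℝ)

/-- The Sobolev space `W^{1,p}(S; F)`. -/
def MemW1p [MeasurableSpace S] (h : Metric2 S) (p : ℝ) (f : S → F) : Prop :=
  MemLp f (ENNReal.ofReal p) (vol h) ∧ (∃ D : OneForm S F, IsWeakDifferential f D) ∧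
  MemLp (fun x => √(formNormSq h (wd f) x)) (ENNReal.ofReal p) (vol h)

/-- The `p`-energy `E_p(f) = ∫ (1 + |∇f|²)^{p/2}`. -/
def energy [MeasurableSpace S] (h : Metric2 S) (p : ℝ) (f : S → F) : ℝ :=
  ∫ x, (1 + formNormSq h (wd f) x) ^ (p / 2) ∂(vol h)

variable {m : ℕ}

/-- `V` is a smooth variation in the target `N`: `V t x` maps `N` to `N` and `V 0 x` is the identity
on `N`. -/
def IsTargetVariation (N : Set (EuclideanSpace ℝ (Fin m)))
    (V : ℝ → S → EuclideanSpace ℝ (Fin m) → EuclideanSpace ℝ (Fin m)) : Prop :=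
  ContMDiff ((𝓘(ℝ, ℝ).prod 𝓘(ℝ, Plane)).prod 𝓘(ℝ, EuclideanSpace ℝ (Fin m)))
    𝓘(ℝ, EuclideanSpace ℝ (Fin m)) ∞
    (fun z : (ℝ × S) × EuclideanSpace ℝ (Fin m) => V z.1.1 z.1.2 z.2) ∧
  (∀ t x, ∀ q ∈ N, V t x q ∈ N) ∧ ∀ x, ∀ q ∈ N, V 0 x q = q

/-- `w ∈ W^{1,p}(S; N)` is a `p`-harmonic map: a critical point of `E_p` with respect to variations
`w_t(x) = V(t, x, w(x))` in the target. -/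
def IsPHarmonic [MeasurableSpace S] (h : Metric2 S) (N : Set (EuclideanSpace ℝ (Fin m))) (p : ℝ)
    (w : S → EuclideanSpace ℝ (Fin m)) : Prop :=
  MemW1p h p w ∧ (∀ᵐ x ∂(vol h), w x ∈ N) ∧
  ∀ V, IsTargetVariation N V →
    HasDerivAt (fun t : ℝ => energy h p (fun x => V t x (w x))) 0 0

/-- The weight `(1 + |∇w|²)^{p/2 - 1}`. -/
def weight (h : Metric2 S) (p : ℝ) (w : S → EuclideanSpace ℝ (Fin m)) (x : S) : ℝ :=
  (1 + formNormSq h (wd w) x) ^ (p / 2 - 1)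

/-- The field `∇^⊥ B = -(1 + |∇w|²)^{p/2 - 1} ⟨∇w, A w⟩`, as a one-form. -/
def perpB (h : Metric2 S) (p : ℝ) (w : S → EuclideanSpace ℝ (Fin m))
    (A : Matrix (Fin m) (Fin m) ℝ) : OneForm S ℝ := fun x =>
  -(weight h p w x) • (innerSL ℝ (act A (w x))).comp (wd w x)

/-- The conservation law, with `Υⁱ = Yⁱ ∘ w` and with constant `C` in the pointwise bounds. -/
structure ConservationLaw [MeasurableSpace S] (h : Metric2 S) (p : ℝ)
    (w : S → EuclideanSpace ℝ (Fin m)) {L : ℕ} (A : Fin L → Matrix (Fin m) (Fin m) ℝ)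
    (Y : Fin L → EuclideanSpace ℝ (Fin m) → EuclideanSpace ℝ (Fin m)) (C : ℝ) : Prop where
  /-- `Υⁱ ∈ W^{1,p}`. -/
  memW1p : ∀ i, MemW1p h p (Y i ∘ w)
  /-- `-div((1 + |∇w|²)^{p/2-1} ∇w) = ∑ᵢ ∇^⊥Bⁱ · ∇Υⁱ` in the sense of distributions. -/
  equation : ∀ ψ : S → ℝ, ContMDiff 𝓘(ℝ, Plane) 𝓘(ℝ, ℝ) ∞ ψ →
    Integrable (fun x => weight h p w x • formPairing h (smoothD ψ) (wd w) x) (vol h) ∧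
    Integrable (fun x => ψ x • ∑ i, formPairing h (perpB h p w (A i)) (wd (Y i ∘ w)) x) (vol h) ∧
    ∫ x, weight h p w x • formPairing h (smoothD ψ) (wd w) x ∂(vol h) =
      ∫ x, ψ x • ∑ i, formPairing h (perpB h p w (A i)) (wd (Y i ∘ w)) x ∂(vol h)
  /-- The fields `∇^⊥Bⁱ` are divergence free on the whole surface. -/
  divFree : ∀ i, ∀ ψ : S → ℝ, ContMDiff 𝓘(ℝ, Plane) 𝓘(ℝ, ℝ) ∞ ψ →
    Integrable (formPairing h (smoothD ψ) (perpB h p w (A i))) (vol h) ∧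
    ∫ x, formPairing h (smoothD ψ) (perpB h p w (A i)) x ∂(vol h) = 0
  /-- On every coordinate disc there is a function `Bⁱ` whose rotated gradient is the given field
  and whose gradient satisfies the pointwise bound. -/
  potential : ∀ i, ∀ c ∈ charts S, ∀ (y₀ : Plane) (r : ℝ), Metric.ball y₀ r ⊆ c.target →
    ∃ (B : Plane → ℝ) (dB : Plane → Plane →L[ℝ] ℝ), HasWeakDerivOn (Metric.ball y₀ r) B dB ∧
      ∀ᵐ y ∂(volume.restrict (Metric.ball y₀ r)),
        (∀ v, perp (chartGram h c y) (dB y) v = chartRep c (perpB h p w (A i)) y v) ∧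
        √(normSq (chartGram h c y) (dB y)) ≤
          C * (weight h p w (c.symm y) * √(formNormSq h (wd w) (c.symm y)))
  /-- `|∇^⊥Bⁱ| ≤ C (1 + |∇w|²)^{p/2-1} |∇w|`. -/
  bound_B : ∀ i, ∀ᵐ x ∂(vol h),
    √(formNormSq h (perpB h p w (A i)) x) ≤ C * (weight h p w x * √(formNormSq h (wd w) x))
  /-- `|∇Υⁱ| ≤ C |∇w|`. -/
  bound_Y : ∀ i, ∀ᵐ x ∂(vol h),
    √(formNormSq h (wd (Y i ∘ w)) x) ≤ C * √(formNormSq h (wd w) x)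

end Surface

end PHarm

end

/-! The theorem is Noether's principle for the rotations in `G`. For `A` in the Lie algebra, `exp (σ
A)` maps `N` to itself and is an isometry of the ambient space. Rotate `w` by the variable angle `σ
= t ζ`, where `ζ = ψ · (η ∘ w)`, with `ψ` smooth on the surface and `η` smooth on the target. The
gradient of the rotated map is `exp (σ A) (∇w + t dζ ⊗ A w)`. The rotation drops out of its norm, so
the energy density is a function of an exact quadratic polynomial in `t`. Differentiating at `t = 0`
(`hasDerivAt_integral_rpow`) gives `∫ ⟨dζ, V⟩ = 0` for `V = -(1 + |∇w|²)^(p/2-1) ⟨∇w, A w⟩`; this is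
`IsPHarmonic.integral_testForm_eq_zero`.

Taking `η = 1` yields that `V` is divergence free. Taking `η = ⟨v, Yⁱ⟩` and summing over `i`, the
frame identity applied to the tangent vectors `∇w` recombines the terms into the weak form of the
equation, tested against `ψ v`. Since `η` may depend on the target point, the Sobolev test functions
`ψ ⟨v, Υⁱ⟩` come from genuine smooth target variations, and no density argument is needed.

Two facts about homogeneous spaces enter. Velocities of curves in `N` are of the form `A q`
(`exists_lieAlg_of_mem_tangent`). A frame exists (`exists_isFrame`): the operator `M_q = ∑ ⟨Aⁱ q, ·⟩
Aⁱ q` is equivariant under `G`, because conjugation preserves the matrix inner product. Hence its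
spectrum is the same at all points of `N`, one polynomial `f` inverts `M_q` on its range for all `q
∈ N`, and `Yⁱ q = f(M_q) Aⁱ q` is smooth on the whole space. Passing from one reference basis to any
other by a matrix with entries at most `1` makes the constant uniform.

The analytic part is a chain rule for bounded Sobolev maps, tangency of the weak differential
(`IsSubmanifold.ae_mem_tangent`), and an `L¹` Poincaré lemma on discs (`exists_potential`). In a
chart, `V` rotated by a right angle is a weakly closed form; its mollifications have primitives,
which converge by the `L¹` Poincaré inequality. Rotation is an isometry, so the bound for `V` is the
bound for `∇B`. -/

noncomputable section

namespace PHarm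

/-! ### Closed subgroups of the orthogonal group and their Lie algebras. -/

section

open Filter Topology

section LieTheory

open scoped Matrix.Norms.L2Operator

variable {m : ℕ}

local notation "Mat" => Matrix (Fin m) (Fin m) ℝ
local notation "Vec" => EuclideanSpace ℝ (Fin m)

/-- Access to a star-algebra isomorphism onto operators, from which linearity, multiplicativity and
adjoints of the action are inherited. -/
theorem act_eq_toEuclideanCLM (A : Mat) (q : Vec) :
    act A q = Matrix.toEuclideanCLM (n := Fin m) (𝕜 := ℝ) A q := rfl

theorem act_mul (A B : Mat) (q : Vec) : act (A * B) q = act A (act B q) := by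
  simp [act_eq_toEuclideanCLM]

theorem act_one (q : Vec) : act (1 : Mat) q = q := by
  simp [act_eq_toEuclideanCLM]

theorem act_sub (A B : Mat) (q : Vec) : act (A - B) q = act A q - act B q := by
  simp [act_eq_toEuclideanCLM]

theorem act_smul (c : ℝ) (A : Mat) (q : Vec) : act (c • A) q = c • act A q := by
  simp [act_eq_toEuclideanCLM]

theorem act_sum {ι : Type*} (s : Finset ι) (A : ι → Mat) (q : Vec) :
    act (∑ i ∈ s, A i) q = ∑ i ∈ s, act (A i) q := by
  simp [act_eq_toEuclideanCLM]

theorem continuous_act : Continuous fun z : Mat × Vec => act z.1 z.2 := by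
  have h : Continuous (Matrix.toEuclideanCLM (n := Fin m) (𝕜 := ℝ)) :=
    LinearMap.continuous_of_finiteDimensional
      (Matrix.toEuclideanCLM (n := Fin m) (𝕜 := ℝ)).toAlgEquiv.toLinearEquiv.toLinearMap
  exact (h.comp continuous_fst).clm_apply continuous_snd

theorem norm_orthogonal_le (Q : Matrix.orthogonalGroup (Fin m) ℝ) : ‖(Q : Mat)‖ ≤ 1 := by
  -- For `m = 0` the matrix ring is trivial and its unit has norm `0`, so equality with `1` fails.
  rcases subsingleton_or_nontrivial Mat with h | h
  · rw [Subsingleton.elim (Q : Mat) 0]; simp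
  · exact (CStarRing.norm_of_mem_unitary Q.2).le

theorem inner_act_orthogonal (Q : Matrix.orthogonalGroup (Fin m) ℝ) (v w : Vec) :
    ⟪act (Q : Mat) v, act (Q : Mat) w⟫ = ⟪v, w⟫ := by
  simp only [act_eq_toEuclideanCLM]
  rw [← ContinuousLinearMap.adjoint_inner_left, ← ContinuousLinearMap.star_eq_adjoint, ← map_star,
    ← ContinuousLinearMap.comp_apply, ← ContinuousLinearMap.mul_def, ← map_mul,
    Unitary.coe_star_mul_self]
  simp

/-- The matrices belonging to `G`. -/
def matSet (G : Subgroup (Matrix.orthogonalGroup (Fin m) ℝ)) : Set Mat :=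
  {Q | ∃ g ∈ G, (g : Mat) = Q}

variable {G : Subgroup (Matrix.orthogonalGroup (Fin m) ℝ)}

theorem one_mem_matSet : (1 : Mat) ∈ matSet G := ⟨1, G.one_mem, rfl⟩

theorem mul_mem_matSet {P Q : Mat} (hP : P ∈ matSet G) (hQ : Q ∈ matSet G) :
    P * Q ∈ matSet G := by
  obtain ⟨g, hg, rfl⟩ := hP
  obtain ⟨k, hk, rfl⟩ := hQ
  exact ⟨g * k, G.mul_mem hg hk, rfl⟩

theorem pow_mem_matSet {P : Mat} (hP : P ∈ matSet G) (n : ℕ) : P ^ n ∈ matSet G := by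
  induction n with
  | zero => simpa using one_mem_matSet
  | succ n ih => rw [pow_succ]; exact mul_mem_matSet ih hP

theorem star_mem_matSet {P : Mat} (hP : P ∈ matSet G) : star P ∈ matSet G := by
  obtain ⟨g, hg, rfl⟩ := hP
  exact ⟨g⁻¹, G.inv_mem hg, rfl⟩

theorem star_mul_of_mem_matSet {P : Mat} (hP : P ∈ matSet G) : star P * P = 1 := by
  obtain ⟨g, hg, rfl⟩ := hP
  exact Unitary.coe_star_mul_self g

theorem mul_star_of_mem_matSet {P : Mat} (hP : P ∈ matSet G) : P * star P = 1 := by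
  obtain ⟨g, hg, rfl⟩ := hP
  exact Unitary.coe_mul_star_self g

theorem norm_le_of_mem_matSet {P : Mat} (hP : P ∈ matSet G) : ‖P‖ ≤ 1 := by
  obtain ⟨g, hg, rfl⟩ := hP
  exact norm_orthogonal_le g

theorem inner_act_of_mem_matSet {P : Mat} (hP : P ∈ matSet G) (v w : Vec) :
    ⟪act P v, act P w⟫ = ⟪v, w⟫ := by
  obtain ⟨g, hg, rfl⟩ := hP
  exact inner_act_orthogonal g v w

theorem isClosed_matSet (hG : IsClosed (G : Set (Matrix.orthogonalGroup (Fin m) ℝ))) :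
    IsClosed (matSet G) := by
  have h1 : IsClosed (Matrix.orthogonalGroup (Fin m) ℝ : Set Mat) := isClosed_unitary
  have := (h1.isClosedEmbedding_subtypeVal).isClosedMap _ hG
  convert this using 1
  ext Q; simp [matSet]

theorem isCompact_matSet (hG : IsClosed (G : Set (Matrix.orthogonalGroup (Fin m) ℝ))) :
    IsCompact (matSet G) := by
  have : FiniteDimensional ℝ Mat := inferInstance
  have : ProperSpace Mat := FiniteDimensional.proper ℝ Mat
  refine Metric.isCompact_of_isClosed_isBounded (isClosed_matSet hG) ?_
  exact (Metric.isBounded_closedBall (x := (0 : Mat)) (r := 1)).subset fun P hP => by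
    simpa using norm_le_of_mem_matSet hP

theorem mem_lieAlg_iff {A : Mat} :
    A ∈ lieAlg G ↔ ∀ t : ℝ, NormedSpace.exp (t • A) ∈ matSet G := Iff.rfl

theorem smul_mem_lieAlg {A : Mat} (hA : A ∈ lieAlg G) (c : ℝ) : c • A ∈ lieAlg G := by
  rw [mem_lieAlg_iff] at *
  intro t
  rw [smul_smul]; exact hA _

/-- Telescoping with contractions: the error grows only linearly in the exponent, so an error `o(r)`
per step is harmless over about `t / r` steps. -/
theorem norm_pow_sub_pow_le {g h : Mat} (hg : ‖g‖ ≤ 1) (hh : ‖h‖ ≤ 1) (n : ℕ) :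
    ‖g ^ n - h ^ n‖ ≤ n * ‖g - h‖ := by
  have hpow : ∀ n : ℕ, ‖h ^ n‖ ≤ 1 := by
    intro n
    rcases subsingleton_or_nontrivial Mat with h' | h'
    · rw [Subsingleton.elim (h ^ n) 0]; simp
    · exact (norm_pow_le h n).trans (pow_le_one₀ (norm_nonneg _) hh)
  induction n with
  | zero => simp
  | succ n ih =>
    have : g ^ (n + 1) - h ^ (n + 1) = g * (g ^ n - h ^ n) + (g - h) * h ^ n := by
      rw [pow_succ', pow_succ']; noncomm_ring
    rw [this]
    calc _ ≤ ‖g * (g ^ n - h ^ n)‖ + ‖(g - h) * h ^ n‖ := norm_add_le _ _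
      _ ≤ ‖g‖ * ‖g ^ n - h ^ n‖ + ‖g - h‖ * ‖h ^ n‖ :=
        add_le_add (norm_mul_le _ _) (norm_mul_le _ _)
      _ ≤ 1 * (n * ‖g - h‖) + ‖g - h‖ * 1 := by
        gcongr
        exact hpow n
      _ = _ := by push_cast; ring

theorem hasDerivAt_exp_smul (A : Mat) (t : ℝ) :
    HasDerivAt (fun s : ℝ => NormedSpace.exp (s • A)) (A * NormedSpace.exp (t • A)) t :=
  hasDerivAt_exp_smul_const' A t

/-- First-order limits at the identity of a closed group lie in its Lie algebra. -/
theorem mem_lieAlg_of_tendsto (hG : IsClosed (G : Set (Matrix.orthogonalGroup (Fin m) ℝ)))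
    {g : ℕ → Mat} (hg : ∀ k, g k ∈ matSet G) {r : ℕ → ℝ} (hr : ∀ k, 0 < r k)
    (hr0 : Tendsto r atTop (𝓝 0)) {a : Mat}
    (ha : Tendsto (fun k => (r k)⁻¹ • (g k - 1)) atTop (𝓝 a)) : a ∈ lieAlg G := by
  let _ : NormedAlgebra ℚ Mat := NormedAlgebra.restrictScalars ℚ ℝ Mat
  have hg1 : Tendsto g atTop (𝓝 1) := by
    have := (hr0.smul ha).add_const (1 : Mat)
    simp only [zero_smul, zero_add] at this
    refine this.congr fun k => ?_
    rw [smul_smul, mul_inv_cancel₀ (hr k).ne', one_smul, sub_add_cancel]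
  -- The relation `gᵀ g = 1` holds exactly for each difference quotient and becomes skewness in the
  -- limit; hence all `exp (s a)` are orthogonal and of norm at most `1`.
  have hskew : star a = -a := by
    have h1 : Tendsto (fun k => star ((r k)⁻¹ • (g k - 1)) * g k + (r k)⁻¹ • (g k - 1)) atTop
        (𝓝 (star a * 1 + a)) := (ha.star.mul hg1).add ha
    have h2 : ∀ k, star ((r k)⁻¹ • (g k - 1)) * g k + (r k)⁻¹ • (g k - 1) = 0 := by
      intro k
      rw [star_smul, star_trivial, smul_mul_assoc, ← smul_add, star_sub, sub_mul,
        star_mul_of_mem_matSet (hg k)]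
      simp
    simp only [h2, mul_one] at h1
    exact eq_neg_of_add_eq_zero_left (tendsto_nhds_unique h1 tendsto_const_nhds)
  have hexp : ∀ s : ℝ, NormedSpace.exp (s • a) ∈ unitary Mat := fun s => by
    refine NormedSpace.exp_mem_unitary_of_mem_skewAdjoint ?_
    rw [skewAdjoint.mem_iff, star_smul, hskew]; simp
  have hexpn : ∀ s : ℝ, ‖NormedSpace.exp (s • a)‖ ≤ 1 := fun s => norm_orthogonal_le ⟨_, hexp s⟩
  -- `exp (t a)` is the limit of the group elements `g k ^ ⌊t / r k⌋`: replacing `g k` by `exp (r k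
  -- a)` costs `o(r k)` per factor, and `⌊t / r k⌋ r k → t`.
  have key : ∀ t : ℝ, 0 ≤ t → NormedSpace.exp (t • a) ∈ matSet G := by
    intro t ht
    have hn : Tendsto (fun k => (⌊t / r k⌋₊ : ℝ) * r k) atTop (𝓝 t) := by
      have : Tendsto (fun k => t - r k) atTop (𝓝 t) := by simpa using hr0.const_sub t
      refine tendsto_of_tendsto_of_tendsto_of_le_of_le this tendsto_const_nhds ?_ ?_
      · intro k
        have := Nat.lt_floor_add_one (t / r k)
        rw [div_lt_iff₀ (hr k)] at this
        simp only; linarith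
      · intro k
        have := Nat.floor_le (div_nonneg ht (hr k).le)
        rwa [le_div_iff₀ (hr k)] at this
    have hexpc : Continuous fun s : ℝ => NormedSpace.exp (s • a) :=
      continuous_iff_continuousAt.2 fun s => (hasDerivAt_exp_smul a s).continuousAt
    have h1 : Tendsto (fun k => NormedSpace.exp (((⌊t / r k⌋₊ : ℝ) * r k) • a)) atTop
        (𝓝 (NormedSpace.exp (t • a))) := (hexpc.tendsto t).comp hn
    have hd : Tendsto (fun k => (r k)⁻¹ • (NormedSpace.exp (r k • a) - 1)) atTop (𝓝 a) := by
      have := (hasDerivAt_exp_smul a 0).tendsto_slope_zero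
      simp only [zero_smul, NormedSpace.exp_zero, mul_one, zero_add] at this
      exact this.comp (tendsto_nhdsWithin_iff.2 ⟨hr0, Eventually.of_forall fun k => (hr k).ne'⟩)
    have h2 : Tendsto (fun k => ((⌊t / r k⌋₊ : ℝ) * r k) *
        ‖(r k)⁻¹ • (g k - 1) - (r k)⁻¹ • (NormedSpace.exp (r k • a) - 1)‖) atTop (𝓝 0) := by
      have := hn.mul (ha.sub hd).norm
      simpa using this
    have h3 : Tendsto (fun k => g k ^ ⌊t / r k⌋₊ -
        NormedSpace.exp (((⌊t / r k⌋₊ : ℝ) * r k) • a)) atTop (𝓝 0) := by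
      refine squeeze_zero_norm (fun k => ?_) h2
      have e1 : NormedSpace.exp (((⌊t / r k⌋₊ : ℝ) * r k) • a) =
          NormedSpace.exp (r k • a) ^ ⌊t / r k⌋₊ := by
        rw [← NormedSpace.exp_nsmul, ← Nat.cast_smul_eq_nsmul ℝ, smul_smul]
      rw [e1]
      refine (norm_pow_sub_pow_le (norm_le_of_mem_matSet (hg k)) (hexpn _) _).trans (le_of_eq ?_)
      rw [← smul_sub, sub_sub_sub_cancel_right, norm_smul, norm_inv, Real.norm_of_nonneg (hr k).le]
      field_simp [(hr k).ne']
    have h4 := h3.add h1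
    simp only [sub_add_cancel, zero_add] at h4
    exact (isClosed_matSet hG).mem_of_tendsto h4
      (Eventually.of_forall fun k => pow_mem_matSet (hg k) _)
  rw [mem_lieAlg_iff]
  intro t
  rcases le_total 0 t with ht | ht
  · exact key t ht
  -- Negative times follow by inversion, which is transposition here.
  · have h1 := star_mem_matSet (key (-t) (by linarith))
    have h2 : star (NormedSpace.exp ((-t) • a)) = NormedSpace.exp (t • a) := by
      rw [NormedSpace.star_exp, star_smul, hskew]; simp
    rwa [h2] at h1

end LieTheory

end

/-! ### Orbits: tangent vectors come from the Lie algebra. -/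

section

open Filter Topology

section Orbits

open scoped Matrix.Norms.L2Operator

variable {m : ℕ} {G : Subgroup (Matrix.orthogonalGroup (Fin m) ℝ)}
  {N : Set (EuclideanSpace ℝ (Fin m))}

local notation "Mat" => Matrix (Fin m) (Fin m) ℝ
local notation "Vec" => EuclideanSpace ℝ (Fin m)

theorem act_mem_of_mem_matSet (hG : ActsTransitively G N) {P : Mat} (hP : P ∈ matSet G) {q : Vec}
    (hq : q ∈ N) : act P q ∈ N := by
  obtain ⟨g, hg, rfl⟩ := hP
  exact hG.1 g hg q hq

theorem exists_matSet_act_eq (hG : ActsTransitively G N) {q₁ q₂ : Vec} (h₁ : q₁ ∈ N)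
    (h₂ : q₂ ∈ N) : ∃ P ∈ matSet G, act P q₁ = q₂ := by
  obtain ⟨g, hg, h⟩ := hG.2 q₁ h₁ q₂ h₂
  exact ⟨g, ⟨g, hg, rfl⟩, h⟩

theorem hasDerivAt_act_exp (A : Mat) (q : Vec) (s : ℝ) :
    HasDerivAt (fun t : ℝ => act (NormedSpace.exp (t • A)) q)
      (act (NormedSpace.exp (s • A)) (act A q)) s := by
  have h1 : HasDerivAt (fun t : ℝ => Matrix.toEuclideanCLM (n := Fin m) (𝕜 := ℝ)
      (NormedSpace.exp (t • A))) (Matrix.toEuclideanCLM (n := Fin m) (𝕜 := ℝ)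
      (NormedSpace.exp (s • A) * A)) s :=
    (LinearMap.toContinuousLinearMap (Matrix.toEuclideanCLM (n := Fin m)
    (𝕜 := ℝ)).toAlgEquiv.toLinearEquiv.toLinearMap).hasFDerivAt.comp_hasDerivAt s
    (hasDerivAt_exp_smul_const A s)
  have h2 := h1.clm_apply (hasDerivAt_const s q)
  rw [map_zero, add_zero] at h2
  rw [← act_mul]
  exact h2

theorem act_mem_tangent (hG : ActsTransitively G N) {A : Mat} (hA : A ∈ lieAlg G) {q : Vec}
    (hq : q ∈ N) : act A q ∈ tangent N q := by
  refine ⟨fun t => act (NormedSpace.exp (t • A)) q, fun t => act_mem_of_mem_matSet hG (hA t) hq,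
    by simp [act_one], ?_⟩
  simpa [act_one] using hasDerivAt_act_exp A q 0

/-- Every velocity of a curve in an orbit is generated by the Lie algebra. -/
theorem exists_lieAlg_of_mem_tangent
    (hGc : IsClosed (G : Set (Matrix.orthogonalGroup (Fin m) ℝ))) (hG : ActsTransitively G N)
    {q : Vec} (hq : q ∈ N) {X : Vec} (hX : X ∈ tangent N q) : ∃ A ∈ lieAlg G, act A q = X := by
  obtain ⟨γ, hγN, hγ0, hγ⟩ := hX
  have hfd : FiniteDimensional ℝ Mat := inferInstance
  have hps : ProperSpace Mat := FiniteDimensional.proper ℝ Mat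
  have hcont : ∀ q : Vec, Continuous fun P : Mat => act P q := fun q =>
    continuous_act.comp (continuous_id.prodMk continuous_const)
  -- Lift the curve to the group by taking, at each time, the element nearest to the identity that
  -- carries `q` to `γ t`. Minimality replaces the choice of a slice transverse to the stabiliser.
  have hmin : ∀ t, ∃ P ∈ matSet G, act P q = γ t ∧
      ∀ P' ∈ matSet G, act P' q = γ t → ‖P - 1‖ ≤ ‖P' - 1‖ := by
    intro t
    have hc : IsCompact (matSet G ∩ {P | act P q = γ t}) :=
      (isCompact_matSet hGc).inter_right (isClosed_eq (hcont q) continuous_const)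
    obtain ⟨P₀, hP₀, hP₀'⟩ := exists_matSet_act_eq hG hq (hγN t)
    obtain ⟨P, hP, hPm⟩ := hc.exists_isMinOn ⟨P₀, hP₀, hP₀'⟩
      (f := fun P => ‖P - 1‖) (by fun_prop)
    exact ⟨P, hP.1, hP.2, fun P' h1 h2 => hPm ⟨h1, h2⟩⟩
  choose P hPG hPq hPmin using hmin
  have hinv : Tendsto (fun k : ℕ => ((k : ℝ) + 1)⁻¹) atTop (𝓝 0) := by
    simpa using tendsto_one_div_add_atTop_nhds_zero_nat (𝕜 := ℝ)
  obtain ⟨Q, hQG, φ, hφ, hQ⟩ := (isCompact_matSet hGc).tendsto_subseq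
    (x := fun k : ℕ => P ((k : ℝ) + 1)⁻¹) (fun k => hPG _)
  set t : ℕ → ℝ := fun k => ((φ k : ℝ) + 1)⁻¹ with ht_def
  have ht : Tendsto t atTop (𝓝 0) := hinv.comp hφ.tendsto_atTop
  have htpos : ∀ k, 0 < t k := fun k => by positivity
  have hγt : Tendsto (fun k => γ (t k)) atTop (𝓝 q) := by
    rw [← hγ0]; exact hγ.continuousAt.tendsto.comp ht
  have hQq : act Q q = q := by
    have h1 : Tendsto (fun k => act (P (t k)) q) atTop (𝓝 (act Q q)) :=
      ((hcont q).tendsto Q).comp hQ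
    simp only [hPq] at h1
    exact tendsto_nhds_unique h1 hγt
  have hQq' : act (star Q) q = q := by
    conv_lhs => rw [← hQq]
    rw [← act_mul, star_mul_of_mem_matSet hQG, act_one]
  -- A limit `Q` of the lifts fixes `q`, so `P (t k) Q*` is a competitor tending to the identity;
  -- minimality then forces the lifts themselves to tend to it.
  have hs : Tendsto (fun k => ‖P (t k) - 1‖) atTop (𝓝 0) := by
    have h1 : Tendsto (fun k => ‖P (t k) * star Q - 1‖) atTop (𝓝 0) := by
      have := ((hQ.mul_const (star Q)).sub_const 1).norm
      rw [mul_star_of_mem_matSet hQG] at this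
      simpa using this
    refine squeeze_zero (fun k => norm_nonneg _) (fun k => ?_) h1
    refine hPmin _ _ (mul_mem_matSet (hPG _) (star_mem_matSet hQG)) ?_
    rw [act_mul, hQq', hPq]
  -- Nothing bounds `‖P - 1‖ / t` yet. Dividing by the sum of both keeps the two quotients in a
  -- compact ball; the limits satisfy `a q = τ X` with `a` in the Lie algebra.
  set r : ℕ → ℝ := fun k => ‖P (t k) - 1‖ + t k with hr_def
  have hrpos : ∀ k, 0 < r k := fun k => add_pos_of_nonneg_of_pos (norm_nonneg _) (htpos k)
  have hr : Tendsto r atTop (𝓝 0) := by simpa using hs.add ht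
  have hmem : ∀ k, ((r k)⁻¹ • (P (t k) - 1), (r k)⁻¹ * t k) ∈
      Metric.closedBall (0 : Mat × ℝ) 1 := by
    intro k
    rw [mem_closedBall_zero_iff, Prod.norm_def, max_le_iff, norm_smul, norm_mul, norm_inv,
      Real.norm_of_nonneg (hrpos k).le, Real.norm_of_nonneg (htpos k).le,
      inv_mul_le_iff₀ (hrpos k), inv_mul_le_iff₀ (hrpos k)]
    constructor <;> simp only [hr_def] <;> linarith [norm_nonneg (P (t k) - 1), htpos k]
  obtain ⟨⟨a, τ⟩, -, σ, hσ, haτ⟩ := (isCompact_closedBall (0 : Mat × ℝ) 1).tendsto_subseq hmem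
  have ha : Tendsto (fun k => (r (σ k))⁻¹ • (P (t (σ k)) - 1)) atTop (𝓝 a) :=
    (continuous_fst.tendsto _).comp haτ
  have hτ : Tendsto (fun k => (r (σ k))⁻¹ * t (σ k)) atTop (𝓝 τ) :=
    (continuous_snd.tendsto _).comp haτ
  have hrσ := hr.comp hσ.tendsto_atTop
  have htσ := ht.comp hσ.tendsto_atTop
  have haG : a ∈ lieAlg G := mem_lieAlg_of_tendsto hGc (fun k => hPG _) (fun k => hrpos (σ k)) hrσ ha
  have haq : act a q = τ • X := by
    have h1 : Tendsto (fun k => act ((r (σ k))⁻¹ • (P (t (σ k)) - 1)) q) atTop (𝓝 (act a q)) :=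
      ((hcont q).tendsto a).comp ha
    have h2 : Tendsto (fun k => ((r (σ k))⁻¹ * t (σ k)) • ((t (σ k))⁻¹ • (γ (t (σ k)) - q))) atTop
        (𝓝 (τ • X)) := by
      refine hτ.smul ?_
      have := hγ.tendsto_slope_zero
      simp only [zero_add, hγ0] at this
      exact this.comp (tendsto_nhdsWithin_iff.2
        ⟨htσ, Eventually.of_forall fun k => (htpos _).ne'⟩)
    refine tendsto_nhds_unique h1 (h2.congr fun k => ?_)
    rw [act_smul, act_sub, hPq, act_one, smul_smul, mul_assoc, mul_inv_cancel₀ (htpos _).ne',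
      mul_one]
  -- If `τ = 0`, then `‖P - 1‖ / r → 1` and `a q = 0`, so `exp (-r a)` fixes `q`. Multiplying `P` by
  -- it gives a competitor at distance `o(r)` from the identity, against minimality.
  by_cases hτ0 : τ = 0
  · exfalso
    subst hτ0
    have hs1 : Tendsto (fun k => (r (σ k))⁻¹ * ‖P (t (σ k)) - 1‖) atTop (𝓝 1) := by
      have := hτ.const_sub 1
      rw [sub_zero] at this
      refine this.congr fun k => ?_
      have h0 := (hrpos (σ k)).ne'
      field_simp
      simp only [hr_def]; ring
    have hexp : ∀ k, NormedSpace.exp ((-r (σ k)) • a) ∈ matSet G := fun k => haG _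
    have hstab : ∀ s : ℝ, act (NormedSpace.exp (s • a)) q = q := by
      have hd : ∀ s : ℝ, HasDerivAt (fun s : ℝ => act (NormedSpace.exp (s • a)) q) 0 s := by
        intro s
        simpa [haq, act_eq_toEuclideanCLM] using hasDerivAt_act_exp a q s
      intro s
      have := is_const_of_deriv_eq_zero (fun s => (hd s).differentiableAt)
        (fun s => (hd s).deriv) s 0
      simpa [act_one] using this
    have hle : ∀ k, (r (σ k))⁻¹ * ‖P (t (σ k)) - 1‖ ≤
        ‖(r (σ k))⁻¹ • (P (t (σ k)) * NormedSpace.exp ((-r (σ k)) • a) - 1)‖ := by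
      intro k
      rw [norm_smul, norm_inv, Real.norm_of_nonneg (hrpos _).le]
      refine mul_le_mul_of_nonneg_left ?_ (inv_nonneg.2 (hrpos _).le)
      refine hPmin _ _ (mul_mem_matSet (hPG _) (hexp k)) ?_
      rw [act_mul, hstab, hPq]
    have hlim : Tendsto (fun k =>
        (r (σ k))⁻¹ • (P (t (σ k)) * NormedSpace.exp ((-r (σ k)) • a) - 1)) atTop (𝓝 0) := by
      have hd : Tendsto (fun k => (r (σ k))⁻¹ • (NormedSpace.exp ((-r (σ k)) • a) - 1)) atTop
          (𝓝 (-a)) := by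
        have := (hasDerivAt_exp_smul (-a) 0).tendsto_slope_zero
        simp only [zero_smul, NormedSpace.exp_zero, mul_one, zero_add] at this
        have := this.comp (tendsto_nhdsWithin_iff.2
          ⟨hrσ, Eventually.of_forall fun k => (hrpos _).ne'⟩)
        refine this.congr fun k => ?_
        simp
      have hP1 : Tendsto (fun k => P (t (σ k))) atTop (𝓝 1) := by
        have := tendsto_zero_iff_norm_tendsto_zero.2 (hs.comp hσ.tendsto_atTop)
        simpa using this.add_const 1
      have := (hP1.mul hd).add ha
      rw [one_mul, neg_add_cancel] at this
      refine this.congr fun k => ?_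
      rw [mul_smul_comm, ← smul_add]
      congr 1
      noncomm_ring
    have := le_of_tendsto_of_tendsto' hs1 hlim.norm hle
    rw [norm_zero] at this
    linarith
  · refine ⟨τ⁻¹ • a, smul_mem_lieAlg haG _, ?_⟩
    rw [act_smul, haq, smul_smul, inv_mul_cancel₀ hτ0, one_smul]

/-- Vectors annihilated by the differential of a local defining submersion are tangent. -/
theorem mem_tangent_of_fderiv_eq_zero {k : ℕ} {U : Set Vec} {f : Vec → EuclideanSpace ℝ (Fin k)}
    (hU : IsOpen U) (hf : ContDiffOn ℝ ∞ f U)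
    (hsurj : ∀ y ∈ U, Function.Surjective (fderiv ℝ f y)) (hN : ∀ y ∈ U, (y ∈ N ↔ f y = 0))
    {q : Vec} (hqU : q ∈ U) (hq : q ∈ N) {X : Vec} (hX : fderiv ℝ f q X = 0) :
    X ∈ tangent N q := by
  have hs : HasStrictFDerivAt f (fderiv ℝ f q) q :=
    (hf.contDiffAt (hU.mem_nhds hqU)).hasStrictFDerivAt (by simp)
  have hr : (fderiv ℝ f q).range = ⊤ := LinearMap.range_eq_top.2 (hsurj q hqU)
  have hfq : f q = 0 := (hN q hqU).1 hq
  set X' : (fderiv ℝ f q).ker := ⟨X, hX⟩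
  -- The implicit function theorem parametrises the level set by the kernel of the differential; a
  -- line in the kernel gives a curve with velocity `X`.
  set g : ℝ → Vec := fun t => hs.implicitFunction f (fderiv ℝ f q) hr (f q) (t • X')
  have hg : HasDerivAt g X 0 := by
    have h1 := (hs.to_implicitFunction hr).hasFDerivAt
    have h2 : HasDerivAt (fun t : ℝ => t • X') X' 0 := by
      simpa using (hasDerivAt_id (0 : ℝ)).smul_const X'
    have h3 : HasFDerivAt (hs.implicitFunction f (fderiv ℝ f q) hr (f q))
        (fderiv ℝ f q).ker.subtypeL ((fun t : ℝ => t • X') 0) := by simpa using h1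
    exact h3.comp_hasDerivAt 0 h2
  have hg0 : g 0 = q := by
    simp only [g, zero_smul]
    exact hs.implicitFunction_apply_image hr
  have hgN : ∀ᶠ t in 𝓝 (0 : ℝ), g t ∈ N := by
    have h1 := hs.map_implicitFunction_eq hr
    have h2 : Tendsto (fun t : ℝ => (f q, t • X')) (𝓝 0) (𝓝 (f q, 0)) := by
      have : Continuous fun t : ℝ => (f q, t • X') := by fun_prop
      simpa using this.tendsto 0
    have h3 := h2.eventually h1
    have h4 : ∀ᶠ t in 𝓝 (0 : ℝ), g t ∈ U :=
      hg.continuousAt.eventually (by rw [hg0]; exact hU.mem_nhds hqU)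
    filter_upwards [h3, h4] with t ht1 ht2
    rw [hN _ ht2]
    exact ht1.trans hfq
  classical
  -- `tangent` asks for a curve that lies in `N` at all times. Only the germ at `0` matters, so the
  -- value `q` is used wherever `g` leaves `N`.
  refine ⟨fun t => if g t ∈ N then g t else q, fun t => ?_, ?_, ?_⟩
  · by_cases h : g t ∈ N <;> simp [h, hq]
  · simp [hg0]
  · refine hg.congr_of_eventuallyEq ?_
    filter_upwards [hgN] with t ht
    simp [ht]

end Orbits

end

/-! ### The equivariant frame operator and frames. -/

section

open Filter Topology

section Frames

variable {m : ℕ} {G : Subgroup (Matrix.orthogonalGroup (Fin m) ℝ)}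
  {N : Set (EuclideanSpace ℝ (Fin m))}

local notation "Mat" => Matrix (Fin m) (Fin m) ℝ
local notation "Vec" => EuclideanSpace ℝ (Fin m)

/-- The inner product `∑ⱼₖ AⱼₖBⱼₖ` of matrices. -/
def frob (A B : Mat) : ℝ := ∑ j, ∑ k, A j k * B j k

theorem frob_eq_trace (A B : Mat) : frob A B = (A.transpose * B).trace := by
  simp only [frob, Matrix.trace, Matrix.diag_apply, Matrix.mul_apply, Matrix.transpose_apply]
  exact Finset.sum_comm

/-- Cyclicity of the trace. This invariance under conjugation is the source of the equivariance of
`frameOp`. -/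
theorem frob_conj {P : Mat} (hP : P ∈ matSet G) (A B : Mat) :
    frob (star P * A * P) (star P * B * P) = frob A B := by
  have h : P * P.transpose = 1 := mul_star_of_mem_matSet hP
  have hs : star P = P.transpose := by
    rw [Matrix.star_eq_conjTranspose, Matrix.conjTranspose_eq_transpose_of_trivial]
  rw [frob_eq_trace, frob_eq_trace, hs]
  simp only [Matrix.transpose_mul, Matrix.transpose_transpose]
  calc (P.transpose * (A.transpose * P) * (P.transpose * B * P)).trace
      = (P.transpose * (A.transpose * (P * P.transpose) * B * P)).trace := by noncomm_ring
    _ = (P.transpose * (A.transpose * B * P)).trace := by rw [h]; simp [Matrix.mul_assoc]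
    _ = ((A.transpose * B) * (P * P.transpose)).trace := by
        rw [Matrix.trace_mul_comm, Matrix.mul_assoc]
    _ = _ := by rw [h, Matrix.mul_one]

theorem frob_sum_left {ι : Type*} (s : Finset ι) (A : ι → Mat) (B : Mat) :
    frob (∑ i ∈ s, A i) B = ∑ i ∈ s, frob (A i) B := by
  simp only [frob_eq_trace, Matrix.transpose_sum, Finset.sum_mul, Matrix.trace_sum]

theorem frob_sum_right {ι : Type*} (s : Finset ι) (A : Mat) (B : ι → Mat) :
    frob A (∑ i ∈ s, B i) = ∑ i ∈ s, frob A (B i) := by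
  simp only [frob_eq_trace, Finset.mul_sum, Matrix.trace_sum]

theorem frob_smul_left (c : ℝ) (A B : Mat) : frob (c • A) B = c * frob A B := by
  simp [frob_eq_trace]

theorem frob_smul_right (c : ℝ) (A B : Mat) : frob A (c • B) = c * frob A B := by
  simp [frob_eq_trace]

/-- Cauchy–Schwarz in each row. -/
theorem norm_sq_act_le (A : Mat) (q : Vec) : ‖act A q‖ ^ 2 ≤ frob A A * ‖q‖ ^ 2 := by
  rw [EuclideanSpace.real_norm_sq_eq, EuclideanSpace.real_norm_sq_eq, frob, Finset.sum_mul]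
  refine Finset.sum_le_sum fun j _ => ?_
  simpa [act, Matrix.mulVec, dotProduct, ← sq] using
    Finset.sum_mul_sq_le_sq_mul_sq Finset.univ (fun k => A j k) (fun k => q k)

variable {L : ℕ} {A : Fin L → Matrix (Fin m) (Fin m) ℝ}

theorem IsLieOrthonormalBasis.frob_eq (hA : IsLieOrthonormalBasis G A) (i j : Fin L) :
    frob (A i) (A j) = if i = j then 1 else 0 := hA.1 i j

theorem IsLieOrthonormalBasis.mem (hA : IsLieOrthonormalBasis G A) (i : Fin L) :
    A i ∈ lieAlg G := by
  rw [← hA.2]; exact Submodule.subset_span ⟨i, rfl⟩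

theorem IsLieOrthonormalBasis.eq_sum (hA : IsLieOrthonormalBasis G A) {B : Mat}
    (hB : B ∈ lieAlg G) : B = ∑ j, frob B (A j) • A j := by
  rw [← hA.2] at hB
  obtain ⟨c, rfl⟩ := (Submodule.mem_span_range_iff_exists_fun ℝ).1 hB
  refine Finset.sum_congr rfl fun j _ => ?_
  rw [frob_sum_left]
  simp [frob_smul_left, hA.frob_eq]

/-- Independent of the basis, which later makes the constant in the bound for `∇B` depend on `N`
only. -/
theorem IsLieOrthonormalBasis.norm_act_le (hA : IsLieOrthonormalBasis G A) (i : Fin L) (q : Vec) :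
    ‖act (A i) q‖ ≤ ‖q‖ := by
  have := norm_sq_act_le (A i) q
  rw [hA.frob_eq, if_pos rfl, one_mul] at this
  exact (sq_le_sq₀ (norm_nonneg _) (norm_nonneg _)).1 this

theorem conj_mem_lieAlg {P B : Mat} (hP : P ∈ matSet G) (hB : B ∈ lieAlg G) :
    star P * B * P ∈ lieAlg G := by
  have hinv : P⁻¹ = star P := Matrix.inv_eq_left_inv (star_mul_of_mem_matSet hP)
  have hu : IsUnit P := by
    rw [isUnit_iff_exists]
    exact ⟨star P, mul_star_of_mem_matSet hP, star_mul_of_mem_matSet hP⟩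
  rw [mem_lieAlg_iff]
  intro t
  have : t • (star P * B * P) = P⁻¹ * (t • B) * P := by
    rw [hinv, mul_smul_comm, smul_mul_assoc]
  rw [this, Matrix.exp_conj' P (t • B) hu, hinv]
  exact mul_mem_matSet (mul_mem_matSet (star_mem_matSet hP) (hB t)) hP

/-- The operator `v ↦ ∑ᵢ ⟨Aⁱ q, v⟩ Aⁱ q`. -/
def frameOp (A : Fin L → Mat) (q : Vec) : Vec →L[ℝ] Vec :=
  ∑ i, (innerSL ℝ (act (A i) q)).smulRight (act (A i) q)

theorem frameOp_apply (A : Fin L → Mat) (q v : Vec) :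
    frameOp A q v = ∑ i, ⟪act (A i) q, v⟫ • act (A i) q := by
  simp [frameOp]

/-- Conjugation carries the orthonormal basis to another one, related to it by an orthogonal matrix,
and `∑ a ⊗ a` over an orthonormal basis does not depend on the basis. -/
theorem frameOp_conj (hA : IsLieOrthonormalBasis G A) {P : Mat} (hP : P ∈ matSet G) (q : Vec) :
    frameOp (fun i => star P * A i * P) q = frameOp A q := by
  set c : Matrix (Fin L) (Fin L) ℝ := Matrix.of fun i j => frob (star P * A i * P) (A j)
  have hexp : ∀ i, star P * A i * P = ∑ j, c i j • A j := fun i =>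
    hA.eq_sum (conj_mem_lieAlg hP (hA.mem i))
  have hcc : c * c.transpose = 1 := by
    ext i j
    rw [Matrix.mul_apply, Matrix.one_apply, ← hA.frob_eq i j, ← frob_conj hP (A i) (A j),
      hexp j, frob_sum_right]
    simp only [frob_smul_right, Matrix.transpose_apply]
    exact Finset.sum_congr rfl fun k _ => by simp [c, mul_comm]
  -- The rows are orthonormal by `frob_conj`, but the sum over `i` below needs the columns; for a
  -- square matrix the two are equivalent.
  have hcc' : c.transpose * c = 1 := mul_eq_one_comm.1 hcc
  have hcol : ∀ j k, ∑ i, c i j * c i k = if j = k then 1 else 0 := by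
    intro j k
    have := congrFun (congrFun hcc' j) k
    rwa [Matrix.mul_apply, Matrix.one_apply] at this
  ext1 v
  simp only [frameOp_apply, hexp, act_sum, act_smul, sum_inner, inner_smul_left,
    Finset.smul_sum, smul_smul]
  rw [Finset.sum_comm]
  refine Finset.sum_congr rfl fun j _ => ?_
  rw [← Finset.sum_smul]
  congr 1
  simp only [RCLike.conj_to_real, Finset.sum_mul]
  rw [Finset.sum_comm]
  calc _ = ∑ k, (∑ i, c i k * c i j) * ⟪act (A k) q, v⟫ := by
        refine Finset.sum_congr rfl fun k _ => ?_
        rw [Finset.sum_mul]; exact Finset.sum_congr rfl fun i _ => by ring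
    _ = _ := by simp [hcol]

/-- Equivariance: the operators at two points of an orbit are conjugate, hence have the same
spectrum and satisfy the same polynomial identities. -/
theorem frameOp_act (hA : IsLieOrthonormalBasis G A) {P : Mat} (hP : P ∈ matSet G) (q : Vec) :
    frameOp A (act P q) * Matrix.toEuclideanCLM (n := Fin m) (𝕜 := ℝ) P =
      Matrix.toEuclideanCLM (n := Fin m) (𝕜 := ℝ) P * frameOp A q := by
  ext1 v
  change frameOp A (act P q) (act P v) = act P (frameOp A q v)
  have h : ∀ i, act (A i) (act P q) = act P (act (star P * A i * P) q) := fun i => by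
    rw [← act_mul, ← act_mul, ← mul_assoc, ← mul_assoc, mul_star_of_mem_matSet hP, one_mul]
  rw [← frameOp_conj hA hP q, frameOp_apply, frameOp_apply]
  simp only [h, inner_act_of_mem_matSet hP]
  simp only [act_eq_toEuclideanCLM, map_sum, map_smul]

/-- A symmetric operator `T` satisfies `T² f(T) = T` for some polynomial `f`. -/
theorem exists_polynomial_pseudoinverse (T : Vec →L[ℝ] Vec)
    (hT : (T : Vec →ₗ[ℝ] Vec).IsSymmetric) :
    ∃ f : Polynomial ℝ, T * T * Polynomial.aeval T f = T := by
  classical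
  have hn : Module.finrank ℝ Vec = m := by simp
  set b := hT.eigenvectorBasis hn
  set ev := hT.eigenvalues hn
  -- Interpolate `x ↦ x⁻¹` on the spectrum. The junk value `0⁻¹ = 0` is harmless, since `λ² f(λ) =
  -- λ` holds at `λ = 0` whatever `f(0)` is.
  refine ⟨Lagrange.interpolate (Finset.univ.image ev) id (fun x => x⁻¹), ?_⟩
  set f := Lagrange.interpolate (Finset.univ.image ev) id (fun x => x⁻¹)
  have hf : ∀ i, f.eval (ev i) = (ev i)⁻¹ := fun i =>
    Lagrange.eval_interpolate_at_node (v := id) (fun x => x⁻¹) Function.injective_id.injOn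
      (Finset.mem_image_of_mem _ (Finset.mem_univ i))
  have hTb : ∀ i, T (b i) = ev i • b i := fun i => hT.apply_eigenvectorBasis hn i
  have hfb : ∀ (g : Polynomial ℝ) i, Polynomial.aeval T g (b i) = g.eval (ev i) • b i := by
    intro g i
    induction g using Polynomial.induction_on' with
    | add p q hp hq => simp [add_smul, hp, hq]
    | monomial n a =>
      have : ∀ n : ℕ, (T ^ n) (b i) = ev i ^ n • b i := by
        intro n
        induction n with
        | zero => simp
        | succ n ih => rw [pow_succ', mul_apply_eq_comp, ih, map_smul, hTb, smul_smul,
            pow_succ]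
      rw [Polynomial.aeval_monomial, Polynomial.eval_monomial, mul_apply_eq_comp, this,
        map_smul, Algebra.algebraMap_eq_smul_one, _root_.smul_apply,
        one_apply_eq_self, smul_smul, mul_comm]
  have : ((T * T * Polynomial.aeval T f : Vec →L[ℝ] Vec) : Vec →ₗ[ℝ] Vec) = T := by
    refine b.toBasis.ext fun i => ?_
    simp only [OrthonormalBasis.coe_toBasis, ContinuousLinearMap.coe_coe,
      mul_apply_eq_comp, hfb, map_smul, hTb, hf, smul_smul]
    congr 1
    by_cases h : ev i = 0
    · simp [h]
    · field_simp
  exact ContinuousLinearMap.coe_injective this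

theorem frameOp_isSymmetric (A : Fin L → Mat) (q : Vec) :
    (frameOp A q : Vec →ₗ[ℝ] Vec).IsSymmetric := by
  intro v w
  simp only [ContinuousLinearMap.coe_coe, frameOp_apply, sum_inner, inner_sum, inner_smul_left,
    inner_smul_right, RCLike.conj_to_real]
  exact Finset.sum_congr rfl fun i _ => by rw [real_inner_comm v]; ring

theorem contDiff_act (A : Mat) : ContDiff ℝ ∞ fun q : Vec => act A q :=
  (Matrix.toEuclideanCLM (n := Fin m) (𝕜 := ℝ) A).contDiff

theorem contDiff_frameOp (A : Fin L → Mat) : ContDiff ℝ ∞ (frameOp A) := by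
  unfold frameOp
  refine ContDiff.sum fun i _ => ?_
  have h1 := contDiff_act (A i)
  exact ((innerSL ℝ).contDiff.comp h1).smulRight h1

theorem contDiff_aeval_frameOp (A : Fin L → Mat) (f : Polynomial ℝ) :
    ContDiff ℝ ∞ fun q => Polynomial.aeval (frameOp A q) f := by
  induction f using Polynomial.induction_on' with
  | add p q hp hq => simpa using hp.add hq
  | monomial n a =>
    simp only [Polynomial.aeval_monomial]
    exact contDiff_const.mul ((contDiff_frameOp A).pow n)

/-- Every orthonormal basis of the Lie algebra has an associated frame. -/
theorem exists_isFrame (hGc : IsClosed (G : Set (Matrix.orthogonalGroup (Fin m) ℝ)))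
    (hG : ActsTransitively G N) (hA : IsLieOrthonormalBasis G A) :
    ∃ Y : Fin L → Vec → Vec, IsFrame N A Y := by
  -- The polynomial is found at a single point `q₀`, and equivariance conjugates its identity to all
  -- of `N`. Hence the pseudoinverse below is smooth in `q` on the whole ambient space.
  obtain ⟨f, hf⟩ : ∃ f : Polynomial ℝ, ∀ q ∈ N,
      frameOp A q * frameOp A q * Polynomial.aeval (frameOp A q) f = frameOp A q := by
    rcases N.eq_empty_or_nonempty with rfl | ⟨q₀, hq₀⟩
    · exact ⟨0, by simp⟩
    obtain ⟨f, hf⟩ := exists_polynomial_pseudoinverse _ (frameOp_isSymmetric A q₀)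
    refine ⟨f, fun q hq => ?_⟩
    obtain ⟨P, hP, rfl⟩ := exists_matSet_act_eq hG hq₀ hq
    set R := Matrix.toEuclideanCLM (n := Fin m) (𝕜 := ℝ) P
    set S := Matrix.toEuclideanCLM (n := Fin m) (𝕜 := ℝ) (star P)
    have hRS : R * S = 1 := by rw [← map_mul, mul_star_of_mem_matSet hP, map_one]
    set M := frameOp A q₀
    set M' := frameOp A (act P q₀)
    have hint : M' * R = R * M := frameOp_act hA hP q₀
    have hpow : ∀ n : ℕ, M' ^ n * R = R * M ^ n := by
      intro n
      induction n with
      | zero => simp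
      | succ n ih => rw [pow_succ, mul_assoc, hint, ← mul_assoc, ih, mul_assoc, ← pow_succ]
    have hpoly : ∀ g : Polynomial ℝ, Polynomial.aeval M' g * R = R * Polynomial.aeval M g := by
      intro g
      induction g using Polynomial.induction_on' with
      | add p q hp hq => simp only [map_add, add_mul, mul_add, hp, hq]
      | monomial n a =>
        rw [Polynomial.aeval_monomial, Polynomial.aeval_monomial, mul_assoc, hpow, ← mul_assoc,
          ← mul_assoc, Algebra.commutes]
    calc M' * M' * Polynomial.aeval M' f
        = M' * (M' * (Polynomial.aeval M' f * R)) * S := by simp only [mul_assoc, hRS, mul_one]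
      _ = M' * (M' * R) * Polynomial.aeval M f * S := by rw [hpoly]; simp only [mul_assoc]
      _ = (M' * R) * M * Polynomial.aeval M f * S := by
          rw [hint]; simp only [← mul_assoc]; rw [hint]
      _ = R * (M * M * Polynomial.aeval M f) * S := by rw [hint]; simp only [mul_assoc]
      _ = M' * (R * S) := by rw [hf, ← hint, mul_assoc]
      _ = M' := by rw [hRS, mul_one]
  set F : Vec → (Vec →L[ℝ] Vec) := fun q => Polynomial.aeval (frameOp A q) f
  have hcomm : ∀ q, frameOp A q * F q = F q * frameOp A q := fun q =>
    by simpa using ((Polynomial.commute_X f).map (Polynomial.aeval (frameOp A q))).eq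
  have hspan : ∀ q v, frameOp A q v ∈ Submodule.span ℝ (Set.range fun i => act (A i) q) := by
    intro q v
    rw [frameOp_apply]
    exact Submodule.sum_mem _ fun i _ => Submodule.smul_mem _ _ (Submodule.subset_span ⟨i, rfl⟩)
  -- On the span of the `Aⁱ q`, `F` inverts `M`. The defect `w = X - M F X` satisfies `M w = 0`, so
  -- `0 = ⟨M w, w⟩ = ∑ ⟨Aⁱ q, w⟩²`; thus `w` is orthogonal to the span in which it lies.
  have hproj : ∀ q ∈ N, ∀ X ∈ Submodule.span ℝ (Set.range fun i => act (A i) q),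
      F q (frameOp A q X) = X := by
    intro q hq X hX
    set w := X - frameOp A q (F q X)
    have hw : w ∈ Submodule.span ℝ (Set.range fun i => act (A i) q) :=
      Submodule.sub_mem _ hX (hspan _ _)
    have h1 : frameOp A q w = 0 := by
      have := congrArg (fun T : Vec →L[ℝ] Vec => T X) (hf q hq)
      simp only [mul_apply_eq_comp] at this
      simp only [w, map_sub]
      rw [this, sub_self]
    have h2 : ∑ i, ⟪act (A i) q, w⟫ ^ 2 = 0 := by
      have : ⟪frameOp A q w, w⟫ = 0 := by rw [h1, inner_zero_left]
      rw [frameOp_apply, sum_inner] at this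
      simpa [inner_smul_left, ← sq] using this
    have h3 : ∀ i, ⟪act (A i) q, w⟫ = 0 := fun i => by
      have := (Finset.sum_eq_zero_iff_of_nonneg fun i _ => sq_nonneg _).1 h2 i (Finset.mem_univ i)
      exact pow_eq_zero_iff (two_ne_zero) |>.1 this
    have h4 : ∀ z ∈ Submodule.span ℝ (Set.range fun i => act (A i) q), ⟪z, w⟫ = 0 := by
      intro z hz
      induction hz using Submodule.span_induction with
      | mem x hx => obtain ⟨i, rfl⟩ := hx; exact h3 i
      | zero => simp
      | add x y _ _ hx hy => rw [inner_add_left, hx, hy, add_zero]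
      | smul c x _ hx => rw [inner_smul_left, hx, mul_zero]
    have h5 : w = 0 := inner_self_eq_zero.1 (h4 w hw)
    have h6 : X = (frameOp A q * F q) X := sub_eq_zero.1 h5
    conv_rhs => rw [h6, hcomm]
    rfl
  have hact : ∀ q, ∀ X ∈ Submodule.span ℝ (Set.range fun i => act (A i) q),
      ∃ B ∈ lieAlg G, act B q = X := by
    intro q X hX
    obtain ⟨c, rfl⟩ := (Submodule.mem_span_range_iff_exists_fun ℝ).1 hX
    refine ⟨∑ i, c i • A i, ?_, by simp [act_sum, act_smul]⟩
    rw [← hA.2]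
    exact Submodule.sum_mem _ fun i _ => Submodule.smul_mem _ _ (Submodule.subset_span ⟨i, rfl⟩)
  -- With this choice the frame identity is `X = F M X = ∑ ⟨Aⁱ q, X⟩ F (Aⁱ q)`.
  refine ⟨fun i q => F q (act (A i) q), fun i => ?_, fun i q hq => ?_, fun q hq X hX => ?_⟩
  · exact (contDiff_aeval_frameOp A f).clm_apply (contDiff_act (A i))
  · have h1 : act (A i) q ∈ Submodule.span ℝ (Set.range fun i => act (A i) q) :=
      Submodule.subset_span ⟨i, rfl⟩
    -- Write `Aⁱ q = F M Aⁱ q` and move `M` to the front: the field then takes values in the range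
    -- of `M`, hence in the tangent vectors.
    have h2 : F q (act (A i) q) = frameOp A q (F q (F q (act (A i) q))) := by
      have h3 : F q (F q (frameOp A q (act (A i) q))) =
          frameOp A q (F q (F q (act (A i) q))) := by
        have : F q * F q * frameOp A q = frameOp A q * (F q * F q) := by
          rw [mul_assoc, ← hcomm, ← mul_assoc, ← hcomm, mul_assoc]
        exact congrArg (fun T : Vec →L[ℝ] Vec => T (act (A i) q)) this
      rw [← h3, hproj q hq _ h1]
    obtain ⟨B, hB, hBq⟩ := hact q _ (h2 ▸ hspan q (F q (F q (act (A i) q))) :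
      F q (act (A i) q) ∈ Submodule.span ℝ (Set.range fun i => act (A i) q))
    beta_reduce
    rw [← hBq]
    exact act_mem_tangent hG hB hq
  · obtain ⟨B, hB, rfl⟩ := exists_lieAlg_of_mem_tangent hGc hG hq hX
    have h1 : act B q ∈ Submodule.span ℝ (Set.range fun i => act (A i) q) := by
      rw [hA.eq_sum hB, act_sum]
      exact Submodule.sum_mem _ fun i _ => by
        rw [act_smul]
        exact Submodule.smul_mem _ _ (Submodule.subset_span ⟨i, rfl⟩)
    conv_lhs => rw [← hproj q hq _ h1, frameOp_apply, map_sum]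
    simp only [map_smul]

/-- A frame for one orthonormal basis gives a frame for any other. -/
theorem IsFrame.change_basis {L' : ℕ} {B : Fin L' → Mat} {Y : Fin L → Vec → Vec}
    (hGc : IsClosed (G : Set (Matrix.orthogonalGroup (Fin m) ℝ))) (hG : ActsTransitively G N)
    (hA : IsLieOrthonormalBasis G A) (hB : IsLieOrthonormalBasis G B) (hY : IsFrame N A Y) :
    IsFrame N B fun i q => ∑ j, frob (B i) (A j) • Y j q := by
  refine ⟨fun i => ContDiff.sum fun j _ => (hY.1 j).const_smul _, fun i q hq => ?_,
    fun q hq X hX => ?_⟩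
  -- `tangent` is only a set of velocities; its linearity is borrowed from the Lie algebra.
  · choose a ha haq using fun j => exists_lieAlg_of_mem_tangent hGc hG hq (hY.2.1 j q hq)
    have : ∑ j, frob (B i) (A j) • Y j q = act (∑ j, frob (B i) (A j) • a j) q := by
      simp [act_sum, act_smul, haq]
    beta_reduce
    rw [this]
    refine act_mem_tangent hG ?_ hq
    rw [← hA.2]
    refine Submodule.sum_mem _ fun j _ => Submodule.smul_mem _ _ ?_
    have := ha j
    rwa [← hA.2] at this
  · conv_lhs => rw [hY.2.2 q hq X hX]
    simp only [Finset.smul_sum, smul_smul]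
    rw [Finset.sum_comm]
    refine Finset.sum_congr rfl fun j _ => ?_
    rw [← Finset.sum_smul]
    congr 1
    conv_lhs => rw [hB.eq_sum (hA.mem j), act_sum, sum_inner]
    refine Finset.sum_congr rfl fun i _ => ?_
    rw [act_smul, inner_smul_left, RCLike.conj_to_real, mul_comm]
    congr 1
    simp only [frob, mul_comm]

end Frames

end

/-! ### Linear algebra of covectors for a Gram matrix on the plane. -/

section

section CoframeAlgebra

open scoped MatrixOrder Matrix.Norms.L2Operator

variable {F : Type*} [NormedAddCommGroup F] [InnerProductSpace ℝ F]
  {F' : Type*} [NormedAddCommGroup F'] [InnerProductSpace ℝ F']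
  {g : Matrix (Fin 2) (Fin 2) ℝ}

/-- The vectors with coordinates the rows of `Q`; they are `g`-orthonormal if `g⁻¹ = Qᵀ Q`. -/
def rowVec (Q : Matrix (Fin 2) (Fin 2) ℝ) (a : Fin 2) : Plane := ∑ i, Q a i • e i

/-- A square root of the inverse Gram matrix amounts to an orthonormal pair of vectors. In it the
contraction and the norm are Euclidean sums, and the estimates below reduce to Cauchy–Schwarz. -/
theorem exists_inv_eq_transpose_mul (hg : g.PosDef) :
    ∃ Q : Matrix (Fin 2) (Fin 2) ℝ, g⁻¹ = Q.transpose * Q := by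
  obtain ⟨Q, hQ⟩ := CStarAlgebra.nonneg_iff_eq_star_mul_self.1 hg.inv.posSemidef.nonneg
  exact ⟨Q, by rw [hQ, Matrix.star_eq_conjTranspose, Matrix.conjTranspose_eq_transpose_of_trivial]⟩

theorem pairing_eq_sum {Q : Matrix (Fin 2) (Fin 2) ℝ} (hQ : g⁻¹ = Q.transpose * Q)
    (α : Plane →L[ℝ] ℝ) (D : Plane →L[ℝ] F) :
    pairing g α D = ∑ a, α (rowVec Q a) • D (rowVec Q a) := by
  simp only [pairing, hQ, rowVec, Matrix.mul_apply, Matrix.transpose_apply, Fin.sum_univ_two,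
    map_add, map_smul, smul_eq_mul]
  module

theorem normSq_eq_sum {Q : Matrix (Fin 2) (Fin 2) ℝ} (hQ : g⁻¹ = Q.transpose * Q)
    (D : Plane →L[ℝ] F) : normSq g D = ∑ a, ‖D (rowVec Q a)‖ ^ 2 := by
  simp only [normSq, hQ, rowVec, Matrix.mul_apply, Matrix.transpose_apply, Fin.sum_univ_two,
    map_add, map_smul, ← real_inner_self_eq_norm_sq, inner_add_left, inner_add_right,
    inner_smul_left, inner_smul_right, RCLike.conj_to_real]
  rw [real_inner_comm (D (e 0)) (D (e 1))]
  ring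

theorem normSq_nonneg (hg : g.PosDef) (D : Plane →L[ℝ] F) : 0 ≤ normSq g D := by
  obtain ⟨Q, hQ⟩ := exists_inv_eq_transpose_mul hg
  rw [normSq_eq_sum hQ]
  positivity

theorem norm_pairing_le (hg : g.PosDef) (α : Plane →L[ℝ] ℝ) (D : Plane →L[ℝ] F) :
    ‖pairing g α D‖ ≤ √(normSq g α) * √(normSq g D) := by
  obtain ⟨Q, hQ⟩ := exists_inv_eq_transpose_mul hg
  rw [normSq_eq_sum hQ, normSq_eq_sum hQ, pairing_eq_sum hQ]
  refine (norm_sum_le _ _).trans ?_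
  simp only [norm_smul]
  exact Real.sum_mul_le_sqrt_mul_sqrt _ _ _

theorem normSq_comp_le (hg : g.PosDef) (T : F →L[ℝ] F') (D : Plane →L[ℝ] F) :
    √(normSq g (T.comp D)) ≤ ‖T‖ * √(normSq g D) := by
  obtain ⟨Q, hQ⟩ := exists_inv_eq_transpose_mul hg
  rw [normSq_eq_sum hQ, normSq_eq_sum hQ]
  refine Real.sqrt_le_iff.2 ⟨by positivity, ?_⟩
  rw [mul_pow, Real.sq_sqrt (by positivity), Finset.mul_sum]
  refine Finset.sum_le_sum fun a _ => ?_
  rw [← mul_pow]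
  exact pow_le_pow_left₀ (norm_nonneg _) (T.le_opNorm _) 2

theorem normSq_smul (c : ℝ) (D : Plane →L[ℝ] F) : normSq g (c • D) = c ^ 2 * normSq g D := by
  simp only [normSq, _root_.smul_apply, inner_smul_left, inner_smul_right,
    RCLike.conj_to_real, Fin.sum_univ_two]
  ring

theorem normSq_comp_isometry (T : F →L[ℝ] F') (hT : ∀ v w, ⟪T v, T w⟫ = ⟪v, w⟫)
    (D : Plane →L[ℝ] F) : normSq g (T.comp D) = normSq g D := by
  simp [normSq, hT]

theorem normSq_smulRight (α : Plane →L[ℝ] ℝ) (v : F) :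
    normSq g (α.smulRight v) = normSq g α * ‖v‖ ^ 2 := by
  simp only [normSq, ContinuousLinearMap.smulRight_apply, inner_smul_left, inner_smul_right,
    RCLike.conj_to_real, Fin.sum_univ_two, real_inner_self_eq_norm_sq, RCLike.inner_apply]
  ring

/-- The expansion in `t` has no remainder; this is the density of the energy along a rotation
variation. -/
theorem normSq_add_smul_smulRight (hg : g.PosDef) (D : Plane →L[ℝ] F) (t : ℝ)
    (α : Plane →L[ℝ] ℝ) (v : F) :
    normSq g (D + t • α.smulRight v) = normSq g D +
      2 * t * pairing g α ((innerSL ℝ v).comp D) + t ^ 2 * (normSq g α * ‖v‖ ^ 2) := by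
  obtain ⟨Q, hQ⟩ := exists_inv_eq_transpose_mul hg
  rw [← normSq_smulRight, normSq_eq_sum hQ, normSq_eq_sum hQ, normSq_eq_sum hQ, pairing_eq_sum hQ,
    Finset.mul_sum, Finset.mul_sum, ← Finset.sum_add_distrib, ← Finset.sum_add_distrib]
  refine Finset.sum_congr rfl fun a _ => ?_
  simp only [_root_.add_apply, _root_.smul_apply,
    ContinuousLinearMap.smulRight_apply, ContinuousLinearMap.comp_apply, innerSL_apply_apply,
    smul_eq_mul]
  rw [norm_add_sq_real, inner_smul_right, inner_smul_right, norm_smul t, mul_pow,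
    real_inner_comm v, Real.norm_eq_abs, sq_abs]
  ring

theorem normSq_add_le (hg : g.PosDef) (D E : Plane →L[ℝ] F) :
    normSq g (D + E) ≤ 2 * normSq g D + 2 * normSq g E := by
  obtain ⟨Q, hQ⟩ := exists_inv_eq_transpose_mul hg
  rw [normSq_eq_sum hQ, normSq_eq_sum hQ, normSq_eq_sum hQ, Finset.mul_sum, Finset.mul_sum,
    ← Finset.sum_add_distrib]
  refine Finset.sum_le_sum fun a _ => ?_
  have h1 := norm_add_le (D (rowVec Q a)) (E (rowVec Q a))
  have h2 : ‖(D + E) (rowVec Q a)‖ ≤ ‖D (rowVec Q a)‖ + ‖E (rowVec Q a)‖ := h1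
  nlinarith [norm_nonneg ((D + E) (rowVec Q a)),
    sq_nonneg (‖D (rowVec Q a)‖ - ‖E (rowVec Q a)‖)]

/-- Expand `e i` in the orthonormal pair: the coefficients `(Q g)ₐᵢ` have square sum `gᵢᵢ`. This
turns an intrinsic bound into one for coordinate components. -/
theorem norm_apply_basis_sq_le (hg : g.PosDef) (D : Plane →L[ℝ] F) (i : Fin 2) :
    ‖D (e i)‖ ≤ √(g i i) * √(normSq g D) := by
  obtain ⟨Q, hQ⟩ := exists_inv_eq_transpose_mul hg
  have hdet : IsUnit g.det := hg.det_pos.ne'.isUnit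
  have hsymm : g.transpose = g := by
    rw [← Matrix.conjTranspose_eq_transpose_of_trivial]; exact hg.isHermitian
  have h1 : e i = ∑ a, (Q * g) a i • rowVec Q a := by
    have h : Q.transpose * (Q * g) = 1 := by
      rw [← Matrix.mul_assoc, ← hQ, Matrix.nonsing_inv_mul _ hdet]
    have h' : ∀ k, ∑ a, Q a k * (Q * g) a i = if k = i then 1 else 0 := fun k => by
      have := congrFun (congrFun h k) i
      rwa [Matrix.mul_apply, Matrix.one_apply] at this
    simp only [rowVec, Finset.smul_sum, smul_smul]
    rw [Finset.sum_comm]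
    simp only [← Finset.sum_smul]
    have : ∀ k, ∑ a, (Q * g) a i * Q a k = if k = i then 1 else 0 := fun k => by
      rw [← h' k]; exact Finset.sum_congr rfl fun a _ => mul_comm _ _
    simp [this]
  have h2 : ∑ a, (Q * g) a i ^ 2 = g i i := by
    have h : (Q * g).transpose * (Q * g) = g := by
      rw [Matrix.transpose_mul, hsymm, Matrix.mul_assoc, ← Matrix.mul_assoc Q.transpose, ← hQ,
        Matrix.nonsing_inv_mul _ hdet, Matrix.mul_one]
    have := congrFun (congrFun h i) i
    rw [Matrix.mul_apply] at this
    rw [← this]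
    exact Finset.sum_congr rfl fun a _ => by rw [Matrix.transpose_apply, sq]
  rw [normSq_eq_sum hQ, ← h2, h1, map_sum]
  refine (norm_sum_le _ _).trans ?_
  simp only [map_smul, norm_smul]
  refine (Real.sum_mul_le_sqrt_mul_sqrt _ _ _).trans (le_of_eq ?_)
  simp

/-- Invariance of the contraction under a linear change of coordinates. -/
theorem pairing_comp {g' : Matrix (Fin 2) (Fin 2) ℝ} (P : Matrix (Fin 2) (Fin 2) ℝ)
    (hP : IsUnit P.det) (hg' : g' = P.transpose * g * P) {T : Plane →L[ℝ] Plane}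
    (hT : ∀ j, T (e j) = ∑ i, P i j • e i) (α : Plane →L[ℝ] ℝ) (D : Plane →L[ℝ] F) :
    pairing g' (α.comp T) (D.comp T) = pairing g α D := by
  have hinv : P * g'⁻¹ * P.transpose = g⁻¹ := by
    have hPt : IsUnit P.transpose.det := by rwa [Matrix.det_transpose]
    rw [hg', Matrix.mul_inv_rev, Matrix.mul_inv_rev, ← Matrix.mul_assoc,
      Matrix.mul_nonsing_inv _ hP, Matrix.one_mul, Matrix.mul_assoc, Matrix.nonsing_inv_mul _ hPt,
      Matrix.mul_one]
  simp only [pairing, ← hinv, ContinuousLinearMap.comp_apply, hT, map_smul,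
    Matrix.mul_apply, Matrix.transpose_apply, Fin.sum_univ_two, smul_eq_mul, map_add]
  module

theorem normSq_comp {g' : Matrix (Fin 2) (Fin 2) ℝ} (P : Matrix (Fin 2) (Fin 2) ℝ)
    (hP : IsUnit P.det) (hg' : g' = P.transpose * g * P) {T : Plane →L[ℝ] Plane}
    (hT : ∀ j, T (e j) = ∑ i, P i j • e i) (D : Plane →L[ℝ] F) :
    normSq g' (D.comp T) = normSq g D := by
  have hinv : P * g'⁻¹ * P.transpose = g⁻¹ := by
    have hPt : IsUnit P.transpose.det := by rwa [Matrix.det_transpose]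
    rw [hg', Matrix.mul_inv_rev, Matrix.mul_inv_rev, ← Matrix.mul_assoc,
      Matrix.mul_nonsing_inv _ hP, Matrix.one_mul, Matrix.mul_assoc, Matrix.nonsing_inv_mul _ hPt,
      Matrix.mul_one]
  simp only [normSq, ← hinv, ContinuousLinearMap.comp_apply, hT, map_smul,
    Matrix.mul_apply, Matrix.transpose_apply, Fin.sum_univ_two, map_add, inner_add_left,
    inner_add_right, inner_smul_left, inner_smul_right, RCLike.conj_to_real]
  ring

/-- The covector `η` with `perp g η = α`. -/
def unperp (g : Matrix (Fin 2) (Fin 2) ℝ) (α : Plane →L[ℝ] ℝ) : Plane →L[ℝ] ℝ :=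
  (√g.det * ∑ j, g⁻¹ 1 j * α (e j)) • EuclideanSpace.proj 0 -
    (√g.det * ∑ j, g⁻¹ 0 j * α (e j)) • EuclideanSpace.proj 1

theorem unperp_e_zero (α : Plane →L[ℝ] ℝ) :
    unperp g α (e 0) = √g.det * ∑ j, g⁻¹ 1 j * α (e j) := by
  simp [unperp, e]

theorem unperp_e_one (α : Plane →L[ℝ] ℝ) :
    unperp g α (e 1) = -(√g.det * ∑ j, g⁻¹ 0 j * α (e j)) := by
  simp [unperp, e]

theorem plane_eq_sum (v : Plane) : v = ∑ j, v j • e j := by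
  ext i
  fin_cases i <;> simp [e, Fin.sum_univ_two]

theorem perp_unperp (hg : g.PosDef) (α : Plane →L[ℝ] ℝ) (v : Plane) :
    perp g (unperp g α) v = α v := by
  have hs : √g.det ≠ 0 := (Real.sqrt_pos.2 hg.det_pos).ne'
  have h : g * g⁻¹ = 1 := Matrix.mul_nonsing_inv _ hg.det_pos.ne'.isUnit
  have h' : ∀ i k, g i 0 * g⁻¹ 0 k + g i 1 * g⁻¹ 1 k = if i = k then 1 else 0 := fun i k => by
    have := congrFun (congrFun h i) k
    rwa [Matrix.mul_apply, Matrix.one_apply, Fin.sum_univ_two] at this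
  have h00 := h' 0 0
  have h01 := h' 0 1
  have h10 := h' 1 0
  have h11 := h' 1 1
  simp only [if_true, Fin.isValue, zero_ne_one, one_ne_zero, if_false] at h00 h01 h10 h11
  conv_rhs => rw [plane_eq_sum v]
  simp only [perp, unperp_e_zero, unperp_e_one, Fin.sum_univ_two, neg_neg, map_add, map_smul,
    smul_eq_mul]
  rw [inv_mul_eq_iff_eq_mul₀ hs]
  linear_combination √g.det * (v 0 * (α (e 0) * h00 + α (e 1) * h01) +
    v 1 * (α (e 0) * h10 + α (e 1) * h11))

/-- A rotation by a right angle is an isometry; in coordinates this is the adjugate formula for the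
inverse of a `2 × 2` matrix. -/
theorem normSq_unperp (hg : g.PosDef) (α : Plane →L[ℝ] ℝ) :
    normSq g (unperp g α) = normSq g α := by
  have hs : √g.det ^ 2 = g.det := Real.sq_sqrt hg.det_pos.le
  have hsymm : g 1 0 = g 0 1 := by simpa using hg.isHermitian.apply 0 1
  have hd := hg.det_pos.ne'
  simp only [normSq, unperp_e_zero, unperp_e_one, Fin.sum_univ_two, RCLike.inner_apply,
    RCLike.conj_to_real]
  have hinv : g⁻¹ = g.det⁻¹ • !![g 1 1, -g 0 1; -g 1 0, g 0 0] := by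
    rw [Matrix.inv_def, Matrix.adjugate_fin_two, Ring.inverse_eq_inv']
  have hdet : g.det = g 0 0 * g 1 1 - g 0 1 * g 0 1 := by rw [Matrix.det_fin_two, hsymm]
  simp only [hinv, Matrix.smul_apply, Matrix.of_apply, Matrix.cons_val', Matrix.cons_val_zero,
    Matrix.cons_val_one, Matrix.cons_val_fin_one, smul_eq_mul, hsymm]
  generalize hx : α (e 0) = x
  generalize hy : α (e 1) = y
  generalize hq : √g.det = s at hs ⊢
  field_simp
  rw [hs, hdet]
  ring

end CoframeAlgebra

end

/-! ### Mollification and weak derivatives in the plane. -/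

section

open Filter Topology Metric

section Mollification

variable {F : Type*} [NormedAddCommGroup F] [NormedSpace ℝ F]

/-- A sequence of bump functions shrinking to the origin. -/
def bumpSeq (k : ℕ) : ContDiffBump (0 : Plane) where
  rIn := 1 / (2 * ((k : ℝ) + 1))
  rOut := 1 / ((k : ℝ) + 1)
  rIn_pos := by positivity
  rIn_lt_rOut := by
    rw [one_div_lt_one_div (by positivity) (by positivity)]
    have : (0 : ℝ) < (k : ℝ) + 1 := by positivity
    linarith

theorem tendsto_bumpSeq_rOut : Tendsto (fun k => (bumpSeq k).rOut) atTop (𝓝 0) :=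
  tendsto_one_div_add_atTop_nhds_zero_nat

/-- Mollification on the plane. -/
def moll (k : ℕ) (f : Plane → F) : Plane → F :=
  convolution ((bumpSeq k).normed volume) f (ContinuousLinearMap.lsmul ℝ ℝ) volume

theorem moll_eq (k : ℕ) (f : Plane → F) (x : Plane) :
    moll k f x = ∫ t, (bumpSeq k).normed volume (x - t) • f t := convolution_lsmul_swap

theorem ae_tendsto_moll [CompleteSpace F] {f : Plane → F} (hf : LocallyIntegrable f) :
    ∀ᵐ x, Tendsto (fun k => moll k f x) atTop (𝓝 (f x)) := by
  -- Lebesgue differentiation needs radii in bounded ratio; here `rOut = 2 rIn`, hence `K = 2`.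
  refine ContDiffBump.ae_convolution_tendsto_right_of_locallyIntegrable (K := 2)
    tendsto_bumpSeq_rOut (Eventually.of_forall fun k => ?_) hf
  simp only [bumpSeq]
  apply le_of_eq
  field_simp

theorem contDiff_moll (k : ℕ) {f : Plane → F} (hf : LocallyIntegrable f) :
    ContDiff ℝ ∞ (moll k f) :=
  (bumpSeq k).hasCompactSupport_normed.contDiff_convolution_left (n := ⊤) _
    (bumpSeq k).contDiff_normed hf

theorem integrable_moll (k : ℕ) {f : Plane → F} (hf : Integrable f) : Integrable (moll k f) :=
  (bumpSeq k).integrable_normed.integrable_convolution _ hf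

/-- The kernel has total mass one. This fixes the masses in the Fatou argument for `L¹` convergence.
-/
theorem integral_moll_norm {E : Type*} [NormedAddCommGroup E] (k : ℕ) {f : Plane → E} (hf : Integrable f) :
    ∫ x, moll k (fun y => ‖f y‖) x = ∫ x, ‖f x‖ := by
  have := integral_convolution (μ := (volume : Measure Plane)) (ν := volume)
    (ContinuousLinearMap.lsmul ℝ ℝ) (bumpSeq k).integrable_normed hf.norm
  rw [(bumpSeq k).integral_normed] at this
  rw [ContinuousLinearMap.lsmul_apply, one_smul] at this
  exact this

theorem norm_moll_le (k : ℕ) (f : Plane → F) (x : Plane) :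
    ‖moll k f x‖ ≤ moll k (fun y => ‖f y‖) x := by
  rw [moll_eq, moll_eq]
  refine (norm_integral_le_integral_norm _).trans (le_of_eq ?_)
  congr 1
  ext t
  rw [norm_smul, Real.norm_of_nonneg ((bumpSeq k).nonneg_normed _), smul_eq_mul]

/-- Mollifications converge in `L¹`. -/
theorem tendsto_integral_norm_moll_sub [CompleteSpace F] {f : Plane → F} (hf : Integrable f) :
    Tendsto (fun k => ∫ x, ‖moll k f x - f x‖) atTop (𝓝 0) := by
  set c := ∫ x, ‖f x‖
  set a := fun k => ∫ x, ‖moll k f x - f x‖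
  -- These functions are nonnegative, have integral `2c - a k` and tend to `2 ‖f‖` almost
  -- everywhere. Fatou gives `2c ≤ liminf (2c - a k)`, so `a k → 0` without a dominating function.
  set Gk : ℕ → Plane → ℝ := fun k x =>
    moll k (fun y => ‖f y‖) x + ‖f x‖ - ‖moll k f x - f x‖
  have hint1 : ∀ k, Integrable (moll k (fun y => ‖f y‖)) := fun k => integrable_moll k hf.norm
  have hint2 : ∀ k, Integrable (fun x => ‖moll k f x - f x‖) := fun k =>
    ((integrable_moll k hf).sub hf).norm
  have hG0 : ∀ k x, 0 ≤ Gk k x := fun k x => by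
    have h1 := norm_sub_le (moll k f x) (f x)
    have h2 := norm_moll_le k f x
    simp only [Gk]; linarith
  have hGint : ∀ k, Integrable (Gk k) := fun k => ((hint1 k).add hf.norm).sub (hint2 k)
  have hGI : ∀ k, ∫ x, Gk k x = 2 * c - a k := fun k => by
    have h1 := integral_sub ((hint1 k).add hf.norm) (hint2 k)
    have h2 := integral_add (hint1 k) hf.norm
    rw [integral_moll_norm k hf] at h2
    simp only [Pi.add_apply] at h1
    rw [h2] at h1
    simp only [Gk, h1, c, a]; ring
  have hlim : ∀ᵐ x, Tendsto (fun k => Gk k x) atTop (𝓝 (2 * ‖f x‖)) := by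
    filter_upwards [ae_tendsto_moll hf.locallyIntegrable, ae_tendsto_moll hf.norm.locallyIntegrable]
      with x h1 h2
    have := (h2.add_const ‖f x‖).sub (h1.sub_const (f x)).norm
    simpa [Gk, two_mul] using this
  have hfatou : ENNReal.ofReal (2 * c) ≤
      liminf (fun k => ENNReal.ofReal (2 * c - a k)) atTop := by
    have h1 : ∫⁻ x, ENNReal.ofReal (2 * ‖f x‖) = ENNReal.ofReal (2 * c) := by
      rw [← ofReal_integral_eq_lintegral_ofReal (hf.norm.const_mul 2)
        (ae_of_all _ fun x => by positivity), integral_const_mul]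
    have h2 : ∀ k, ∫⁻ x, ENNReal.ofReal (Gk k x) = ENNReal.ofReal (2 * c - a k) := fun k => by
      rw [← ofReal_integral_eq_lintegral_ofReal (hGint k) (ae_of_all _ (hG0 k)), hGI]
    rw [← h1]
    simp only [← h2]
    refine le_trans (lintegral_mono_ae ?_) (lintegral_liminf_le' fun k =>
      (hGint k).aestronglyMeasurable.aemeasurable.ennreal_ofReal)
    filter_upwards [hlim] with x hx
    exact ((ENNReal.continuous_ofReal.tendsto _).comp hx).liminf_eq.ge
  have ha0 : ∀ k, 0 ≤ a k := fun k => integral_nonneg fun x => norm_nonneg _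
  have hc0 : 0 ≤ c := integral_nonneg fun x => norm_nonneg _
  rw [Metric.tendsto_atTop]
  intro ε hε
  rcases hc0.eq_or_lt with hc | hc
  · refine ⟨0, fun k _ => ?_⟩
    have h3 : 0 ≤ ∫ x, Gk k x := integral_nonneg (hG0 k)
    rw [hGI, ← hc] at h3
    have : a k = 0 := le_antisymm (by linarith) (ha0 k)
    rw [this]; simpa using hε
  -- The minimum with `c` keeps `2c - min ε c` nonnegative, so that the comparison survives the
  -- removal of `ENNReal.ofReal`; strictness uses `0 < c`.
  · have hlt : ENNReal.ofReal (2 * c - min ε c) < liminf (fun k => ENNReal.ofReal (2 * c - a k))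
        atTop := by
      refine lt_of_lt_of_le ?_ hfatou
      rw [ENNReal.ofReal_lt_ofReal_iff (by positivity)]
      linarith [lt_min hε hc]
    obtain ⟨K, hK⟩ := eventually_atTop.1 (eventually_lt_of_lt_liminf hlt)
    refine ⟨K, fun k hk => ?_⟩
    have h4 := (ENNReal.ofReal_lt_ofReal_iff_of_nonneg (by linarith [min_le_right ε c])).1 (hK k hk)
    rw [Real.dist_0_eq_abs, abs_of_nonneg (ha0 k)]
    linarith [min_le_left ε c]

end Mollification

section WeakDerivatives

variable {F : Type*} [NormedAddCommGroup F] [InnerProductSpace ℝ F]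
  {F' : Type*} [NormedAddCommGroup F'] [InnerProductSpace ℝ F']
  {U : Set Plane} {f : Plane → F} {f' : Plane → Plane →L[ℝ] F}

theorem integrable_smul_of_locallyIntegrableOn {E : Type*} [NormedAddCommGroup E]
    [NormedSpace ℝ E] {f : Plane → E} (hf : LocallyIntegrableOn f U)
    {φ : Plane → ℝ} (hφ : Continuous φ) (hφc : HasCompactSupport φ) (hφU : tsupport φ ⊆ U) :
    Integrable fun y => φ y • f y := by
  have h1 : IntegrableOn f (tsupport φ) := hf.integrableOn_compact_subset hφU hφc
  have h2 : IntegrableOn (fun y => φ y • f y) (tsupport φ) :=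
    h1.continuousOn_smul hφ.continuousOn hφc
  rw [← integrableOn_iff_integrable_of_support_subset (s := tsupport φ)]
  · exact h2
  · exact (Function.support_smul_subset_left _ _).trans (subset_tsupport _)

theorem LocallyIntegrableOn.clm_apply_const {E : Type*} [NormedAddCommGroup E]
    [NormedSpace ℝ E] {f' : Plane → Plane →L[ℝ] E} (hf : LocallyIntegrableOn f' U)
    (v : Plane) : LocallyIntegrableOn (fun y => f' y v) U :=
  (ContinuousLinearMap.apply ℝ E v).locallyIntegrableOn_comp hf

/-- The fundamental lemma of the calculus of variations, applied to the two coordinate components.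
-/
theorem HasWeakDerivOn.unique [CompleteSpace F] (hU : IsOpen U) {f₁ f₂ : Plane → Plane →L[ℝ] F}
    (h₁ : HasWeakDerivOn U f f₁) (h₂ : HasWeakDerivOn U f f₂) :
    ∀ᵐ y ∂(volume.restrict U), f₁ y = f₂ y := by
  have key : ∀ i, ∀ᵐ y ∂(volume : Measure Plane), y ∈ U → f₁ y (e i) - f₂ y (e i) = 0 := by
    intro i
    have hl₁ := LocallyIntegrableOn.clm_apply_const h₁.2.1 (e i)
    have hl₂ := LocallyIntegrableOn.clm_apply_const h₂.2.1 (e i)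
    refine hU.ae_eq_zero_of_integral_contDiff_smul_eq_zero (hl₁.sub hl₂) fun g hg hgc hgU => ?_
    have e₁ := h₁.2.2 g hg hgc hgU (e i)
    have e₂ := h₂.2.2 g hg hgc hgU (e i)
    simp only [smul_sub]
    rw [integral_sub (integrable_smul_of_locallyIntegrableOn hl₁ hg.continuous hgc hgU)
      (integrable_smul_of_locallyIntegrableOn hl₂ hg.continuous hgc hgU), sub_eq_zero]
    rw [e₁] at e₂
    exact neg_injective e₂
  rw [ae_restrict_iff' hU.measurableSet]
  filter_upwards [key 0, key 1] with y h0 h1 hy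
  ext1 v
  rw [plane_eq_sum v]
  simp only [Fin.sum_univ_two, map_add, map_smul]
  rw [sub_eq_zero.1 (h0 hy), sub_eq_zero.1 (h1 hy)]

theorem HasWeakDerivOn.congr (hU : MeasurableSet U) {g : Plane → F} {g' : Plane → Plane →L[ℝ] F}
    (h : HasWeakDerivOn U f f') (hfg : ∀ᵐ y ∂(volume.restrict U), f y = g y)
    (hfg' : ∀ᵐ y ∂(volume.restrict U), f' y = g' y) : HasWeakDerivOn U g g' := by
  refine ⟨h.1.congr hfg, h.2.1.congr hfg', fun φ hφ hφc hφU v => ?_⟩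
  rw [ae_restrict_iff' hU] at hfg hfg'
  have e1 : ∫ y, (fderiv ℝ φ y v) • g y = ∫ y, (fderiv ℝ φ y v) • f y := by
    refine integral_congr_ae ?_
    filter_upwards [hfg] with y hy
    by_cases hyU : y ∈ U
    · rw [hy hyU]
    · have : fderiv ℝ φ y = 0 := image_eq_zero_of_notMem_tsupport fun h =>
        hyU (hφU (tsupport_fderiv_subset ℝ h))
      simp [this]
  have e2 : ∫ y, φ y • g' y v = ∫ y, φ y • f' y v := by
    refine integral_congr_ae ?_
    filter_upwards [hfg'] with y hy
    by_cases hyU : y ∈ U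
    · rw [hy hyU]
    · have : φ y = 0 := image_eq_zero_of_notMem_tsupport fun h => hyU (hφU h)
      simp [this]
  rw [e1, e2, h.2.2 φ hφ hφc hφU v]

theorem HasWeakDerivOn.clm_comp [CompleteSpace F] [CompleteSpace F'] (h : HasWeakDerivOn U f f')
    (T : F →L[ℝ] F') : HasWeakDerivOn U (fun y => T (f y)) (fun y => T.comp (f' y)) := by
  refine ⟨T.locallyIntegrableOn_comp h.1,
    (ContinuousLinearMap.compL ℝ Plane F F' T).locallyIntegrableOn_comp h.2.1,
    fun φ hφ hφc hφU v => ?_⟩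
  have hd : Continuous fun y => fderiv ℝ φ y v :=
    (hφ.continuous_fderiv (by simp)).clm_apply continuous_const
  have hdc : HasCompactSupport fun y => fderiv ℝ φ y v := hφc.fderiv_apply ℝ v
  have hdU : tsupport (fun y => fderiv ℝ φ y v) ⊆ U := (tsupport_fderiv_apply_subset ℝ v).trans hφU
  have h1 := T.integral_comp_comm (integrable_smul_of_locallyIntegrableOn h.1 hd hdc hdU)
  have h2 := T.integral_comp_comm (integrable_smul_of_locallyIntegrableOn
    (LocallyIntegrableOn.clm_apply_const h.2.1 v) hφ.continuous hφc hφU)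
  simp only [map_smul] at h1 h2
  simp only [ContinuousLinearMap.comp_apply]
  rw [h1, h2, h.2.2 φ hφ hφc hφU v, map_neg]

theorem HasWeakDerivOn.add {g : Plane → F} {g' : Plane → Plane →L[ℝ] F}
    (hf : HasWeakDerivOn U f f') (hg : HasWeakDerivOn U g g') :
    HasWeakDerivOn U (fun y => f y + g y) (fun y => f' y + g' y) := by
  refine ⟨LocallyIntegrableOn.add hf.1 hg.1, LocallyIntegrableOn.add (f := f') (g := g') hf.2.1 hg.2.1,
    fun φ hφ hφc hφU v => ?_⟩
  have hd : Continuous fun y => fderiv ℝ φ y v :=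
    (hφ.continuous_fderiv (by simp)).clm_apply continuous_const
  have hdc : HasCompactSupport fun y => fderiv ℝ φ y v := hφc.fderiv_apply ℝ v
  have hdU : tsupport (fun y => fderiv ℝ φ y v) ⊆ U := (tsupport_fderiv_apply_subset ℝ v).trans hφU
  simp only [smul_add, _root_.add_apply]
  rw [integral_add (integrable_smul_of_locallyIntegrableOn hf.1 hd hdc hdU)
    (integrable_smul_of_locallyIntegrableOn hg.1 hd hdc hdU),
    integral_add (integrable_smul_of_locallyIntegrableOn
    (LocallyIntegrableOn.clm_apply_const hf.2.1 v) hφ.continuous hφc hφU)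
    (integrable_smul_of_locallyIntegrableOn
    (LocallyIntegrableOn.clm_apply_const hg.2.1 v) hφ.continuous hφc hφU),
    hf.2.2 φ hφ hφc hφU v, hg.2.2 φ hφ hφc hφU v, neg_add]

theorem HasWeakDerivOn.mono {V : Set Plane} (h : HasWeakDerivOn U f f') (hV : V ⊆ U) :
    HasWeakDerivOn V f f' :=
  ⟨h.1.mono_set hV, h.2.1.mono_set hV, fun φ hφ hφc hφV v => h.2.2 φ hφ hφc (hφV.trans hV) v⟩

theorem integral_fderiv_smul_eq_neg {E : Type*} [NormedAddCommGroup E] [NormedSpace ℝ E]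
    (hU : IsOpen U) {φ : Plane → ℝ} (hφ : ContDiff ℝ 1 φ) (hφc : HasCompactSupport φ)
    (hφU : tsupport φ ⊆ U) {G : Plane → E} (hG : ContDiffOn ℝ 1 G U) (v : Plane) :
    ∫ y, (fderiv ℝ φ y v) • G y = -∫ y, φ y • fderiv ℝ G y v := by
  have hd : Continuous fun y => fderiv ℝ φ y v :=
    (hφ.continuous_fderiv one_ne_zero).clm_apply continuous_const
  have hG0 : LocallyIntegrableOn G U := hG.continuousOn.locallyIntegrableOn hU.measurableSet
  have hG1 : LocallyIntegrableOn (fderiv ℝ G) U :=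
    (hG.continuousOn_fderiv_of_isOpen hU le_rfl).locallyIntegrableOn hU.measurableSet
  have h := integral_smul_fderiv_eq_neg_fderiv_smul_of_integrable (μ := (volume : Measure Plane))
    (f := φ) (g := G) (v := v)
    (integrable_smul_of_locallyIntegrableOn hG0 hd (hφc.fderiv_apply ℝ v)
      ((tsupport_fderiv_apply_subset ℝ v).trans hφU))
    (integrable_smul_of_locallyIntegrableOn (LocallyIntegrableOn.clm_apply_const hG1 v)
      hφ.continuous hφc hφU)
    (integrable_smul_of_locallyIntegrableOn hG0 hφ.continuous hφc hφU)
    (fun y _ => (hφ.differentiable one_ne_zero) y)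
    (fun y hy => (hG.contDiffAt (hU.mem_nhds (hφU hy))).differentiableAt one_ne_zero)
  rw [h, neg_neg]

/-- A `C¹` function is weakly differentiable. -/
theorem hasWeakDerivOn_of_contDiffOn (hU : IsOpen U) (hf : ContDiffOn ℝ 1 f U) :
    HasWeakDerivOn U f (fderiv ℝ f) :=
  ⟨hf.continuousOn.locallyIntegrableOn hU.measurableSet,
    (hf.continuousOn_fderiv_of_isOpen hU le_rfl).locallyIntegrableOn hU.measurableSet,
    fun _ hφ hφc hφU v => integral_fderiv_smul_eq_neg hU (hφ.of_le (by simp)) hφc hφU hf v⟩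

/-- Mollification commutes with weak differentiation. -/
theorem HasWeakDerivOn.hasFDerivAt_moll [CompleteSpace F] (h : HasWeakDerivOn U f f')
    {K : Set Plane} (hK : IsCompact K) (hKU : K ⊆ U) {k : ℕ} {x : Plane}
    (hx : closedBall x (bumpSeq k).rOut ⊆ K) :
    HasFDerivAt (moll k (K.indicator f)) (moll k (K.indicator f') x) x := by
  have hf : Integrable (K.indicator f) :=
    (integrable_indicator_iff hK.measurableSet).2 (h.1.integrableOn_compact_subset hKU hK)
  have hf' : Integrable (K.indicator f') :=
    (integrable_indicator_iff (f := f') hK.measurableSet).2 (h.2.1.integrableOn_compact_subset hKU hK)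
  have hb : ContDiff ℝ ∞ ((bumpSeq k).normed (volume : Measure Plane)) :=
    (bumpSeq k).contDiff_normed
  have hbc := (bumpSeq k).hasCompactSupport_normed (μ := (volume : Measure Plane))
  have h1 := hbc.hasFDerivAt_convolution_left (ContinuousLinearMap.lsmul ℝ ℝ)
    (hb.of_le (by simp)) hf.locallyIntegrable x
  suffices hEq : moll k (K.indicator f') x = (convolution (fderiv ℝ ((bumpSeq k).normed volume))
      (K.indicator f) ((ContinuousLinearMap.lsmul ℝ ℝ).precompL Plane) volume) x by
    rw [hEq]; exact h1
  -- The translated kernel is itself an admissible test function: its support lies in `K ⊆ U`, where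
  -- the indicator is invisible.
  set φ : Plane → ℝ := fun t => (bumpSeq k).normed volume (x - t)
  have hφ : ContDiff ℝ ∞ φ := hb.comp (contDiff_const.sub contDiff_id)
  have hsupp : Function.support φ ⊆ closedBall x (bumpSeq k).rOut := by
    intro t ht
    have : x - t ∈ Function.support ((bumpSeq k).normed (volume : Measure Plane)) := ht
    rw [(bumpSeq k).support_normed_eq, mem_ball_zero_iff] at this
    rw [mem_closedBall, dist_comm, dist_eq_norm]
    exact this.le
  have htsupp : tsupport φ ⊆ K :=
    (closure_minimal hsupp isClosed_closedBall).trans hx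
  have hφc : HasCompactSupport φ := hK.of_isClosed_subset (isClosed_tsupport _) htsupp
  have hfd : ∀ t v, fderiv ℝ φ t v = -fderiv ℝ ((bumpSeq k).normed volume) (x - t) v := by
    intro t v
    have e1 : HasFDerivAt (fun t : Plane => x - t) (-ContinuousLinearMap.id ℝ Plane) t := by
      simpa using (hasFDerivAt_id t).const_sub x
    have e2 := ((hb.differentiable (by simp)) (x - t)).hasFDerivAt.comp t e1
    change fderiv ℝ (((bumpSeq k).normed volume) ∘ fun t => x - t) t v = _
    rw [e2.fderiv]; simp
  ext1 v
  have hL : moll k (K.indicator f') x v = ∫ t, φ t • f' t v := by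
    rw [moll_eq, ContinuousLinearMap.integral_apply]
    · refine integral_congr_ae (ae_of_all _ fun t => ?_)
      by_cases ht : t ∈ K
      · simp [ht, φ]
      · have : φ t = 0 := image_eq_zero_of_notMem_tsupport fun h => ht (htsupp h)
        simp only [φ] at this
        simp [ht, φ, this]
    · refine integrable_smul_of_locallyIntegrableOn (U := univ) (φ := φ)
        (hf'.locallyIntegrable.locallyIntegrableOn _) hφ.continuous hφc (subset_univ _)
  have hR : (convolution (fderiv ℝ ((bumpSeq k).normed volume)) (K.indicator f)
      ((ContinuousLinearMap.lsmul ℝ ℝ).precompL Plane) volume) x v =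
      -∫ t, (fderiv ℝ φ t v) • f t := by
    rw [convolution_eq_swap, ContinuousLinearMap.integral_apply, ← integral_neg]
    · refine integral_congr_ae (ae_of_all _ fun t => ?_)
      simp only [ContinuousLinearMap.precompL_apply, ContinuousLinearMap.lsmul_apply]
      by_cases ht : t ∈ K
      · simp [ht, hfd]
      · have : fderiv ℝ φ t = 0 := image_eq_zero_of_notMem_tsupport fun h =>
          ht (htsupp (tsupport_fderiv_subset ℝ h))
        simp [ht, this]
    · have := (HasCompactSupport.convolutionExists_left
        ((ContinuousLinearMap.lsmul ℝ ℝ).precompL Plane) (hbc.fderiv ℝ)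
        (hb.continuous_fderiv (by simp)) hf.locallyIntegrable) x
      exact (this.integrable_swap :)
  rw [hL, hR, h.2.2 φ hφ hφc (htsupp.trans hKU) v, neg_neg]

end WeakDerivatives

end

/-! ### The chain rule for weak derivatives. -/

section

open Filter Topology Metric

section ChainRule

variable {H : Type*} [NormedAddCommGroup H] [InnerProductSpace ℝ H]
  {F : Type*} [NormedAddCommGroup F] [InnerProductSpace ℝ F]
  {U : Set Plane} {u : Plane → H} {u' : Plane → Plane →L[ℝ] H}

theorem locallyIntegrableOn_of_norm_le {E E' : Type*} [NormedAddCommGroup E]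
    [NormedAddCommGroup E'] {f : Plane → E} {g : Plane → E'} (hU : IsOpen U)
    (hf : LocallyIntegrableOn f U) (hg : AEStronglyMeasurable g (volume.restrict U)) {C : ℝ}
    (h : ∀ᵐ y ∂(volume.restrict U), ‖g y‖ ≤ C * ‖f y‖) : LocallyIntegrableOn g U := by
  rw [locallyIntegrableOn_iff hU.isLocallyClosed] at hf ⊢
  intro K hKU hK
  have hle : volume.restrict K ≤ volume.restrict U := Measure.restrict_mono hKU le_rfl
  exact Integrable.mono' ((hf K hKU hK).norm.const_mul C) (hg.mono_measure hle)
    (ae_mono hle h)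

theorem HasWeakDerivOn.aestronglyMeasurable (h : HasWeakDerivOn U u u') :
    AEStronglyMeasurable u (volume.restrict U) := h.1.aestronglyMeasurable

theorem HasWeakDerivOn.aestronglyMeasurable' (h : HasWeakDerivOn U u u') :
    AEStronglyMeasurable u' (volume.restrict U) := h.2.1.aestronglyMeasurable

theorem aestronglyMeasurable_clm_comp {α : Type*} [MeasurableSpace α] {μ : Measure α}
    {E₁ E₂ E₃ : Type*} [NormedAddCommGroup E₁] [NormedSpace ℝ E₁] [NormedAddCommGroup E₂]
    [NormedSpace ℝ E₂] [NormedAddCommGroup E₃] [NormedSpace ℝ E₃] {T : α → E₂ →L[ℝ] E₃}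
    {D : α → E₁ →L[ℝ] E₂} (hT : AEStronglyMeasurable T μ) (hD : AEStronglyMeasurable D μ) :
    AEStronglyMeasurable (fun a => (T a).comp (D a)) μ :=
  (ContinuousLinearMap.compL ℝ E₁ E₂ E₃).aestronglyMeasurable_comp₂ hT hD

/-- Chain rule for `Φ ∘ u` with `Φ` bounded with bounded derivative. -/
theorem HasWeakDerivOn.comp_of_bounded [CompleteSpace H] [CompleteSpace F] (hU : IsOpen U)
    (h : HasWeakDerivOn U u u') {Φ : H → F} (hΦ : ContDiff ℝ 1 Φ) {C : ℝ}
    (hC : ∀ q, ‖Φ q‖ ≤ C) (hC' : ∀ q, ‖fderiv ℝ Φ q‖ ≤ C) :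
    HasWeakDerivOn U (fun y => Φ (u y)) (fun y => (fderiv ℝ Φ (u y)).comp (u' y)) := by
  have hdΦ : Continuous (fderiv ℝ Φ) := hΦ.continuous_fderiv one_ne_zero
  refine ⟨?_, ?_, fun φ hφ hφc hφU v => ?_⟩
  · refine locallyIntegrableOn_of_norm_le (f := fun _ => (1 : ℝ)) (C := C) hU
      (continuous_const.continuousOn.locallyIntegrableOn hU.measurableSet)
      (hΦ.continuous.comp_aestronglyMeasurable h.aestronglyMeasurable)
      (ae_of_all _ fun y => by simpa using hC _)
  · refine locallyIntegrableOn_of_norm_le (C := C) hU h.2.1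
      (aestronglyMeasurable_clm_comp (hdΦ.comp_aestronglyMeasurable h.aestronglyMeasurable)
      h.aestronglyMeasurable') (ae_of_all _ fun y => ?_)
    exact (ContinuousLinearMap.opNorm_comp_le _ _).trans
      (mul_le_mul_of_nonneg_right (hC' _) (norm_nonneg _))
  -- A compact thickening of the support leaves room `δ` for mollification; truncating `u` to it
  -- makes everything integrable.
  · obtain ⟨δ, hδ, hδU⟩ := hφc.exists_cthickening_subset_open hU hφU
    set K := cthickening δ (tsupport φ)
    have hK : IsCompact K := IsCompact.cthickening hφc
    have hφK : tsupport φ ⊆ K := self_subset_cthickening _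
    set w := K.indicator u
    set w' := K.indicator u'
    have hw : Integrable w :=
      (integrable_indicator_iff hK.measurableSet).2 (h.1.integrableOn_compact_subset hδU hK)
    have hw' : Integrable w' :=
      (integrable_indicator_iff (f := u') hK.measurableSet).2
        (h.2.1.integrableOn_compact_subset hδU hK)
    have hφd : Continuous fun y => fderiv ℝ φ y v :=
      (hφ.continuous_fderiv (by simp)).clm_apply continuous_const
    have hφdc : HasCompactSupport fun y => fderiv ℝ φ y v := hφc.fderiv_apply ℝ v
    have hφd0 : ∀ y, y ∉ tsupport φ → fderiv ℝ φ y = 0 := fun y hy =>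
      image_eq_zero_of_notMem_tsupport fun h => hy (tsupport_fderiv_subset ℝ h)
    have hφ0 : ∀ y, y ∉ tsupport φ → φ y = 0 := fun y hy => image_eq_zero_of_notMem_tsupport hy
    have hev : ∀ᶠ k in atTop, (bumpSeq k).rOut < δ :=
      (tendsto_order.1 tendsto_bumpSeq_rOut).2 δ hδ
    have hibp : ∀ᶠ k in atTop, ∫ y, (fderiv ℝ φ y v) • Φ (moll k w y) =
        -∫ y, φ y • fderiv ℝ Φ (moll k w y) (moll k w' y v) := by
      filter_upwards [hev] with k hk
      have h1 : ContDiff ℝ 1 fun y => Φ (moll k w y) :=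
        hΦ.comp ((contDiff_moll k hw.locallyIntegrable).of_le (by simp))
      rw [integral_fderiv_smul_eq_neg hU (hφ.of_le (by simp)) hφc hφU h1.contDiffOn v]
      congr 1
      refine integral_congr_ae (ae_of_all _ fun y => ?_)
      beta_reduce
      by_cases hy : y ∈ tsupport φ
      · have h2 : closedBall y (bumpSeq k).rOut ⊆ K :=
          (closedBall_subset_closedBall hk.le).trans (closedBall_subset_cthickening hy δ)
        have h3 := h.hasFDerivAt_moll hK hδU h2
        have h4 := (hΦ.differentiable one_ne_zero (moll k w y)).hasFDerivAt.comp y h3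
        have h5 : fderiv ℝ (fun y => Φ (moll k w y)) y = _ := h4.fderiv
        rw [h5]; rfl
      · simp [hφ0 y hy]
    have hwlim := ae_tendsto_moll hw.locallyIntegrable
    have hmeas : ∀ k, AEStronglyMeasurable (moll k w) volume := fun k =>
      (contDiff_moll k hw.locallyIntegrable).continuous.aestronglyMeasurable
    have hlhs : Tendsto (fun k => ∫ y, (fderiv ℝ φ y v) • Φ (moll k w y)) atTop
        (𝓝 (∫ y, (fderiv ℝ φ y v) • Φ (w y))) := by
      refine tendsto_integral_of_dominated_convergence (fun y => ‖fderiv ℝ φ y v‖ * C)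
        (fun k => hφd.aestronglyMeasurable.smul
          (hΦ.continuous.comp_aestronglyMeasurable (hmeas k)))
        ((hφd.integrable_of_hasCompactSupport hφdc).norm.mul_const C)
        (fun k => ae_of_all _ fun y => ?_) ?_
      · rw [norm_smul]; exact mul_le_mul_of_nonneg_left (hC _) (norm_nonneg _)
      · filter_upwards [hwlim] with y hy
        exact ((hΦ.continuous.tendsto _).comp hy).const_smul _
    obtain ⟨B, hB⟩ : ∃ B, ∀ y, ‖φ y‖ ≤ B := hφ.continuous.bounded_above_of_compact_support hφc
    have hC0 : 0 ≤ C := (norm_nonneg _).trans (hC 0)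
    have hB0 : 0 ≤ B := (norm_nonneg _).trans (hB 0)
    have hdm : ∀ k, AEStronglyMeasurable (fun y => φ y • (fderiv ℝ Φ (moll k w y))) volume :=
      fun k => hφ.continuous.aestronglyMeasurable.smul
        (hdΦ.comp_aestronglyMeasurable (hmeas k))
    have hdb : ∀ k y, ‖φ y • (fderiv ℝ Φ (moll k w y))‖ ≤ B * C := fun k y => by
      rw [norm_smul]
      exact mul_le_mul (hB y) (hC' _) (norm_nonneg _) hB0
    have hw'v : AEStronglyMeasurable (fun y => w' y v) volume :=
      (ContinuousLinearMap.apply ℝ H v).continuous.comp_aestronglyMeasurable hw'.1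
    have hmw'v : ∀ k, AEStronglyMeasurable (fun y => moll k w' y v) volume := fun k =>
      (ContinuousLinearMap.apply ℝ H v).continuous.comp_aestronglyMeasurable
        (integrable_moll k hw').1
    have happ : ∀ (T : Plane → H →L[ℝ] F) (z : Plane → H), AEStronglyMeasurable T volume →
        AEStronglyMeasurable z volume → AEStronglyMeasurable (fun y => T y (z y)) volume :=
      fun T z hT hz =>
        (ContinuousLinearMap.id ℝ (H →L[ℝ] F)).aestronglyMeasurable_comp₂ hT hz
    -- Split the mollified derivative as `w' + (moll w' - w')`. With `w'` fixed, dominated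
    -- convergence applies; the remainder vanishes by `L¹` convergence and the bound on `fderiv ℝ
    -- Φ`.
    have hrhs1 : Tendsto (fun k => ∫ y, φ y • fderiv ℝ Φ (moll k w y) (w' y v)) atTop
        (𝓝 (∫ y, φ y • fderiv ℝ Φ (w y) (w' y v))) := by
      refine tendsto_integral_of_dominated_convergence (fun y => B * C * (‖w' y‖ * ‖v‖))
        (fun k => happ _ _ (hdm k) hw'v) ((hw'.norm.mul_const _).const_mul _)
        (fun k => ae_of_all _ fun y => ?_) ?_
      · exact ((φ y • (fderiv ℝ Φ (moll k w y))).le_opNorm _).trans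
          (mul_le_mul (hdb k y) ((w' y).le_opNorm v) (norm_nonneg _) (by positivity))
      · filter_upwards [hwlim] with y hy
        have h1 : Tendsto (fun k => fderiv ℝ Φ (moll k w y)) atTop (𝓝 (fderiv ℝ Φ (w y))) :=
          (hdΦ.tendsto _).comp hy
        exact (((ContinuousLinearMap.apply ℝ F (w' y v)).continuous.tendsto _).comp h1).const_smul _
    have hrhs2 : Tendsto (fun k => ∫ y, φ y • fderiv ℝ Φ (moll k w y) (moll k w' y v - w' y v))
        atTop (𝓝 0) := by
      have hz := (tendsto_integral_norm_moll_sub hw').const_mul (B * C * ‖v‖)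
      rw [mul_zero] at hz
      refine squeeze_zero_norm (fun k => ?_) hz
      rw [← integral_const_mul]
      refine norm_integral_le_of_norm_le
        (((integrable_moll k hw').sub hw').norm.const_mul _) (ae_of_all _ fun y => ?_)
      refine ((φ y • (fderiv ℝ Φ (moll k w y))).le_opNorm _).trans ?_
      rw [mul_assoc (B * C), mul_comm ‖v‖]
      exact mul_le_mul (hdb k y) ((moll k w' y - w' y).le_opNorm v) (norm_nonneg _)
        (by positivity)
    have hint1 : ∀ k, Integrable fun y => φ y • fderiv ℝ Φ (moll k w y) (w' y v) := fun k =>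
      Integrable.mono' ((hw'.norm.mul_const ‖v‖).const_mul (B * C))
        (happ _ _ (hdm k) hw'v) (ae_of_all _ fun y =>
        ((φ y • (fderiv ℝ Φ (moll k w y))).le_opNorm _).trans
          (mul_le_mul (hdb k y) ((w' y).le_opNorm v) (norm_nonneg _) (by positivity)))
    have hint2 : ∀ k, Integrable fun y =>
        φ y • fderiv ℝ Φ (moll k w y) (moll k w' y v - w' y v) := fun k =>
      Integrable.mono' ((((integrable_moll k hw').sub hw').norm.mul_const ‖v‖).const_mul (B * C))
        (happ _ _ (hdm k) ((hmw'v k).sub hw'v)) (ae_of_all _ fun y =>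
        ((φ y • (fderiv ℝ Φ (moll k w y))).le_opNorm _).trans
          (mul_le_mul (hdb k y) ((moll k w' y - w' y).le_opNorm v) (norm_nonneg _)
            (by positivity)))
    have hrhs : Tendsto (fun k => ∫ y, φ y • fderiv ℝ Φ (moll k w y) (moll k w' y v)) atTop
        (𝓝 (∫ y, φ y • fderiv ℝ Φ (w y) (w' y v))) := by
      have := hrhs1.add hrhs2
      rw [add_zero] at this
      refine this.congr fun k => ?_
      rw [← integral_add (hint1 k) (hint2 k)]
      refine integral_congr_ae (ae_of_all _ fun y => ?_)
      beta_reduce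
      rw [← smul_add, ← map_add, add_sub_cancel]
    have hfin := tendsto_nhds_unique (hlhs.congr' hibp) hrhs.neg
    have e1 : ∫ y, (fderiv ℝ φ y v) • Φ (u y) = ∫ y, (fderiv ℝ φ y v) • Φ (w y) := by
      refine integral_congr_ae (ae_of_all _ fun y => ?_)
      by_cases hy : y ∈ tsupport φ
      · simp [w, hφK hy]
      · simp [hφd0 y hy]
    have e2 : ∫ y, φ y • ((fderiv ℝ Φ (u y)).comp (u' y)) v =
        ∫ y, φ y • fderiv ℝ Φ (w y) (w' y v) := by
      refine integral_congr_ae (ae_of_all _ fun y => ?_)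
      by_cases hy : y ∈ tsupport φ
      · simp [w, w', hφK hy]
      · simp [hφ0 y hy]
    rw [e1, e2, hfin]

/-- Chain rule for an essentially bounded `u`. -/
theorem HasWeakDerivOn.comp_of_ae_bounded [FiniteDimensional ℝ H] [CompleteSpace F]
    (hU : IsOpen U) (h : HasWeakDerivOn U u u') {Φ : H → F} (hΦ : ContDiff ℝ 1 Φ) {R : ℝ}
    (hR : ∀ᵐ y ∂(volume.restrict U), ‖u y‖ ≤ R) :
    HasWeakDerivOn U (fun y => Φ (u y)) (fun y => (fderiv ℝ Φ (u y)).comp (u' y)) := by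
  have hcomp : CompleteSpace H := FiniteDimensional.complete ℝ H
  -- Cutting off `Φ` makes it bounded with bounded derivative. The margin `1` makes the cut-off
  -- equal to `Φ` near every point of norm at most `R`, so the derivatives agree as well.
  let χ : ContDiffBump (0 : H) := ⟨|R| + 1, |R| + 2, by positivity, by linarith⟩
  set Ψ : H → F := fun q => χ q • Φ q
  have hΨ : ContDiff ℝ 1 Ψ := χ.contDiff.smul hΦ
  have hΨc : HasCompactSupport Ψ := χ.hasCompactSupport.smul_right
  obtain ⟨C₁, hC₁⟩ := hΨ.continuous.bounded_above_of_compact_support hΨc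
  obtain ⟨C₂, hC₂⟩ := (hΨ.continuous_fderiv one_ne_zero).bounded_above_of_compact_support
    (hΨc.fderiv ℝ)
  have heq : ∀ q : H, ‖q‖ ≤ R → Ψ =ᶠ[𝓝 q] Φ := fun q hq => by
    have : ball (0 : H) (|R| + 1) ∈ 𝓝 q := isOpen_ball.mem_nhds (by
      rw [mem_ball_zero_iff]; linarith [le_abs_self R])
    filter_upwards [this] with z hz
    simp only [Ψ]
    rw [χ.one_of_mem_closedBall (ball_subset_closedBall hz), one_smul]
  refine (h.comp_of_bounded hU hΨ (C := max C₁ C₂) (fun q => (hC₁ q).trans (le_max_left _ _))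
    (fun q => (hC₂ q).trans (le_max_right _ _))).congr hU.measurableSet ?_ ?_
  · filter_upwards [hR] with y hy using (heq _ hy).eq_of_nhds
  · filter_upwards [hR] with y hy
    rw [(heq _ hy).fderiv_eq]

end ChainRule

end

/-! ### The `L¹` Poincaré inequality and primitives of mollified closed forms. -/

section

open Filter Topology Metric

section Potentials

open scoped ENNReal

/-- The homothety with centre `z` and ratio `t` has Jacobian `t²` in the plane. -/
theorem lintegral_comp_homothety {g : Plane → ℝ≥0∞} (hg : Measurable g) (z : Plane) {t : ℝ}
    (ht : t ≠ 0) :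
    ∫⁻ x, g (z + t • (x - z)) = ENNReal.ofReal (t ^ 2)⁻¹ * ∫⁻ x, g x := by
  have h1 : ∫⁻ x, g (z + t • (x - z)) = ∫⁻ x, g (z + t • x) :=
    lintegral_sub_right_eq_self (μ := (volume : Measure Plane)) (fun x => g (z + t • x)) z
  have h2 := Measure.map_addHaar_smul (volume : Measure Plane) ht
  have h3 : ∫⁻ x, g (z + t • x) = ∫⁻ y, g (z + y) ∂(Measure.map (t • ·) volume) := by
    rw [lintegral_map (by fun_prop) (by fun_prop)]
  rw [h1, h3, h2, lintegral_smul_measure,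
    lintegral_add_left_eq_self (μ := (volume : Measure Plane)) g z]
  simp

/-- The `L¹` Poincaré inequality on balls. -/
theorem lintegral_lintegral_enorm_sub_le {y₀ : Plane} {ρ : ℝ} {b : Plane → ℝ}
    {η : Plane → Plane →L[ℝ] ℝ} (hη : Continuous η)
    (hb : ∀ x ∈ ball y₀ ρ, HasFDerivAt b (η x) x) :
    ∫⁻ x in ball y₀ ρ, ∫⁻ z in ball y₀ ρ, ‖b x - b z‖ₑ ≤
      ENNReal.ofReal (2 * ρ) * (4 * volume (ball y₀ ρ)) * ∫⁻ x in ball y₀ ρ, ‖η x‖ₑ := by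
  set B := ball y₀ ρ
  set g : Plane → ℝ≥0∞ := B.indicator fun x => ‖η x‖ₑ
  have hg : Measurable g := hη.enorm.measurable.indicator measurableSet_ball
  have hI : ∫⁻ x in B, ‖η x‖ₑ = ∫⁻ x, g x := (lintegral_indicator measurableSet_ball _).symm
  have hm : ∀ x ∈ B, ∀ z ∈ B, ∀ t ∈ Icc (0 : ℝ) 1, z + t • (x - z) ∈ B := fun x hx z hz t ht =>
    (convex_ball y₀ ρ).add_smul_sub_mem hz hx ht
  -- The fundamental theorem of calculus along the segment from `z` to `x`, of length at most `2ρ`.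
  have hpt : ∀ x ∈ B, ∀ z ∈ B, ‖b x - b z‖ₑ ≤
      ENNReal.ofReal (2 * ρ) * ∫⁻ t in Ioc (0 : ℝ) 1, g (z + t • (x - z)) := by
    intro x hx z hz
    have hd : ∀ t ∈ uIcc (0 : ℝ) 1, HasDerivAt (fun t : ℝ => b (z + t • (x - z)))
        (η (z + t • (x - z)) (x - z)) t := by
      intro t ht
      rw [uIcc_of_le zero_le_one] at ht
      have h1 : HasDerivAt (fun t : ℝ => z + t • (x - z)) (x - z) t := by
        simpa using ((hasDerivAt_id t).smul_const (x - z)).const_add z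
      exact (hb _ (hm x hx z hz t ht)).comp_hasDerivAt t h1
    have hc : Continuous fun t : ℝ => η (z + t • (x - z)) (x - z) :=
      (hη.comp (by fun_prop)).clm_apply continuous_const
    have hftc := intervalIntegral.integral_eq_sub_of_hasDerivAt hd (hc.intervalIntegrable _ _)
    simp only [one_smul, zero_smul, add_zero, add_sub_cancel] at hftc
    rw [← hftc, intervalIntegral.integral_of_le zero_le_one,
      ← lintegral_const_mul' _ _ ENNReal.ofReal_ne_top]
    refine (enorm_integral_le_lintegral_enorm _).trans (setLIntegral_mono' measurableSet_Ioc ?_)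
    intro t ht
    have h2 : ‖x - z‖ₑ ≤ ENNReal.ofReal (2 * ρ) := by
      rw [← ofReal_norm]
      refine ENNReal.ofReal_le_ofReal ?_
      rw [← dist_eq_norm]
      have := dist_triangle_right x z y₀
      rw [mem_ball] at hx hz
      linarith
    simp only [g, indicator_of_mem (hm x hx z hz t ⟨ht.1.le, ht.2⟩)]
    rw [mul_comm]
    exact (ContinuousLinearMap.le_opENorm _ _).trans (mul_le_mul_right h2 _)
  have hfour : ∀ t : ℝ, 1 / 2 ≤ t → ENNReal.ofReal (t ^ 2)⁻¹ ≤ 4 := by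
    intro t ht
    have h4 : (4 : ℝ≥0∞) = ENNReal.ofReal 4 := by norm_num
    rw [h4]
    refine ENNReal.ofReal_le_ofReal ?_
    rw [inv_le_comm₀ (by positivity) (by norm_num)]
    nlinarith
  have hmeas3 : Measurable fun p : (Plane × Plane) × ℝ => g (p.1.2 + p.2 • (p.1.1 - p.1.2)) :=
    hg.comp (by fun_prop : Continuous fun p : (Plane × Plane) × ℝ =>
      p.1.2 + p.2 • (p.1.1 - p.1.2)).measurable
  -- The point `z + t (x - z)` is a homothety of ratio `t` in `x` and of ratio `1 - t` in `z`. One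
  -- of the ratios is at least `1/2`; integrating first in that variable costs a factor at most `4`.
  have ht : ∀ t : ℝ, ∫⁻ x in B, ∫⁻ z in B, g (z + t • (x - z)) ≤
      4 * volume B * ∫⁻ x, g x := by
    intro t
    rcases le_total (1 / 2) t with h | h
    · rw [lintegral_lintegral_swap]
      · calc _ ≤ ∫⁻ z in B, 4 * ∫⁻ x, g x := by
              refine lintegral_mono fun z => (setLIntegral_le_lintegral _ _).trans ?_
              rw [lintegral_comp_homothety hg z (by linarith)]
              exact mul_le_mul_left (hfour t h) _
          _ = _ := by rw [setLIntegral_const]; ring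
      · exact (hmeas3.comp (by fun_prop : Measurable fun p : Plane × Plane => (p, t))).aemeasurable
    · calc _ ≤ ∫⁻ x in B, 4 * ∫⁻ x, g x := by
            refine lintegral_mono fun x => (setLIntegral_le_lintegral _ _).trans ?_
            have : ∀ z, z + t • (x - z) = x + (1 - t) • (z - x) := fun z => by module
            simp only [this]
            rw [lintegral_comp_homothety hg x (by linarith)]
            exact mul_le_mul_left (hfour (1 - t) (by linarith)) _
        _ = _ := by rw [setLIntegral_const]; ring
  have hz : ∀ x, ∫⁻ z in B, ∫⁻ t in Ioc (0 : ℝ) 1, g (z + t • (x - z)) =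
      ∫⁻ t in Ioc (0 : ℝ) 1, ∫⁻ z in B, g (z + t • (x - z)) := fun x => by
    rw [lintegral_lintegral_swap]
    exact (hmeas3.comp (by fun_prop : Measurable fun p : Plane × ℝ => ((x, p.1), p.2))).aemeasurable
  calc _ ≤ ∫⁻ x in B, ∫⁻ z in B,
        ENNReal.ofReal (2 * ρ) * ∫⁻ t in Ioc (0 : ℝ) 1, g (z + t • (x - z)) := by
        refine setLIntegral_mono' measurableSet_ball fun x hx => ?_
        exact setLIntegral_mono' measurableSet_ball fun z hz => hpt x hx z hz
    _ = ENNReal.ofReal (2 * ρ) *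
        ∫⁻ x in B, ∫⁻ t in Ioc (0 : ℝ) 1, ∫⁻ z in B, g (z + t • (x - z)) := by
        simp only [lintegral_const_mul' _ _ ENNReal.ofReal_ne_top, hz]
    _ = ENNReal.ofReal (2 * ρ) *
        ∫⁻ t in Ioc (0 : ℝ) 1, ∫⁻ x in B, ∫⁻ z in B, g (z + t • (x - z)) := by
        have h1 : Measurable fun p : (Plane × ℝ) × Plane => g (p.2 + p.1.2 • (p.1.1 - p.2)) :=
          hg.comp (by fun_prop : Continuous fun p : (Plane × ℝ) × Plane =>
            p.2 + p.1.2 • (p.1.1 - p.2)).measurable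
        have h2 : Measurable fun p : Plane × ℝ => ∫⁻ z in B, g (z + p.2 • (p.1 - z)) :=
          h1.lintegral_prod_right' (ν := volume.restrict B)
        exact congrArg _ (lintegral_lintegral_swap (μ := volume.restrict B)
          (ν := volume.restrict (Ioc (0 : ℝ) 1))
          (f := fun x t => ∫⁻ z in B, g (z + t • (x - z))) h2.aemeasurable)
    _ ≤ ENNReal.ofReal (2 * ρ) * ∫⁻ t in Ioc (0 : ℝ) 1, 4 * volume B * ∫⁻ x, g x := by
        gcongr with t
        exact ht t
    _ = _ := by
        rw [setLIntegral_const, Real.volume_Ioc, hI]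
        simp [mul_assoc]

/-- The derivative falls on the kernel, so that distributional closedness can be tested with it. -/
theorem fderiv_moll_apply {E : Type*} [NormedAddCommGroup E] [NormedSpace ℝ E] (k : ℕ)
    {w : Plane → E} (hw : Integrable w) (x v : Plane) :
    fderiv ℝ (moll k w) x v =
      -∫ t, (fderiv ℝ (fun t => (bumpSeq k).normed (volume : Measure Plane) (x - t)) t v) • w t := by
  have hb : ContDiff ℝ ∞ ((bumpSeq k).normed (volume : Measure Plane)) :=
    (bumpSeq k).contDiff_normed
  have hbc := (bumpSeq k).hasCompactSupport_normed (μ := (volume : Measure Plane))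
  have h1 := hbc.hasFDerivAt_convolution_left (ContinuousLinearMap.lsmul ℝ ℝ)
    (hb.of_le (by simp)) hw.locallyIntegrable x
  have h2 : fderiv ℝ (moll k w) x = _ := h1.fderiv
  have hfd : ∀ t v, fderiv ℝ (fun t => (bumpSeq k).normed (volume : Measure Plane) (x - t)) t v =
      -fderiv ℝ ((bumpSeq k).normed volume) (x - t) v := by
    intro t v
    have e1 : HasFDerivAt (fun t : Plane => x - t) (-ContinuousLinearMap.id ℝ Plane) t := by
      simpa using (hasFDerivAt_id t).const_sub x
    have e2 := ((hb.differentiable (by simp)) (x - t)).hasFDerivAt.comp t e1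
    change fderiv ℝ (((bumpSeq k).normed volume) ∘ fun t => x - t) t v = _
    rw [e2.fderiv]; simp
  rw [h2, convolution_eq_swap, ContinuousLinearMap.integral_apply, ← integral_neg]
  · refine integral_congr_ae (ae_of_all _ fun t => ?_)
    simp only [ContinuousLinearMap.precompL_apply, ContinuousLinearMap.lsmul_apply, hfd, neg_smul,
      neg_neg]
  · have := (HasCompactSupport.convolutionExists_left
      ((ContinuousLinearMap.lsmul ℝ ℝ).precompL Plane) (hbc.fderiv ℝ)
      (hb.continuous_fderiv (by simp)) hw.locallyIntegrable) x
    exact (this.integrable_swap :)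

/-- `η` is closed on `U` in the sense of distributions. -/
def IsWeaklyClosedOn (U : Set Plane) (η : Plane → Plane →L[ℝ] ℝ) : Prop :=
  ∀ φ : Plane → ℝ, ContDiff ℝ ∞ φ → HasCompactSupport φ → tsupport φ ⊆ U → ∀ u v : Plane,
    ∫ y, (fderiv ℝ φ y u) • η y v = ∫ y, (fderiv ℝ φ y v) • η y u

theorem tsupport_bump_sub_subset (k : ℕ) (x : Plane) :
    tsupport (fun t => (bumpSeq k).normed (volume : Measure Plane) (x - t)) ⊆
      closedBall x (bumpSeq k).rOut := by
  refine closure_minimal (fun t ht => ?_) isClosed_closedBall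
  have : x - t ∈ Function.support ((bumpSeq k).normed (volume : Measure Plane)) := ht
  rw [(bumpSeq k).support_normed_eq, mem_ball_zero_iff] at this
  rw [mem_closedBall, dist_comm, dist_eq_norm]
  exact this.le

/-- Mollifications of closed forms are closed, hence exact on balls. -/
theorem exists_primitive_moll {y₀ : Plane} {ρ ρ' r : ℝ} (hρ'r : ρ' < r)
    {η : Plane → Plane →L[ℝ] ℝ} (hη : LocallyIntegrableOn η (ball y₀ r))
    (hcl : IsWeaklyClosedOn (ball y₀ r) η) {k : ℕ} (hk : ρ + (bumpSeq k).rOut ≤ ρ') :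
    ∃ b : Plane → ℝ, ∀ x ∈ ball y₀ ρ,
      HasFDerivAt b (moll k ((closedBall y₀ ρ').indicator η) x) x := by
  have hint : Integrable ((closedBall y₀ ρ').indicator η) :=
    (integrable_indicator_iff (f := η) measurableSet_closedBall).2
      (hη.integrableOn_compact_subset (closedBall_subset_ball hρ'r) (isCompact_closedBall _ _))
  set w := (closedBall y₀ ρ').indicator η
  -- The Poincaré lemma on a convex set asks for a symmetric derivative; written against the
  -- translated kernel, the symmetry is weak closedness.
  refine (convex_ball y₀ ρ).exists_forall_hasFDerivAt_of_fderiv_symmetric isOpen_ball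
    (((contDiff_moll k hint.locallyIntegrable).differentiable (by simp)).differentiableOn)
    fun x hx u v => ?_
  have hb : ContDiff ℝ ∞ ((bumpSeq k).normed (volume : Measure Plane)) :=
    (bumpSeq k).contDiff_normed
  set φ : Plane → ℝ := fun t => (bumpSeq k).normed volume (x - t)
  have hφ : ContDiff ℝ ∞ φ := hb.comp (contDiff_const.sub contDiff_id)
  have hsub : tsupport φ ⊆ closedBall y₀ ρ' :=
    (tsupport_bump_sub_subset k x).trans (closedBall_subset_closedBall' (by
      rw [mem_ball] at hx; linarith))
  have hφc : HasCompactSupport φ :=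
    (isCompact_closedBall y₀ ρ').of_isClosed_subset (isClosed_tsupport _) hsub
  have key : ∀ u v : Plane, fderiv ℝ (moll k w) x u v = -∫ t, (fderiv ℝ φ t u) • η t v := by
    intro u v
    rw [fderiv_moll_apply k hint, _root_.neg_apply, ContinuousLinearMap.integral_apply]
    · congr 1
      refine integral_congr_ae (ae_of_all _ fun t => ?_)
      by_cases ht : t ∈ closedBall y₀ ρ'
      · simp [w, ht, φ]
      · have : fderiv ℝ φ t = 0 := image_eq_zero_of_notMem_tsupport fun h =>
          ht (hsub (tsupport_fderiv_subset ℝ h))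
        simp only [φ] at this
        simp [φ, this]
    · exact integrable_smul_of_locallyIntegrableOn (U := univ)
        (hint.locallyIntegrable.locallyIntegrableOn _)
        ((hφ.continuous_fderiv (by simp)).clm_apply continuous_const) (hφc.fderiv_apply ℝ u)
        (subset_univ _)
  rw [key, key, hcl φ hφ hφc (hsub.trans (closedBall_subset_ball hρ'r)) u v]

end Potentials

end

/-! ### Potentials of weakly closed `L¹` forms on discs. -/

section

open Filter Topology Metric

section Potentials

open scoped ENNReal

theorem dist_toL1_eq {α E : Type*} [MeasurableSpace α] {μ : Measure α} [NormedAddCommGroup E]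
    {f g : α → E} (hf : Integrable f μ) (hg : Integrable g μ) :
    dist (hf.toL1 f) (hg.toL1 g) = ∫ x, ‖f x - g x‖ ∂μ := by
  have h := integral_norm_eq_lintegral_enorm (hf.sub hg).1
  simp only [Pi.sub_apply] at h
  rw [dist_edist, Integrable.edist_toL1_toL1, h]
  simp [edist_eq_enorm_sub]

theorem measureReal_ball_pos (y₀ : Plane) {r : ℝ} (hr : 0 < r) :
    0 < volume.real (ball y₀ r) :=
  ENNReal.toReal_pos (measure_ball_pos volume y₀ hr).ne' measure_ball_lt_top.ne

/-- Mean zero on the small ball gives `|B₀| |d x| ≤ ∫ |d x - d z| dz`; integrating in `x` leads to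
the double integral already estimated. The constant depends on the radii only, as needed for
differences of primitives. -/
theorem integral_norm_le_of_hasFDerivAt {y₀ : Plane} {ρ r₀ : ℝ} (hr₀ : 0 < r₀) (hr₀ρ : r₀ ≤ ρ) :
    ∃ C : ℝ, 0 ≤ C ∧ ∀ (d : Plane → ℝ) (θ : Plane → Plane →L[ℝ] ℝ), Integrable θ → Continuous θ →
      (∀ x ∈ ball y₀ ρ, HasFDerivAt d (θ x) x) → IntegrableOn d (ball y₀ ρ) →
      ∫ x in ball y₀ r₀, d x = 0 → ∫ x in ball y₀ ρ, ‖d x‖ ≤ C * ∫ x, ‖θ x‖ := by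
  set B := ball y₀ ρ
  set B₀ := ball y₀ r₀
  have hB₀ : B₀ ⊆ B := ball_subset_ball hr₀ρ
  set V := volume B₀
  have hV0 : V ≠ 0 := (measure_ball_pos volume y₀ hr₀).ne'
  have hVt : V ≠ ⊤ := measure_ball_lt_top.ne
  set c : ℝ≥0∞ := ENNReal.ofReal (2 * ρ) * (4 * volume B)
  have hc : c ≠ ⊤ := ENNReal.mul_ne_top ENNReal.ofReal_ne_top
    (ENNReal.mul_ne_top (by simp) measure_ball_lt_top.ne)
  refine ⟨(V⁻¹ * c).toReal, ENNReal.toReal_nonneg, fun d θ hθi hθ hd hdi hd0 => ?_⟩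
  have hpt : ∀ x, V * ‖d x‖ₑ ≤ ∫⁻ z in B, ‖d x - d z‖ₑ := by
    intro x
    have h1 : ∫ z in B₀, (d x - d z) = V.toReal * d x := by
      have hci : Integrable (fun _ : Plane => d x) (volume.restrict B₀) :=
        integrableOn_const measure_ball_lt_top.ne
      rw [integral_sub hci (hdi.mono_set hB₀), hd0, sub_zero]
      simp [V, Measure.real]
    calc V * ‖d x‖ₑ = ‖V.toReal * d x‖ₑ := by
          rw [enorm_mul, Real.enorm_of_nonneg ENNReal.toReal_nonneg, ENNReal.ofReal_toReal hVt]
      _ = ‖∫ z in B₀, (d x - d z)‖ₑ := by rw [h1]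
      _ ≤ ∫⁻ z in B₀, ‖d x - d z‖ₑ := enorm_integral_le_lintegral_enorm _
      _ ≤ _ := lintegral_mono_set hB₀
  have h2 : V * ∫⁻ x in B, ‖d x‖ₑ ≤ c * ∫⁻ x in B, ‖θ x‖ₑ := by
    rw [← lintegral_const_mul' _ _ hVt]
    exact (lintegral_mono hpt).trans (lintegral_lintegral_enorm_sub_le hθ hd)
  have h3 : ∫⁻ x in B, ‖d x‖ₑ ≤ V⁻¹ * c * ∫⁻ x, ‖θ x‖ₑ := by
    have h4 := mul_le_mul_right (h2.trans (mul_le_mul_right (setLIntegral_le_lintegral B _) c)) V⁻¹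
    rwa [← mul_assoc, ENNReal.inv_mul_cancel hV0 hVt, one_mul, ← mul_assoc] at h4
  rw [integral_norm_eq_lintegral_enorm hdi.1, integral_norm_eq_lintegral_enorm hθi.1,
    ← ENNReal.toReal_mul]
  refine ENNReal.toReal_mono (ENNReal.mul_ne_top (ENNReal.mul_ne_top (by simpa using hV0) hc) ?_) h3
  exact hθi.2.ne

/-- On a smaller ball, a closed `L¹_loc` form has a potential, normalized to have mean zero. -/
theorem exists_potential_smaller_ball {y₀ : Plane} {r r₀ ρ : ℝ} (hr₀ : 0 < r₀) (hr₀ρ : r₀ ≤ ρ)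
    (hρr : ρ < r) {η : Plane → Plane →L[ℝ] ℝ} (hη : LocallyIntegrableOn η (ball y₀ r))
    (hcl : IsWeaklyClosedOn (ball y₀ r) η) :
    ∃ B : Plane → ℝ, IntegrableOn B (ball y₀ ρ) ∧ HasWeakDerivOn (ball y₀ ρ) B η ∧
      ∫ x in ball y₀ r₀, B x = 0 := by
  -- With kernels of radius below `ρ₂ - ρ₁`, mollifying on the ball of radius `ρ₂` gives primitives
  -- on that of radius `ρ₁`, which are continuous, hence integrable, up to the boundary of the one
  -- of radius `ρ`.
  set ρ₁ := (2 * ρ + r) / 3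
  set ρ₂ := (ρ + 2 * r) / 3
  have h1 : ρ < ρ₁ := by simp only [ρ₁]; linarith
  have h12 : ρ₁ < ρ₂ := by simp only [ρ₁, ρ₂]; linarith
  have h2 : ρ₂ < r := by simp only [ρ₂]; linarith
  set D := ball y₀ ρ
  set w := (closedBall y₀ ρ₂).indicator η
  have hw : Integrable w :=
    (integrable_indicator_iff (f := η) measurableSet_closedBall).2
      (hη.integrableOn_compact_subset (closedBall_subset_ball h2) (isCompact_closedBall _ _))
  obtain ⟨K, hK⟩ := eventually_atTop.1
    ((tendsto_order.1 tendsto_bumpSeq_rOut).2 (ρ₂ - ρ₁) (by linarith))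
  set θ : ℕ → Plane → Plane →L[ℝ] ℝ := fun k => moll (k + K) w
  have hθc : ∀ k, Continuous (θ k) := fun k => (contDiff_moll _ hw.locallyIntegrable).continuous
  have hθi : ∀ k, Integrable (θ k) := fun k => integrable_moll _ hw
  have hθlim : Tendsto (fun k => ∫ x, ‖θ k x - w x‖) atTop (𝓝 0) :=
    (tendsto_add_atTop_iff_nat K).2 (tendsto_integral_norm_moll_sub hw)
  have hint : ∀ (b : Plane → ℝ) (ζ : Plane → Plane →L[ℝ] ℝ),
      (∀ x ∈ ball y₀ ρ₁, HasFDerivAt b (ζ x) x) → IntegrableOn b D := by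
    intro b ζ hb
    have : ContinuousOn b (closedBall y₀ ρ) := fun x hx =>
      (hb x (closedBall_subset_ball h1 hx)).continuousAt.continuousWithinAt
    exact (this.integrableOn_compact (isCompact_closedBall _ _)).mono_set ball_subset_closedBall
  have hex : ∀ k, ∃ b : Plane → ℝ, (∀ x ∈ ball y₀ ρ₁, HasFDerivAt b (θ k x) x) ∧
      ∫ x in ball y₀ r₀, b x = 0 := by
    intro k
    obtain ⟨b, hb⟩ := exists_primitive_moll (ρ := ρ₁) h2 hη hcl (k := k + K)
      (by linarith [hK (k + K) (by omega)])
    refine ⟨fun x => b x - (∫ x in ball y₀ r₀, b x) / volume.real (ball y₀ r₀),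
      fun x hx => (hb x hx).sub_const _, ?_⟩
    have hV : volume.real (ball y₀ r₀) ≠ 0 := (measureReal_ball_pos y₀ hr₀).ne'
    rw [integral_sub ((hint b _ hb).mono_set (ball_subset_ball hr₀ρ)) (integrableOn_const measure_ball_lt_top.ne)]
    simp only [integral_const, measureReal_restrict_apply_univ, smul_eq_mul]
    field_simp
    ring
  choose b hb hb0 using hex
  have hbi : ∀ k, Integrable (b k) (volume.restrict D) := fun k => hint _ _ (hb k)
  obtain ⟨C, hC, hCb⟩ := integral_norm_le_of_hasFDerivAt (y₀ := y₀) hr₀ hr₀ρ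
  -- The normalised primitives inherit the Cauchy property in `L¹` from the mollified forms.
  have hle : ∀ k l, dist ((hbi k).toL1 (b k)) ((hbi l).toL1 (b l)) ≤
      C * dist ((hθi k).toL1 (θ k)) ((hθi l).toL1 (θ l)) := by
    intro k l
    rw [dist_toL1_eq, dist_toL1_eq]
    refine hCb (fun x => b k x - b l x) (fun x => θ k x - θ l x) ((hθi k).sub (hθi l))
      ((hθc k).sub (hθc l)) (fun x hx => ?_) ((hbi k).sub (hbi l)) ?_
    · have hx' := ball_subset_ball h1.le hx
      exact (hb k x hx').sub (hb l x hx')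
    · rw [integral_sub (IntegrableOn.mono_set (hbi k) (ball_subset_ball hr₀ρ))
        (IntegrableOn.mono_set (hbi l) (ball_subset_ball hr₀ρ)), hb0, hb0, sub_zero]
  have hθcau : CauchySeq fun k => (hθi k).toL1 (θ k) := by
    refine Tendsto.cauchySeq (x := hw.toL1 w) ?_
    rw [tendsto_iff_dist_tendsto_zero]
    simpa only [dist_toL1_eq] using hθlim
  have hbcau : CauchySeq fun k => (hbi k).toL1 (b k) := by
    rw [Metric.cauchySeq_iff] at hθcau ⊢
    intro ε hε
    obtain ⟨n, hn⟩ := hθcau (ε / (C + 1)) (by positivity)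
    refine ⟨n, fun k hk l hl => (hle k l).trans_lt ?_⟩
    have := hn k hk l hl
    rw [lt_div_iff₀ (by positivity)] at this
    nlinarith [dist_nonneg (x := (hθi k).toL1 (θ k)) (y := (hθi l).toL1 (θ l))]
  obtain ⟨B, hB⟩ := cauchySeq_tendsto_of_complete hbcau
  have hBi : Integrable B (volume.restrict D) := L1.integrable_coeFn B
  have hBlim : Tendsto (fun k => ∫ x in D, ‖b k x - B x‖) atTop (𝓝 0) := by
    rw [tendsto_iff_dist_tendsto_zero] at hB
    have : hBi.toL1 B = B := Integrable.toL1_coeFn B hBi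
    rw [← this] at hB
    simpa only [dist_toL1_eq] using hB
  have hηl : LocallyIntegrableOn η D := hη.mono_set (ball_subset_ball hρr.le)
  refine ⟨B, hBi, ⟨IntegrableOn.locallyIntegrableOn hBi, hηl, fun φ hφ hφc hφD v => ?_⟩, ?_⟩
  · have hφd : Continuous fun y => fderiv ℝ φ y v :=
      (hφ.continuous_fderiv (by simp)).clm_apply continuous_const
    have hφdc : HasCompactSupport fun y => fderiv ℝ φ y v := hφc.fderiv_apply ℝ v
    have hφdD : tsupport (fun y => fderiv ℝ φ y v) ⊆ D :=
      (tsupport_fderiv_apply_subset ℝ v).trans hφD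
    have hBl : LocallyIntegrableOn (B : Plane → ℝ) D := IntegrableOn.locallyIntegrableOn hBi
    obtain ⟨M₁, hM₁⟩ := hφd.bounded_above_of_compact_support hφdc
    obtain ⟨M₂, hM₂⟩ := hφ.continuous.bounded_above_of_compact_support hφc
    have hθv : ∀ k, LocallyIntegrableOn (fun y => θ k y v) D := fun k =>
      ((hθc k).clm_apply continuous_const).continuousOn.locallyIntegrableOn measurableSet_ball
    have hηv : LocallyIntegrableOn (fun y => η y v) D :=
      LocallyIntegrableOn.clm_apply_const hηl v
    have hbl : ∀ k, LocallyIntegrableOn (b k) D := fun k =>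
      IntegrableOn.locallyIntegrableOn (hbi k)
    have hibp : ∀ k, ∫ y, (fderiv ℝ φ y v) • b k y = -∫ y, φ y • θ k y v := by
      intro k
      have := integral_bilinear_hasFDerivAt_right_eq_neg_left_of_integrable
        (μ := (volume : Measure Plane)) (f := φ) (f' := fderiv ℝ φ) (g := b k) (g' := θ k) (v := v)
        (B := ContinuousLinearMap.lsmul ℝ ℝ)
        (integrable_smul_of_locallyIntegrableOn (hbl k) hφd hφdc hφdD)
        (integrable_smul_of_locallyIntegrableOn (hθv k) hφ.continuous hφc hφD)
        (integrable_smul_of_locallyIntegrableOn (hbl k) hφ.continuous hφc hφD)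
        (fun x _ => ((hφ.differentiable (by simp)) x).hasFDerivAt)
        (fun x hx => hb k x (ball_subset_ball h1.le (hφD hx)))
      simp only [ContinuousLinearMap.lsmul_apply] at this
      rw [this, neg_neg]
    have hlhs : Tendsto (fun k => ∫ y, (fderiv ℝ φ y v) • b k y) atTop
        (𝓝 (∫ y, (fderiv ℝ φ y v) • B y)) := by
      rw [tendsto_iff_norm_sub_tendsto_zero]
      have hz := hBlim.const_mul M₁
      rw [mul_zero] at hz
      refine squeeze_zero (fun k => norm_nonneg _) (fun k => ?_) hz
      rw [← integral_sub (integrable_smul_of_locallyIntegrableOn (hbl k) hφd hφdc hφdD)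
        (integrable_smul_of_locallyIntegrableOn hBl hφd hφdc hφdD), ← integral_const_mul,
        ← setIntegral_eq_integral_of_forall_compl_eq_zero (s := D)]
      · refine norm_integral_le_of_norm_le (((hbi k).sub hBi).norm.const_mul _)
          (ae_of_all _ fun y => ?_)
        rw [← smul_sub, norm_smul]
        exact mul_le_mul_of_nonneg_right (hM₁ y) (norm_nonneg _)
      · intro y hy
        have : fderiv ℝ φ y v = 0 :=
          image_eq_zero_of_notMem_tsupport (f := fun y => fderiv ℝ φ y v) fun h => hy (hφdD h)
        simp [this]
    have hrhs : Tendsto (fun k => ∫ y, φ y • θ k y v) atTop (𝓝 (∫ y, φ y • η y v)) := by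
      rw [tendsto_iff_norm_sub_tendsto_zero]
      have hz := hθlim.const_mul (M₂ * ‖v‖)
      rw [mul_zero] at hz
      refine squeeze_zero (fun k => norm_nonneg _) (fun k => ?_) hz
      rw [← integral_sub (integrable_smul_of_locallyIntegrableOn (hθv k) hφ.continuous hφc hφD)
        (integrable_smul_of_locallyIntegrableOn hηv hφ.continuous hφc hφD), ← integral_const_mul]
      refine norm_integral_le_of_norm_le (((hθi k).sub hw).norm.const_mul _)
        (ae_of_all _ fun y => ?_)
      by_cases hy : y ∈ D
      · have hy' : y ∈ closedBall y₀ ρ₂ :=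
          (ball_subset_closedBall.trans (closedBall_subset_closedBall (by linarith))) hy
        have hwy : w y = η y := indicator_of_mem hy' _
        rw [← smul_sub, norm_smul, mul_assoc, hwy, mul_comm ‖v‖]
        exact mul_le_mul (hM₂ y) ((θ k y - η y).le_opNorm v) (norm_nonneg _)
          ((norm_nonneg _).trans (hM₂ y))
      · have : φ y = 0 := image_eq_zero_of_notMem_tsupport fun h => hy (hφD h)
        have hM₂0 : 0 ≤ M₂ := (norm_nonneg _).trans (hM₂ y)
        simp only [this, zero_smul, sub_zero, norm_zero]
        positivity
    exact tendsto_nhds_unique (hlhs.congr hibp) hrhs.neg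
  · have hsub : ball y₀ r₀ ⊆ D := ball_subset_ball hr₀ρ
    have : Tendsto (fun _ : ℕ => (0 : ℝ)) atTop (𝓝 (∫ x in ball y₀ r₀, B x)) := by
      rw [tendsto_iff_norm_sub_tendsto_zero]
      refine squeeze_zero (fun k => norm_nonneg _) (fun k => ?_) hBlim
      rw [← hb0 k, ← integral_sub (IntegrableOn.mono_set (hbi k) hsub) (IntegrableOn.mono_set hBi hsub)]
      refine (norm_integral_le_integral_norm _).trans ?_
      exact setIntegral_mono_set ((hbi k).sub hBi).norm (ae_of_all _ fun x => norm_nonneg _)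
        hsub.eventuallyLE
    exact tendsto_nhds_unique this tendsto_const_nhds

/-- A function with vanishing weak derivative on a ball is constant on smaller balls. -/
theorem HasWeakDerivOn.ae_eq_const {y₀ : Plane} {s ρ : ℝ} (hs : s < ρ) {f : Plane → ℝ}
    (h : HasWeakDerivOn (ball y₀ ρ) f fun _ => 0) :
    ∃ c, ∀ᵐ x ∂(volume : Measure Plane), x ∈ ball y₀ s → f x = c := by
  set s' := (s + ρ) / 2
  have h1 : s < s' := by simp only [s']; linarith
  have h2 : s' < ρ := by simp only [s']; linarith
  set K := closedBall y₀ s'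
  have hK : IsCompact K := isCompact_closedBall _ _
  have hKρ : K ⊆ ball y₀ ρ := closedBall_subset_ball h2
  set w := K.indicator f
  have hw : Integrable w :=
    (integrable_indicator_iff hK.measurableSet).2 (h.1.integrableOn_compact_subset hKρ hK)
  -- Fine mollifications have zero derivative on the inner ball, hence are constant there; almost
  -- everywhere convergence passes this to `f`.
  have hconst : ∀ᶠ k in atTop, ∀ x ∈ ball y₀ s, ∀ z ∈ ball y₀ s, moll k w x = moll k w z := by
    filter_upwards [(tendsto_order.1 tendsto_bumpSeq_rOut).2 (s' - s) (by linarith)] with k hk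
    have hd : ∀ x ∈ ball y₀ s, HasFDerivAt (moll k w) (0 : Plane →L[ℝ] ℝ) x := by
      intro x hx
      have := h.hasFDerivAt_moll hK hKρ (k := k) (x := x) (closedBall_subset_closedBall' (by
        rw [mem_ball] at hx; linarith))
      have h0 : moll k (K.indicator fun _ => (0 : Plane →L[ℝ] ℝ)) x = 0 := by
        rw [moll_eq]
        simp
      rwa [h0] at this
    intro x hx z hz
    refine (convex_ball y₀ s).is_const_of_fderivWithin_eq_zero (𝕜 := ℝ) (f := moll k w)
      (fun x hx => (hd x hx).differentiableAt.differentiableWithinAt) (fun x hx => ?_) hx hz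
    rw [fderivWithin_of_isOpen isOpen_ball hx, (hd x hx).fderiv]
  have hlim := ae_tendsto_moll hw.locallyIntegrable
  have hwf : ∀ x ∈ ball y₀ s, w x = f x := fun x hx =>
    indicator_of_mem (ball_subset_closedBall.trans (closedBall_subset_closedBall h1.le) hx) _
  by_cases hex : ∃ z ∈ ball y₀ s, Tendsto (fun k => moll k w z) atTop (𝓝 (w z))
  · obtain ⟨z, hz, hzl⟩ := hex
    refine ⟨f z, ?_⟩
    filter_upwards [hlim] with x hxl hx
    rw [← hwf x hx, ← hwf z hz]
    refine tendsto_nhds_unique hxl (hzl.congr' ?_)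
    filter_upwards [hconst] with k hk using hk z hz x hx
  -- No point of convergence in the inner ball means that the ball is null, and any constant will
  -- do.
  · refine ⟨0, ?_⟩
    filter_upwards [hlim] with x hxl hx
    exact absurd ⟨x, hx, hxl⟩ hex

/-- Every weakly closed `L¹_loc` form on a disc has a `W^{1,1}_loc` potential. -/
theorem exists_potential {y₀ : Plane} {r : ℝ} {η : Plane → Plane →L[ℝ] ℝ}
    (hη : LocallyIntegrableOn η (ball y₀ r)) (hcl : IsWeaklyClosedOn (ball y₀ r) η) :
    ∃ B : Plane → ℝ, HasWeakDerivOn (ball y₀ r) B η := by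
  rcases le_or_gt r 0 with hr | hr
  · refine ⟨0, ?_, hη, fun φ hφ hφc hφU v => ?_⟩
    · rw [ball_eq_empty.2 hr]; intro x hx; exact hx.elim
    · have : φ = 0 := by
        rw [ball_eq_empty.2 hr, subset_empty_iff, tsupport_eq_empty_iff] at hφU
        exact hφU
      subst this
      simp
  -- An exhaustion of the disc. The shift by `3` makes all radii exceed `r / 2`, the radius of the
  -- common ball on which the potentials are normalised.
  set ρ : ℕ → ℝ := fun n => r * (1 - 1 / ((n : ℝ) + 3))
  have hρr : ∀ n, ρ n < r := fun n => by
    have : (0 : ℝ) < 1 / ((n : ℝ) + 3) := by positivity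
    simp only [ρ]; nlinarith
  have hρm : StrictMono ρ := strictMono_nat_of_lt_succ fun n => by
    have : 1 / (((n + 1 : ℕ) : ℝ) + 3) < 1 / ((n : ℝ) + 3) := by
      apply one_div_lt_one_div_of_lt (by positivity); push_cast; linarith
    simp only [ρ]; nlinarith
  have hρ0 : ∀ n, r / 2 < ρ n := fun n => by
    refine lt_of_lt_of_le ?_ (hρm.monotone (Nat.zero_le n))
    simp only [ρ]; norm_num; linarith
  have hρlim : Tendsto ρ atTop (𝓝 r) := by
    have h1 : Tendsto (fun n : ℕ => 1 / ((n : ℝ) + 3)) atTop (𝓝 0) := by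
      have := (tendsto_add_atTop_iff_nat 2).2 (tendsto_one_div_add_atTop_nhds_zero_nat (𝕜 := ℝ))
      refine this.congr fun n => ?_
      push_cast; ring_nf
    simpa [ρ] using (h1.const_sub 1).const_mul r
  have hex : ∀ n, ∃ B : Plane → ℝ, IntegrableOn B (ball y₀ (ρ (n + 1))) ∧
      HasWeakDerivOn (ball y₀ (ρ (n + 1))) B η ∧ ∫ x in ball y₀ (r / 2), B x = 0 := fun n =>
    exists_potential_smaller_ball (by linarith) (hρ0 _).le (hρr _) hη hcl
  choose B hBi hBd hB0 using hex
  have hagree : ∀ n m, n ≤ m → ∀ᵐ x ∂(volume : Measure Plane), x ∈ ball y₀ (ρ n) →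
      B n x = B m x := by
    intro n m hnm
    have hsub : ball y₀ (ρ (n + 1)) ⊆ ball y₀ (ρ (m + 1)) :=
      ball_subset_ball (hρm.monotone (by omega))
    have hd : HasWeakDerivOn (ball y₀ (ρ (n + 1))) (fun x => B n x + (-1 : ℝ) • B m x)
        fun x => 0 := by
      have h1 := (hBd n).add (((hBd m).mono hsub).clm_comp ((-1 : ℝ) • ContinuousLinearMap.id ℝ ℝ))
      refine h1.congr measurableSet_ball (ae_of_all _ fun x => by simp) (ae_of_all _ fun x => ?_)
      ext v; simp
    obtain ⟨c, hc⟩ := hd.ae_eq_const (hρm (Nat.lt_succ_self n))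
    have hr2 : ball y₀ (r / 2) ⊆ ball y₀ (ρ n) := ball_subset_ball (hρ0 n).le
    have hr3 : ball y₀ (r / 2) ⊆ ball y₀ (ρ (n + 1)) := ball_subset_ball (hρ0 _).le
    -- Two potentials differ by a constant, which vanishes because both have mean zero on the ball
    -- of radius `r / 2`.
    have hc0 : c = 0 := by
      have h1 : ∫ x in ball y₀ (r / 2), (B n x + (-1 : ℝ) • B m x) = 0 := by
        have h3 := integral_add ((hBi n).mono_set hr3)
          (((hBi m).mono_set (hr3.trans hsub)).smul (-1 : ℝ))
        simp only [Pi.smul_apply] at h3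
        rw [h3, integral_smul, hB0, hB0]
        simp
      have h2 : ∫ x in ball y₀ (r / 2), (B n x + (-1 : ℝ) • B m x) =
          ∫ x in ball y₀ (r / 2), c := by
        refine setIntegral_congr_ae measurableSet_ball ?_
        filter_upwards [hc] with x hx hx' using hx (hr2 hx')
      rw [h1] at h2
      simp only [integral_const, measureReal_restrict_apply_univ, smul_eq_mul] at h2
      have hV : volume.real (ball y₀ (r / 2)) ≠ 0 :=
        (measureReal_ball_pos y₀ (by linarith)).ne'
      rcases mul_eq_zero.1 h2.symm with h | h
      · exact absurd h hV
      · exact h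
    filter_upwards [hc] with x hx hx'
    have := hx hx'
    rw [hc0, neg_one_smul] at this
    linarith
  -- Glue by using at `y` the potential of the first ball that contains `y`; almost everywhere this
  -- agrees with the later ones.
  set N : Plane → ℕ := fun y => sInf {n | y ∈ ball y₀ (ρ n)}
  refine ⟨fun y => B (N y) y, ?_⟩
  have hBn : ∀ n, ∀ᵐ y ∂(volume.restrict (ball y₀ (ρ n))), B n y = B (N y) y := by
    intro n
    rw [ae_restrict_iff' measurableSet_ball]
    have : ∀ᵐ y ∂(volume : Measure Plane), ∀ k, k ≤ n → y ∈ ball y₀ (ρ k) → B k y = B n y := by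
      rw [ae_all_iff]
      intro k
      by_cases hk : k ≤ n
      · filter_upwards [hagree k n hk] with y hy _ using hy
      · exact ae_of_all _ fun y h => absurd h hk
    filter_upwards [this] with y hy hyn
    have hN : N y ∈ {n | y ∈ ball y₀ (ρ n)} := Nat.sInf_mem ⟨n, hyn⟩
    exact (hy (N y) (Nat.sInf_le hyn) hN).symm
  have hweak : ∀ n, HasWeakDerivOn (ball y₀ (ρ n)) (fun y => B (N y) y) η := fun n =>
    ((hBd n).mono (ball_subset_ball (hρm.monotone (Nat.le_succ n)))).congr measurableSet_ball
      (hBn n) (ae_of_all _ fun _ => rfl)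
  refine ⟨fun x hx => ?_, hη, fun φ hφ hφc hφU v => ?_⟩
  · obtain ⟨n, hn⟩ := ((tendsto_order.1 hρlim).1 _ (mem_ball.1 hx)).exists
    have h1 := (hweak n).1 x hn
    rw [isOpen_ball.nhdsWithin_eq hn] at h1
    rwa [isOpen_ball.nhdsWithin_eq hx]
  -- By compactness, the support of the test function already lies in one ball of the exhaustion.
  · obtain ⟨n, hn⟩ : ∃ n, tsupport φ ⊆ ball y₀ (ρ n) := by
      refine hφc.isCompact.elim_directed_cover (fun n => ball y₀ (ρ n)) (fun n => isOpen_ball)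
        (fun x hx => ?_) (directed_of_isDirected_le fun n m hnm =>
          ball_subset_ball (hρm.monotone hnm))
      obtain ⟨n, hn⟩ := ((tendsto_order.1 hρlim).1 _ (mem_ball.1 (hφU hx))).exists
      exact mem_iUnion.2 ⟨n, hn⟩
    exact (hweak n).2.2 φ hφ hφc hn v

end Potentials

end

/-! ### Charts, the metric in coordinates and change of coordinates. -/

section

open Filter Topology Metric

set_option linter.unusedSectionVars false

section SurfaceGeometry

open Bundle

variable {S : Type u} [TopologicalSpace S] [ChartedSpace Plane S] [IsManifold 𝓘(ℝ, Plane) ∞ S]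
  {F : Type*} [NormedAddCommGroup F] [InnerProductSpace ℝ F]
  {h : Metric2 S} {c c' : OpenPartialHomeomorph S Plane} {y : Plane}

/-- The metric at `x`, as a bilinear form on the model space. -/
def metricForm (h : Metric2 S) (x : S) : Plane →L[ℝ] Plane →L[ℝ] ℝ := h.inner x

/-- The differential of the inverse chart, as an endomorphism of the model space. -/
def chartJac (c : OpenPartialHomeomorph S Plane) (y : Plane) : Plane →L[ℝ] Plane := chartD c y

/-- A one-form on `S`, with tangent spaces identified with the model space. -/
def formAt (D : OneForm S F) (x : S) : Plane →L[ℝ] F := D x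

theorem chartGram_apply (i j : Fin 2) : chartGram h c y i j =
    metricForm h (c.symm y) (chartJac c y (e i)) (chartJac c y (e j)) := rfl

theorem chartRep_eq (D : OneForm S F) :
    chartRep c D y = (formAt D (c.symm y)).comp (chartJac c y) := rfl

theorem metricForm_symm (x : S) (v w : Plane) : metricForm h x v w = metricForm h x w v :=
  h.symm x v w

theorem metricForm_pos (x : S) {v : Plane} (hv : v ≠ 0) : 0 < metricForm h x v v :=
  h.pos x v hv

theorem sum_smul_e_eq_toLp (v : Fin 2 → ℝ) : ∑ i, v i • e i = WithLp.toLp 2 v := by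
  ext j
  fin_cases j <;> simp [e]

theorem posDef_of_bilin (b : Plane →L[ℝ] Plane →L[ℝ] ℝ) (hs : ∀ v w, b v w = b w v)
    (hp : ∀ v, v ≠ 0 → 0 < b v v) {T : Plane →L[ℝ] Plane} (hT : Function.Injective T) :
    (Matrix.of fun i j => b (T (e i)) (T (e j)) : Matrix (Fin 2) (Fin 2) ℝ).PosDef := by
  refine Matrix.PosDef.of_dotProduct_mulVec_pos ?_ fun v hv => ?_
  · ext i j
    exact hs _ _
  · have h1 : T (∑ i, v i • e i) ≠ 0 := by
      intro h0
      apply hv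
      have := hT (h0.trans (map_zero T).symm)
      rw [sum_smul_e_eq_toLp] at this
      simpa using this
    have h2 := hp _ h1
    refine lt_of_lt_of_eq h2 ?_
    simp [Fin.sum_univ_two, dotProduct, Matrix.mulVec]
    ring

theorem gram_posDef (h : Metric2 S) (x : S) : (gram h x).PosDef :=
  posDef_of_bilin (metricForm h x) (metricForm_symm _) (fun _ hv => metricForm_pos x hv)
    (T := ContinuousLinearMap.id ℝ Plane) fun _ _ h => h

theorem mdifferentiable_of_mem_charts (hc : c ∈ charts S) :
    c.MDifferentiable 𝓘(ℝ, Plane) 𝓘(ℝ, Plane) :=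
  ⟨(contMDiffOn_of_mem_maximalAtlas hc).mdifferentiableOn (by simp),
    (contMDiffOn_symm_of_mem_maximalAtlas hc).mdifferentiableOn (by simp)⟩

theorem chartJac_bijective (hc : c ∈ charts S) (hy : y ∈ c.target) :
    Function.Bijective (chartJac c y) :=
  (mdifferentiable_of_mem_charts hc).symm.mfderiv_bijective (x := y) hy

theorem chartGram_posDef (h : Metric2 S) (hc : c ∈ charts S) (hy : y ∈ c.target) :
    (chartGram h c y).PosDef :=
  posDef_of_bilin (metricForm h (c.symm y)) (metricForm_symm _) (fun _ hv => metricForm_pos _ hv)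
    (chartJac_bijective hc hy).1

/-- The matrix of an endomorphism of the plane. -/
def planeMatrix (T : Plane →L[ℝ] Plane) : Matrix (Fin 2) (Fin 2) ℝ :=
  Matrix.of fun i j => T (e j) i

theorem apply_e_eq_sum (T : Plane →L[ℝ] Plane) (j : Fin 2) :
    T (e j) = ∑ i, planeMatrix T i j • e i := plane_eq_sum _

theorem gram_comp_eq (b : Plane →L[ℝ] Plane →L[ℝ] ℝ) (T P : Plane →L[ℝ] Plane) :
    (Matrix.of fun i j => b (T (P (e i))) (T (P (e j))) : Matrix (Fin 2) (Fin 2) ℝ) =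
      (planeMatrix P).transpose * (Matrix.of fun i j => b (T (e i)) (T (e j))) *
        planeMatrix P := by
  ext i j
  rw [Matrix.of_apply, apply_e_eq_sum P i, apply_e_eq_sum P j]
  simp [Matrix.mul_apply, Fin.sum_univ_two]
  ring

theorem planeMatrix_det (T : Plane →L[ℝ] Plane) : (planeMatrix T).det = T.det := by
  have h := LinearMap.det_toMatrix (EuclideanSpace.basisFun (Fin 2) ℝ).toBasis
    (T : Plane →ₗ[ℝ] Plane)
  change _ = LinearMap.det (T : Plane →ₗ[ℝ] Plane)
  rw [← h]
  congr 1

theorem isUnit_planeMatrix_det {T : Plane →L[ℝ] Plane} (hT : Function.Bijective T) :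
    IsUnit (planeMatrix T).det := by
  rw [planeMatrix_det]
  exact (LinearEquiv.ofBijective (T : Plane →ₗ[ℝ] Plane) hT).isUnit_det'

/-- The norm of one covector computed in two bases of the tangent space, related by the matrix of
`chartJac`. -/
theorem normSq_chartRep (hc : c ∈ charts S) (hy : y ∈ c.target) (D : OneForm S F) :
    normSq (chartGram h c y) (chartRep c D y) = formNormSq h D (c.symm y) :=
  normSq_comp (planeMatrix (chartJac c y)) (isUnit_planeMatrix_det (chartJac_bijective hc hy))
    (gram_comp_eq (metricForm h (c.symm y)) (ContinuousLinearMap.id ℝ Plane) (chartJac c y))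
    (apply_e_eq_sum _) (formAt D (c.symm y))

theorem pairing_chartRep (hc : c ∈ charts S) (hy : y ∈ c.target) (α : OneForm S ℝ)
    (D : OneForm S F) :
    pairing (chartGram h c y) (chartRep c α y) (chartRep c D y) =
      formPairing h α D (c.symm y) :=
  pairing_comp (planeMatrix (chartJac c y)) (isUnit_planeMatrix_det (chartJac_bijective hc hy))
    (gram_comp_eq (metricForm h (c.symm y)) (ContinuousLinearMap.id ℝ Plane) (chartJac c y))
    (apply_e_eq_sum _) (formAt α (c.symm y)) (formAt D (c.symm y))

theorem chartRep_inj (hc : c ∈ charts S) (hy : y ∈ c.target) {D E : OneForm S F}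
    (hDE : chartRep c D y = chartRep c E y) : formAt D (c.symm y) = formAt E (c.symm y) := by
  ext v
  obtain ⟨w, rfl⟩ := (chartJac_bijective hc hy).2 v
  exact DFunLike.congr_fun hDE w

theorem continuousOn_chartGram (h : Metric2 S) (hc : c ∈ charts S) :
    ContinuousOn (chartGram h c) c.target := by
  have hsm := contMDiffOn_symm_of_mem_maximalAtlas hc
  have hv : ∀ i, ContinuousOn
      (fun y => TotalSpace.mk' Plane (E := fun x : S => TangentSpace 𝓘(ℝ, Plane) x)
        (c.symm y) (chartD c y (e i))) c.target := by
    intro i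
    -- The coordinate vector fields are the tangent map of `c.symm` along constant sections, hence
    -- continuous into the tangent bundle.
    have h1 := hsm.continuousOn_tangentMapWithin (by simp) c.open_target.uniqueMDiffOn
    have h2 : Continuous (fun y : Plane => TotalSpace.mk' Plane
          (E := fun x : Plane => TangentSpace 𝓘(ℝ, Plane) x) y (e i)) :=
      (tangentBundleModelSpaceHomeomorph 𝓘(ℝ, Plane)).symm.continuous.comp
        (f := fun y : Plane => (y, e i)) (by fun_prop)
    refine (h1.comp h2.continuousOn fun y hy => hy).congr fun y hy => ?_
    simp only [Function.comp, tangentMapWithin]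
    rw [mfderivWithin_of_isOpen c.open_target hy]
    rfl
  have hh : ContinuousOn
      (fun y => TotalSpace.mk' (Plane →L[ℝ] Plane →L[ℝ] ℝ)
        (E := fun x : S => TangentSpace 𝓘(ℝ, Plane) x →L[ℝ] TangentSpace 𝓘(ℝ, Plane) x →L[ℝ] ℝ)
        (c.symm y) (h.inner (c.symm y))) c.target :=
    h.contMDiff.continuous.comp_continuousOn hsm.continuousOn
  refine continuousOn_pi.2 fun i => continuousOn_pi.2 fun j => fun y hy => ?_
  have h3 : ContinuousWithinAt (fun y => TotalSpace.mk' ℝ (E := Bundle.Trivial S ℝ) (c.symm y)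
      (h.inner (c.symm y) (chartD c y (e i)) (chartD c y (e j)))) c.target y :=
    (hh y hy).clm_bundle_apply₂ (F₁ := Plane) (F₂ := Plane) (hv i y hy) (hv j y hy)
  simp only [FiberBundle.continuousWithinAt_totalSpace] at h3
  exact h3.2

/-- The differential of the transition map from `c` to `c'`. -/
theorem chartJac_transition (hc : c ∈ charts S) (hc' : c' ∈ charts S) (hy : y ∈ c.target)
    (hy' : c.symm y ∈ c'.source) : ∃ T : Plane →L[ℝ] Plane,
      HasFDerivAt (fun z => c' (c.symm z)) T y ∧
      chartJac c y = (chartJac c' (c' (c.symm y))).comp T := by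
  have h1 := (mdifferentiable_of_mem_charts hc).mdifferentiableAt_symm hy
  have h2 := (mdifferentiable_of_mem_charts hc').mdifferentiableAt hy'
  have h3 := (mdifferentiable_of_mem_charts hc').mdifferentiableAt_symm
    (c'.map_source hy')
  have h4 : MDifferentiableAt 𝓘(ℝ, Plane) 𝓘(ℝ, Plane) (fun z => c' (c.symm z)) y :=
    MDifferentiableAt.comp y h2 h1
  refine ⟨fderiv ℝ (fun z => c' (c.symm z)) y,
    (mdifferentiableAt_iff_differentiableAt.1 h4).hasFDerivAt, ?_⟩
  have h5 := mfderiv_comp y h3 h4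
  rw [mfderiv_eq_fderiv] at h5
  have h6 : (c'.symm ∘ fun z => c' (c.symm z)) =ᶠ[𝓝 y] c.symm := by
    have : c.symm ⁻¹' c'.source ∈ 𝓝 y :=
      (c.symm.continuousAt hy).preimage_mem_nhds (c'.open_source.mem_nhds hy')
    filter_upwards [this] with z hz using c'.left_inv hz
  have h7 := h6.mfderiv_eq (I := 𝓘(ℝ, Plane)) (I' := 𝓘(ℝ, Plane))
  exact h7.symm.trans h5

theorem chartGram_transition (h : Metric2 S) (hy' : c.symm y ∈ c'.source)
    {T : Plane →L[ℝ] Plane} (hT : chartJac c y = (chartJac c' (c' (c.symm y))).comp T) :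
    chartGram h c y =
      (planeMatrix T).transpose * chartGram h c' (c' (c.symm y)) * planeMatrix T := by
  have h1 := gram_comp_eq (metricForm h (c.symm y)) (chartJac c' (c' (c.symm y))) T
  have h2 : chartGram h c' (c' (c.symm y)) = Matrix.of fun i j => metricForm h (c.symm y)
      (chartJac c' (c' (c.symm y)) (e i)) (chartJac c' (c' (c.symm y)) (e j)) := by
    ext i j
    rw [chartGram_apply, c'.left_inv hy']
    rfl
  rw [h2, ← h1]
  ext i j
  rw [chartGram_apply, hT]
  rfl

/-- The Jacobian factor that makes the chart measures agree on overlaps. -/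
theorem sqrt_det_chartGram_transition (h : Metric2 S) (hy' : c.symm y ∈ c'.source)
    {T : Plane →L[ℝ] Plane} (hT : chartJac c y = (chartJac c' (c' (c.symm y))).comp T) :
    √(chartGram h c y).det = |T.det| * √(chartGram h c' (c' (c.symm y))).det := by
  rw [chartGram_transition h hy' hT, Matrix.det_mul, Matrix.det_mul, Matrix.det_transpose,
    planeMatrix_det, mul_right_comm, ← pow_two, Real.sqrt_mul (sq_nonneg _), Real.sqrt_sq_eq_abs]

end SurfaceGeometry

end

/-! ### The Riemannian volume. -/

section

open Filter Topology Metric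

set_option linter.unusedSectionVars false

section SurfaceMeasure

variable {S : Type u} [TopologicalSpace S] [ChartedSpace Plane S] [IsManifold 𝓘(ℝ, Plane) ∞ S]
  [MeasurableSpace S] [BorelSpace S]
  {h : Metric2 S} {c c' : OpenPartialHomeomorph S Plane} {E : Set S}

theorem _root_.ContinuousOn.measurableSet_inter_preimage {X Y : Type*} [TopologicalSpace X]
    [MeasurableSpace X] [BorelSpace X] [TopologicalSpace Y] [MeasurableSpace Y] [BorelSpace Y]
    {f : X → Y} {s : Set X} (hf : ContinuousOn f s) (hs : MeasurableSet s) {t : Set Y}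
    (ht : MeasurableSet t) : MeasurableSet (s ∩ f ⁻¹' t) := by
  have h1 := hs.subtype_image ((continuousOn_iff_continuous_domRestrict.1 hf).measurable ht)
  convert h1 using 1
  ext x
  simp [and_comm]

theorem measurableSet_target_inter (c : OpenPartialHomeomorph S Plane) (hE : MeasurableSet E) :
    MeasurableSet (c.target ∩ c.symm ⁻¹' E) :=
  c.symm.continuousOn.measurableSet_inter_preimage c.open_target.measurableSet hE

theorem aemeasurable_symm (c : OpenPartialHomeomorph S Plane) :
    AEMeasurable c.symm (volume.restrict c.target) :=
  c.symm.continuousOn.aemeasurable c.open_target.measurableSet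

theorem aemeasurable_symm_withDensity (c : OpenPartialHomeomorph S Plane)
    (ρ : Plane → ENNReal) : AEMeasurable c.symm ((volume.restrict c.target).withDensity ρ) :=
  (aemeasurable_symm c).mono_ac (withDensity_absolutelyContinuous _ _)

theorem chartVolume_apply (h : Metric2 S) (c : OpenPartialHomeomorph S Plane)
    (hE : MeasurableSet E) : chartVolume h c E =
      ∫⁻ y in c.target ∩ c.symm ⁻¹' E, ENNReal.ofReal √(chartGram h c y).det := by
  rw [chartVolume, Measure.map_apply_of_aemeasurable (aemeasurable_symm_withDensity c _) hE,
    withDensity_apply', Measure.restrict_restrict' c.open_target.measurableSet, inter_comm]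

theorem chartVolume_inter_source (h : Metric2 S) (c : OpenPartialHomeomorph S Plane)
    (hE : MeasurableSet E) : chartVolume h c (E ∩ c.source) = chartVolume h c E := by
  rw [chartVolume_apply h c hE, chartVolume_apply h c (hE.inter c.open_source.measurableSet)]
  congr 2
  ext y
  simp only [mem_inter_iff, mem_preimage]
  exact ⟨fun H => ⟨H.1, H.2.1⟩, fun H => ⟨H.1, H.2, c.map_target H.1⟩⟩

/-- Change of variables by the transition map, whose Jacobian is absorbed by the transformation of
the density. -/
theorem chartVolume_eq_of_subset (h : Metric2 S) (hc : c ∈ charts S) (hc' : c' ∈ charts S)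
    (hE : MeasurableSet E) (hEc : E ⊆ c.source) (hEc' : E ⊆ c'.source) :
    chartVolume h c E = chartVolume h c' E := by
  rw [chartVolume_apply h c hE, chartVolume_apply h c' hE]
  set s := c.target ∩ c.symm ⁻¹' E
  have hs : MeasurableSet s := measurableSet_target_inter c hE
  have hT : ∀ y ∈ s, ∃ T : Plane →L[ℝ] Plane, HasFDerivAt (fun z => c' (c.symm z)) T y ∧
      chartJac c y = (chartJac c' (c' (c.symm y))).comp T := fun y hy =>
    chartJac_transition hc hc' hy.1 (hEc' hy.2)
  choose! T hT1 hT2 using hT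
  have himg : c'.target ∩ c'.symm ⁻¹' E = (fun z => c' (c.symm z)) '' s := by
    ext z
    constructor
    · rintro ⟨hz1, hz2⟩
      refine ⟨c (c'.symm z), ⟨c.map_source (hEc hz2), ?_⟩, ?_⟩
      · simp only [mem_preimage]
        rwa [c.left_inv (hEc hz2)]
      · simp only
        rw [c.left_inv (hEc hz2), c'.right_inv hz1]
    · rintro ⟨y, hy, rfl⟩
      refine ⟨c'.map_source (hEc' hy.2), ?_⟩
      simp only [mem_preimage]
      rw [c'.left_inv (hEc' hy.2)]
      exact hy.2
  have hinj : InjOn (fun z => c' (c.symm z)) s := fun y hy z hz hyz =>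
    c.symm.injOn hy.1 hz.1 (c'.injOn (hEc' hy.2) (hEc' hz.2) hyz)
  rw [himg, lintegral_image_eq_lintegral_abs_det_fderiv_mul volume hs
    (fun y hy => (hT1 y hy).hasFDerivWithinAt) hinj]
  refine setLIntegral_congr_fun hs fun y hy => ?_
  rw [sqrt_det_chartGram_transition h (hEc' hy.2) (hT2 y hy), ENNReal.ofReal_mul (abs_nonneg _)]

theorem continuousOn_density (h : Metric2 S) (hc : c ∈ charts S) :
    ContinuousOn (fun y => √(chartGram h c y).det) c.target :=
  ((continuous_id (X := Matrix (Fin 2) (Fin 2) ℝ)).matrix_det.sqrt).comp_continuousOn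
    (continuousOn_chartGram h hc)

theorem chartVolume_le_vol (h : Metric2 S) (hc : c ∈ charts S) : chartVolume h c ≤ vol h :=
  le_iSup₂ (f := fun c (_ : c ∈ charts S) => chartVolume h c) c hc

variable [CompactSpace S]

/-- Compactness gives a countable atlas. Inserting `c` makes the family nonempty, so that `ℕ` can
enumerate it. -/
theorem exists_chart_cover (hc : c ∈ charts S) : ∃ d : ℕ → OpenPartialHomeomorph S Plane,
    (∀ n, d n ∈ charts S) ∧ ⋃ n, (d n).source = univ := by
  obtain ⟨s, hs, hcov⟩ := countable_cover_nhds (X := S)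
    (U := fun x => (chartAt Plane x).source) fun x =>
      (chartAt Plane x).open_source.mem_nhds (mem_chart_source Plane x)
  obtain ⟨d, hd⟩ := (((hs.image fun x => chartAt Plane x)).insert c).exists_eq_range
    (insert_nonempty _ _)
  refine ⟨d, fun n => ?_, ?_⟩
  · have : d n ∈ insert c ((fun x => chartAt Plane x) '' s) := hd ▸ mem_range_self n
    rcases this with h | ⟨x, -, h⟩
    · rwa [h]
    · rw [← h]; exact IsManifold.chart_mem_maximalAtlas x
  · rw [eq_univ_iff_forall] at hcov ⊢
    intro x
    obtain ⟨z, hz, hx⟩ := mem_iUnion₂.1 (hcov x)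
    have : chartAt Plane z ∈ range d := hd ▸ mem_insert_of_mem _ (mem_image_of_mem _ hz)
    obtain ⟨n, hn⟩ := this
    exact mem_iUnion.2 ⟨n, by rwa [hn]⟩

/-- A supremum of measures could exceed every member. The measure `ν`, glued from disjoint pieces of
a countable atlas, agrees with each chart measure on its domain, so it is an upper bound and pins
down `vol`. -/
theorem vol_apply_of_subset (h : Metric2 S) (hc : c ∈ charts S) (hE : MeasurableSet E)
    (hEc : E ⊆ c.source) : vol h E = chartVolume h c E := by
  obtain ⟨d, hd, hcov⟩ := exists_chart_cover hc
  set P : ℕ → Set S := disjointed fun n => (d n).source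
  have hP : ∀ n, MeasurableSet (P n) :=
    MeasurableSet.disjointed fun n => (d n).open_source.measurableSet
  have hPd : ∀ n, P n ⊆ (d n).source := disjointed_subset _
  have hPu : ⋃ n, P n = univ := (iUnion_disjointed).trans hcov
  set ν : Measure S := Measure.sum fun n => (chartVolume h (d n)).restrict (P n)
  have hν : ∀ c' ∈ charts S, ∀ E : Set S, MeasurableSet E → E ⊆ c'.source →
      ν E = chartVolume h c' E := by
    intro c' hc' E hE hEc'
    calc ν E = ∑' n, chartVolume h (d n) (E ∩ P n) := by
          rw [Measure.sum_apply _ hE]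
          exact tsum_congr fun n => Measure.restrict_apply hE
      _ = ∑' n, chartVolume h c' (E ∩ P n) := tsum_congr fun n =>
          chartVolume_eq_of_subset h (hd n) hc' (hE.inter (hP n))
            (inter_subset_right.trans (hPd n)) (inter_subset_left.trans hEc')
      _ = chartVolume h c' (⋃ n, E ∩ P n) := (measure_iUnion
          (fun i j hij => ((disjoint_disjointed _ hij).mono inter_subset_right
            inter_subset_right)) fun n => hE.inter (hP n)).symm
      _ = chartVolume h c' E := by rw [← inter_iUnion, hPu, inter_univ]
  refine le_antisymm ?_ (chartVolume_le_vol h hc E)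
  have hle : vol h ≤ ν := by
    refine iSup₂_le fun c' hc' => Measure.le_iff.2 fun E hE => ?_
    rw [← chartVolume_inter_source h c' hE,
      ← hν c' hc' _ (hE.inter c'.open_source.measurableSet) inter_subset_right]
    exact measure_mono inter_subset_left
  exact (hle E).trans_eq (hν c hc E hE hEc)

theorem vol_restrict_source (h : Metric2 S) (hc : c ∈ charts S) :
    (vol h).restrict c.source = chartVolume h c := by
  ext E hE
  rw [Measure.restrict_apply hE, vol_apply_of_subset h hc
    (hE.inter c.open_source.measurableSet) inter_subset_right, chartVolume_inter_source h c hE]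

theorem aemeasurable_density (h : Metric2 S) (hc : c ∈ charts S) :
    AEMeasurable (fun y => ENNReal.ofReal √(chartGram h c y).det) (volume.restrict c.target) :=
  ((continuousOn_density h hc).aemeasurable
    c.open_target.measurableSet).ennreal_ofReal

theorem density_pos (h : Metric2 S) (hc : c ∈ charts S) {y : Plane} (hy : y ∈ c.target) :
    0 < √(chartGram h c y).det := Real.sqrt_pos.2 (chartGram_posDef h hc hy).det_pos

/-- The density is positive, so null sets of `vol` are Lebesgue null in charts. With the converse
`ae_vol_of_chart`, almost everywhere statements can be moved to charts and back. -/
theorem ae_vol_chart (hc : c ∈ charts S) {Q : S → Prop} (hQ : ∀ᵐ x ∂(vol h), Q x) :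
    ∀ᵐ y ∂(volume.restrict c.target), Q (c.symm y) := by
  have h1 : ∀ᵐ x ∂(chartVolume h c), Q x :=
    (chartVolume_le_vol h hc).absolutelyContinuous.ae_le hQ
  have h2 := ae_of_ae_map (aemeasurable_symm_withDensity c _) h1
  rw [ae_withDensity_iff' (aemeasurable_density h hc)] at h2
  filter_upwards [h2, ae_restrict_mem c.open_target.measurableSet] with y hy hyc
  exact hy (by simpa using density_pos h hc hyc)

theorem ae_vol_of_chart {Q : S → Prop}
    (hQ : ∀ c ∈ charts S, ∀ᵐ y ∂(volume.restrict c.target), Q (c.symm y)) :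
    ∀ᵐ x ∂(vol h), Q x := by
  have := ChartedSpace.secondCountable_of_sigmaCompact Plane S
  refine measure_null_of_locally_null _ fun x _ => ?_
  set c := chartAt Plane x
  have hc : c ∈ charts S := IsManifold.chart_mem_maximalAtlas x
  refine ⟨{x | ¬ Q x} ∩ c.source, inter_mem_nhdsWithin _
    (c.open_source.mem_nhds (mem_chart_source Plane x)), ?_⟩
  have h1 := hQ c hc
  rw [ae_restrict_iff' c.open_target.measurableSet] at h1
  obtain ⟨Z, hZ1, hZ2, hZ3⟩ := exists_measurable_superset_of_null h1
  have hm : MeasurableSet (c.source ∩ c ⁻¹' Z) :=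
    c.continuousOn.measurableSet_inter_preimage c.open_source.measurableSet hZ2
  refine measure_mono_null (t := c.source ∩ c ⁻¹' Z) ?_ ?_
  · rintro z ⟨hz1, hz2⟩
    refine ⟨hz2, hZ1 ?_⟩
    simp only [mem_compl_iff, mem_ofPred_eq, not_forall]
    refine ⟨c.map_source hz2, ?_⟩
    rwa [c.left_inv hz2]
  · rw [vol_apply_of_subset h hc hm inter_subset_left, chartVolume_apply h c hm]
    refine setLIntegral_measure_zero _ _ (measure_mono_null ?_ hZ3)
    rintro y ⟨hy1, hy2⟩
    have := hy2.2
    simpa only [mem_preimage, c.right_inv hy1] using this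

theorem aestronglyMeasurable_vol {E' : Type*} [TopologicalSpace E']
    [TopologicalSpace.PseudoMetrizableSpace E'] {f : S → E'}
    (hf : ∀ c ∈ charts S, AEStronglyMeasurable (fun y => f (c.symm y))
      (volume.restrict c.target)) : AEStronglyMeasurable f (vol h) := by
  rcases isEmpty_or_nonempty S with hS | ⟨⟨x₀⟩⟩
  · rw [Subsingleton.elim (vol h) 0]; exact aestronglyMeasurable_zero_measure f
  obtain ⟨d, hd, hcov⟩ := exists_chart_cover
    (IsManifold.chart_mem_maximalAtlas (I := 𝓘(ℝ, Plane)) (n := ∞) x₀)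
  rw [← Measure.restrict_univ (μ := vol h), ← hcov, aestronglyMeasurable_iUnion_iff]
  intro n
  set c := d n
  have hm : AEMeasurable c ((vol h).restrict c.source) :=
    c.continuousOn.aemeasurable c.open_source.measurableSet
  have h1 : AEStronglyMeasurable (fun y => f (c.symm y))
      (Measure.map c ((vol h).restrict c.source)) := by
    refine (hf c (hd n)).mono_ac ?_
    intro Z hZ
    obtain ⟨Z', hZ1, hZ2, hZ3⟩ := exists_measurable_superset_of_null hZ
    refine measure_mono_null hZ1 ?_
    have hm' : MeasurableSet (c.source ∩ c ⁻¹' Z') :=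
      c.continuousOn.measurableSet_inter_preimage c.open_source.measurableSet hZ2
    rw [Measure.map_apply_of_aemeasurable hm hZ2,
      Measure.restrict_apply' c.open_source.measurableSet, inter_comm,
      vol_apply_of_subset h (hd n) hm' inter_subset_left, chartVolume_apply h c hm']
    rw [Measure.restrict_apply hZ2] at hZ3
    refine setLIntegral_measure_zero _ _ (measure_mono_null ?_ hZ3)
    rintro y ⟨hy1, hy2⟩
    have := hy2.2
    simp only [mem_preimage, c.right_inv hy1] at this
    exact ⟨this, hy1⟩
  refine (h1.comp_aemeasurable hm).congr ?_
  filter_upwards [ae_restrict_mem c.open_source.measurableSet] with x hx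
  simp only [Function.comp, c.left_inv hx]

instance isFiniteMeasure_vol (h : Metric2 S) : IsFiniteMeasure (vol h) := by
  have : IsLocallyFiniteMeasure (vol h) := by
    refine ⟨fun x => ?_⟩
    set c := chartAt Plane x
    have hc : c ∈ charts S := IsManifold.chart_mem_maximalAtlas x
    have hx : x ∈ c.source := mem_chart_source Plane x
    obtain ⟨r, hr, hrc⟩ := nhds_basis_closedBall.mem_iff.1
      (c.open_target.mem_nhds (c.map_source hx))
    have hm : MeasurableSet (c.source ∩ c ⁻¹' ball (c x) r) :=
      c.continuousOn.measurableSet_inter_preimage c.open_source.measurableSet measurableSet_ball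
    refine ⟨c.source ∩ c ⁻¹' ball (c x) r, inter_mem (c.open_source.mem_nhds hx)
      ((c.continuousAt hx).preimage_mem_nhds (ball_mem_nhds _ hr)), ?_⟩
    rw [vol_apply_of_subset h hc hm inter_subset_left, chartVolume_apply h c hm]
    have h1 : IntegrableOn (fun y => √(chartGram h c y).det) (closedBall (c x) r) :=
      ((continuousOn_density h hc).mono hrc).integrableOn_compact
        (isCompact_closedBall _ _)
    refine lt_of_le_of_lt (lintegral_mono_set (t := closedBall (c x) r) ?_) ?_
    · rintro y ⟨hy1, hy2⟩
      have := hy2.2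
      simp only [mem_preimage, c.right_inv hy1] at this
      exact ball_subset_closedBall this
    · exact h1.lintegral_lt_top
  infer_instance

theorem integrableOn_chart {E' : Type*} [NormedAddCommGroup E'] [NormedSpace ℝ E']
    (hc : c ∈ charts S) {f : S → E'} (hf : Integrable f (vol h)) :
    IntegrableOn (fun y => √(chartGram h c y).det • f (c.symm y)) c.target := by
  have h1 : Integrable f (chartVolume h c) := by
    rw [← vol_restrict_source h hc]; exact hf.restrict
  have h2 := (integrable_map_measure h1.1 (aemeasurable_symm_withDensity c _)).1 h1
  rw [integrable_withDensity_iff_integrable_smul₀' (aemeasurable_density h hc)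
    (ae_of_all _ fun _ => ENNReal.ofReal_lt_top)] at h2
  rw [IntegrableOn]
  simpa [ENNReal.toReal_ofReal (Real.sqrt_nonneg _)] using h2

theorem setIntegral_chart {E' : Type*} [NormedAddCommGroup E'] [NormedSpace ℝ E']
    (hc : c ∈ charts S) {f : S → E'} (hf : AEStronglyMeasurable f (vol h)) :
    ∫ x in c.source, f x ∂(vol h) =
      ∫ y in c.target, √(chartGram h c y).det • f (c.symm y) := by
  have h1 : AEStronglyMeasurable f (chartVolume h c) := by
    rw [← vol_restrict_source h hc]; exact hf.restrict
  rw [vol_restrict_source h hc, chartVolume,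
    integral_map (aemeasurable_symm_withDensity c _) h1,
    integral_withDensity_eq_integral_toReal_smul₀ (aemeasurable_density h hc)
      (ae_of_all _ fun _ => ENNReal.ofReal_lt_top)]
  simp [ENNReal.toReal_ofReal (Real.sqrt_nonneg _)]

/-- The density is continuous and positive, so dividing by it preserves integrability on compact
sets. -/
theorem locallyIntegrableOn_chart {E' : Type*} [NormedAddCommGroup E'] [NormedSpace ℝ E']
    (hc : c ∈ charts S) {f : S → E'} (hf : Integrable f (vol h)) :
    LocallyIntegrableOn (fun y => f (c.symm y)) c.target := by
  have h1 : LocallyIntegrableOn (fun y => √(chartGram h c y).det • f (c.symm y)) c.target :=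
    (integrableOn_chart hc hf).locallyIntegrableOn
  rw [locallyIntegrableOn_iff c.open_target.isLocallyClosed] at h1 ⊢
  intro K hK hKc
  have hcont : ContinuousOn (fun y => (√(chartGram h c y).det)⁻¹) c.target :=
    (continuousOn_density h hc).inv₀ fun y hy => (density_pos h hc hy).ne'
  refine ((h1 K hK hKc).continuousOn_smul (hcont.mono hK) hKc).congr_fun (fun y hy => ?_)
    hKc.measurableSet
  simp only
  rw [smul_smul, inv_mul_cancel₀ (density_pos h hc (hK hy)).ne', one_smul]

end SurfaceMeasure

end

/-! ### Weak differentials on the surface. -/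

section

open Filter Topology Metric

set_option linter.unusedSectionVars false

section WeakDifferentials

variable {S : Type u} [TopologicalSpace S] [ChartedSpace Plane S] [IsManifold 𝓘(ℝ, Plane) ∞ S]
  {F : Type*} [NormedAddCommGroup F] [InnerProductSpace ℝ F]
  {F' : Type*} [NormedAddCommGroup F'] [InnerProductSpace ℝ F']
  {h : Metric2 S} {c : OpenPartialHomeomorph S Plane} {f : S → F} {D : OneForm S F}

theorem isWeakDifferential_wd (hf : ∃ D : OneForm S F, IsWeakDifferential f D) :
    IsWeakDifferential f (wd f) := by
  rw [wd, dif_pos hf]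
  exact hf.choose_spec

/-- One-forms that are almost everywhere measurable in charts. -/
def IsMeasurableForm (D : OneForm S F) : Prop :=
  ∀ c ∈ charts S, AEStronglyMeasurable (chartRep c D) (volume.restrict c.target)

theorem IsWeakDifferential.isMeasurableForm (hD : IsWeakDifferential f D) : IsMeasurableForm D :=
  fun c hc => (hD c hc).aestronglyMeasurable'

theorem IsMeasurableForm.clm_comp (hD : IsMeasurableForm D) {T : S → F →L[ℝ] F'}
    (hT : ∀ c ∈ charts S, AEStronglyMeasurable (fun y => T (c.symm y))
      (volume.restrict c.target)) : IsMeasurableForm (fun x => (T x).comp (D x)) :=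
  fun c hc => (aestronglyMeasurable_clm_comp (hT c hc) (hD c hc)).congr (ae_of_all _ fun _ => rfl)

theorem IsMeasurableForm.smul (hD : IsMeasurableForm D) {a : S → ℝ}
    (ha : ∀ c ∈ charts S, AEStronglyMeasurable (fun y => a (c.symm y))
      (volume.restrict c.target)) : IsMeasurableForm (fun x => a x • D x) :=
  fun c hc => (ha c hc).smul (hD c hc)

theorem IsMeasurableForm.add (hD : IsMeasurableForm D) {E : OneForm S F}
    (hE : IsMeasurableForm E) : IsMeasurableForm (fun x => D x + E x) := fun c hc => by
  refine ((hD c hc).add (hE c hc)).congr (ae_of_all _ fun y => ?_)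
  rfl

theorem continuousOn_chartGram_inv_apply (h : Metric2 S) (hc : c ∈ charts S) (i j : Fin 2) :
    ContinuousOn (fun y => (chartGram h c y)⁻¹ i j) c.target := by
  have hg := continuousOn_chartGram h hc
  have h1 : ContinuousOn (fun y => (chartGram h c y).det) c.target :=
    ((continuous_id (X := Matrix (Fin 2) (Fin 2) ℝ)).matrix_det).comp_continuousOn hg
  have h2 : ContinuousOn (fun y => (chartGram h c y).adjugate i j) c.target :=
    (((continuous_id (X := Matrix (Fin 2) (Fin 2) ℝ)).matrix_adjugate).matrix_elem i j)
      |>.comp_continuousOn hg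
  refine ((h1.inv₀ fun y hy => (chartGram_posDef h hc hy).det_pos.ne').mul h2).congr
    fun y hy => ?_
  simp [Matrix.inv_def, Ring.inverse_eq_inv']

theorem aestronglyMeasurable_chartGram_inv_apply (h : Metric2 S) (hc : c ∈ charts S)
    (i j : Fin 2) : AEStronglyMeasurable (fun y => (chartGram h c y)⁻¹ i j)
      (volume.restrict c.target) :=
  (continuousOn_chartGram_inv_apply h hc i j).aestronglyMeasurable c.open_target.measurableSet

theorem aestronglyMeasurable_formPairing_chart {α : OneForm S ℝ} (hα : IsMeasurableForm α)
    (hD : IsMeasurableForm D) (hc : c ∈ charts S) :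
    AEStronglyMeasurable (fun y => formPairing h α D (c.symm y))
      (volume.restrict c.target) := by
  have h1 : AEStronglyMeasurable
      (fun y => pairing (chartGram h c y) (chartRep c α y) (chartRep c D y))
      (volume.restrict c.target) := by
    unfold pairing
    refine Finset.aestronglyMeasurable_fun_sum _ fun i _ =>
      Finset.aestronglyMeasurable_fun_sum _ fun j _ => ?_
    exact ((aestronglyMeasurable_chartGram_inv_apply h hc i j).mul
      ((ContinuousLinearMap.apply ℝ ℝ (e i)).continuous.comp_aestronglyMeasurable (hα c hc))).smul
      ((ContinuousLinearMap.apply ℝ F (e j)).continuous.comp_aestronglyMeasurable (hD c hc))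
  refine h1.congr ?_
  filter_upwards [ae_restrict_mem c.open_target.measurableSet] with y hy
  exact pairing_chartRep hc hy α D

theorem aestronglyMeasurable_formNormSq_chart (hD : IsMeasurableForm D) (hc : c ∈ charts S) :
    AEStronglyMeasurable (fun y => formNormSq h D (c.symm y)) (volume.restrict c.target) := by
  have h1 : AEStronglyMeasurable
      (fun y => normSq (chartGram h c y) (chartRep c D y)) (volume.restrict c.target) := by
    unfold normSq
    refine Finset.aestronglyMeasurable_fun_sum _ fun i _ =>
      Finset.aestronglyMeasurable_fun_sum _ fun j _ => ?_
    exact (aestronglyMeasurable_chartGram_inv_apply h hc i j).mul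
      (((ContinuousLinearMap.apply ℝ F (e i)).continuous.comp_aestronglyMeasurable
        (hD c hc)).inner
      ((ContinuousLinearMap.apply ℝ F (e j)).continuous.comp_aestronglyMeasurable (hD c hc)))
  refine h1.congr ?_
  filter_upwards [ae_restrict_mem c.open_target.measurableSet] with y hy
  exact normSq_chartRep hc hy D

theorem chartRep_smoothD {ψ : S → ℝ} (hψ : ContMDiff 𝓘(ℝ, Plane) 𝓘(ℝ, ℝ) ∞ ψ)
    (hc : c ∈ charts S) {y : Plane} (hy : y ∈ c.target) :
    chartRep c (smoothD ψ) y = fderiv ℝ (fun z => ψ (c.symm z)) y := by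
  have h1 := (mdifferentiable_of_mem_charts hc).mdifferentiableAt_symm hy
  have h2 := mfderiv_comp y (hψ.mdifferentiable (by simp) (c.symm y)) h1
  rw [mfderiv_eq_fderiv] at h2
  exact h2.symm

theorem contDiffOn_comp_symm {E : Type*} [NormedAddCommGroup E] [NormedSpace ℝ E] {ψ : S → E}
    (hψ : ContMDiff 𝓘(ℝ, Plane) 𝓘(ℝ, E) ∞ ψ) (hc : c ∈ charts S) :
    ContDiffOn ℝ ∞ (fun z => ψ (c.symm z)) c.target :=
  contMDiffOn_iff_contDiffOn.1
    (hψ.comp_contMDiffOn (contMDiffOn_symm_of_mem_maximalAtlas hc))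

theorem isWeakDifferential_smoothD {ψ : S → ℝ} (hψ : ContMDiff 𝓘(ℝ, Plane) 𝓘(ℝ, ℝ) ∞ ψ) :
    IsWeakDifferential ψ (smoothD ψ) := by
  intro c hc
  refine (hasWeakDerivOn_of_contDiffOn c.open_target
    ((contDiffOn_comp_symm hψ hc).of_le (by simp))).congr c.open_target.measurableSet
      (ae_of_all _ fun _ => rfl) ?_
  filter_upwards [ae_restrict_mem c.open_target.measurableSet] with y hy
  exact (chartRep_smoothD hψ hc hy).symm

/-- Weak derivatives are set up for inner product spaces, and `ℝ × F` carries the sup norm; hence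
the `ℓ²` product. -/
theorem IsWeakDifferential.prod [CompleteSpace F] {ψ : S → ℝ} {α : OneForm S ℝ}
    (hψ : IsWeakDifferential ψ α) (hf : IsWeakDifferential f D) :
    IsWeakDifferential (F := WithLp 2 (ℝ × F)) (fun x => WithLp.toLp 2 (ψ x, f x)) (fun x =>
      ((WithLp.prodContinuousLinearEquiv 2 ℝ ℝ F).symm : ℝ × F →L[ℝ] WithLp 2 (ℝ × F)).comp
        ((formAt α x).prod (formAt D x))) := by
  intro c hc
  set P : ℝ × F →L[ℝ] WithLp 2 (ℝ × F) :=
    ((WithLp.prodContinuousLinearEquiv 2 ℝ ℝ F).symm : ℝ × F →L[ℝ] WithLp 2 (ℝ × F))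
  have h1 := (hψ c hc).clm_comp (P.comp (ContinuousLinearMap.inl ℝ ℝ F))
  have h2 := (hf c hc).clm_comp (P.comp (ContinuousLinearMap.inr ℝ ℝ F))
  refine (h1.add h2).congr c.open_target.measurableSet (ae_of_all _ fun y => ?_)
    (ae_of_all _ fun y => ?_)
  · simp only [ContinuousLinearMap.comp_apply, ContinuousLinearMap.inl_apply,
      ContinuousLinearMap.inr_apply, ← map_add, Function.comp]
    simp [P]
  · ext v
    change P (chartRep c α y v, 0) + P (0, chartRep c D y v) =
      P (chartRep c α y v, chartRep c D y v)
    rw [← map_add]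
    simp

variable [MeasurableSpace S] [BorelSpace S] [CompactSpace S]

theorem aestronglyMeasurable_formPairing {α : OneForm S ℝ} (hα : IsMeasurableForm α)
    (hD : IsMeasurableForm D) : AEStronglyMeasurable (formPairing h α D) (vol h) :=
  aestronglyMeasurable_vol fun _ hc => aestronglyMeasurable_formPairing_chart hα hD hc

theorem aestronglyMeasurable_formNormSq (hD : IsMeasurableForm D) :
    AEStronglyMeasurable (formNormSq h D) (vol h) :=
  aestronglyMeasurable_vol fun _ hc => aestronglyMeasurable_formNormSq_chart hD hc

theorem IsWeakDifferential.aestronglyMeasurable (hD : IsWeakDifferential f D) :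
    AEStronglyMeasurable f (vol h) :=
  aestronglyMeasurable_vol fun c hc => (hD c hc).aestronglyMeasurable

theorem IsWeakDifferential.ae_eq [CompleteSpace F] {g : S → F} {E : OneForm S F}
    (hD : IsWeakDifferential f D) (hE : IsWeakDifferential g E)
    (hfg : ∀ᵐ x ∂(vol h), f x = g x) : ∀ᵐ x ∂(vol h), formAt D x = formAt E x := by
  refine ae_vol_of_chart fun c hc => ?_
  have h1 := (hD c hc).congr (g := g ∘ c.symm) c.open_target.measurableSet (ae_vol_chart hc hfg)
    (ae_of_all _ fun _ => rfl)
  filter_upwards [h1.unique c.open_target (hE c hc),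
    ae_restrict_mem c.open_target.measurableSet] with y hy hyc
  exact chartRep_inj hc hyc hy

theorem IsWeakDifferential.ae_eq_wd [CompleteSpace F] (hD : IsWeakDifferential f D) :
    ∀ᵐ x ∂(vol h), formAt (wd f) x = formAt D x :=
  (isWeakDifferential_wd ⟨D, hD⟩).ae_eq hD (ae_of_all _ fun _ => rfl)

theorem IsWeakDifferential.comp_smooth [FiniteDimensional ℝ F] [CompleteSpace F']
    (hD : IsWeakDifferential f D) {Φ : F → F'} (hΦ : ContDiff ℝ 1 Φ) {R : ℝ}
    (hR : ∀ᵐ x ∂(vol h), ‖f x‖ ≤ R) :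
    IsWeakDifferential (Φ ∘ f) (fun x => (fderiv ℝ Φ (f x)).comp (D x)) := fun c hc =>
  (hD c hc).comp_of_ae_bounded c.open_target hΦ (ae_vol_chart hc hR)

/-- The angle of rotation depends on the point of the surface and on the value of the map, so the
chain rule is needed for both together. -/
theorem IsWeakDifferential.comp_pair [FiniteDimensional ℝ F] [CompleteSpace F']
    (hD : IsWeakDifferential f D) {ψ : S → ℝ} (hψ : ContMDiff 𝓘(ℝ, Plane) 𝓘(ℝ, ℝ) ∞ ψ)
    {Φ : ℝ × F → F'} (hΦ : ContDiff ℝ 1 Φ) {R : ℝ} (hR : ∀ᵐ x ∂(vol h), ‖f x‖ ≤ R) :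
    IsWeakDifferential (fun x => Φ (ψ x, f x)) (fun x =>
      (fderiv ℝ Φ (ψ x, f x)).comp ((formAt (smoothD ψ) x).prod (formAt D x))) := by
  have : CompleteSpace F := FiniteDimensional.complete ℝ F
  obtain ⟨R', hR'⟩ := isCompact_univ.exists_bound_of_continuousOn hψ.continuous.continuousOn
  set P : WithLp 2 (ℝ × F) →L[ℝ] ℝ × F := (WithLp.prodContinuousLinearEquiv 2 ℝ ℝ F :
    WithLp 2 (ℝ × F) →L[ℝ] ℝ × F)
  have h1 := ((isWeakDifferential_smoothD hψ).prod hD).comp_smooth (h := h)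
    (Φ := fun z => Φ (P z)) (hΦ.comp P.contDiff) (R := R' + R) (by
      filter_upwards [hR] with x hx
      have h1 := hR' x (mem_univ _)
      have h2 : (WithLp.toLp 2 (ψ x, f x) : WithLp 2 (ℝ × F)) =
          WithLp.toLp 2 (ψ x, 0) + WithLp.toLp 2 (0, f x) := by
        rw [← WithLp.toLp_add]; simp
      rw [h2]
      refine (norm_add_le _ _).trans ?_
      rw [WithLp.norm_toLp_fst, WithLp.norm_toLp_snd]
      exact add_le_add h1 hx)
  intro c hc
  refine (h1 c hc).congr c.open_target.measurableSet (ae_of_all _ fun y => rfl)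
    (ae_of_all _ fun y => ?_)
  ext v
  have h2 : fderiv ℝ (fun z => Φ (P z)) (WithLp.toLp 2 (ψ (c.symm y), f (c.symm y))) =
      (fderiv ℝ Φ (ψ (c.symm y), f (c.symm y))).comp P :=
    fderiv_comp _ ((hΦ.differentiable (by simp)) _) P.differentiableAt |>.trans (by
      rw [P.fderiv]; rfl)
  simp only [chartRep_eq, formAt, h2]
  rfl

theorem exists_norm_smoothD_le (h : Metric2 S) {ψ : S → ℝ}
    (hψ : ContMDiff 𝓘(ℝ, Plane) 𝓘(ℝ, ℝ) ∞ ψ) :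
    ∃ M : ℝ, 0 ≤ M ∧ ∀ x, √(formNormSq h (smoothD ψ) x) ≤ M := by
  have hcont : Continuous (formNormSq h (smoothD ψ)) := by
    rw [continuous_iff_continuousAt]
    intro x
    set c := chartAt Plane x
    have hc : c ∈ charts S := IsManifold.chart_mem_maximalAtlas x
    have hx : x ∈ c.source := mem_chart_source Plane x
    have h1 : ContinuousOn (fun y => normSq (chartGram h c y) (chartRep c (smoothD ψ) y))
        c.target := by
      have h2 : ContinuousOn (chartRep c (smoothD ψ)) c.target :=
        ((contDiffOn_comp_symm hψ hc).continuousOn_fderiv_of_isOpen c.open_target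
          (by simp)).congr fun y hy => chartRep_smoothD hψ hc hy
      unfold normSq
      refine continuousOn_finsetSum _ fun i _ => continuousOn_finsetSum _ fun j _ => ?_
      exact (continuousOn_chartGram_inv_apply h hc i j).mul
        ((h2.clm_apply continuousOn_const).inner (h2.clm_apply continuousOn_const))
    have h3 : ContinuousAt (fun z => normSq (chartGram h c (c z)) (chartRep c (smoothD ψ) (c z)))
        x := ContinuousAt.comp (f := c) (x := x)
      (h1.continuousAt (c.open_target.mem_nhds (c.map_source hx))) (c.continuousAt hx)
    refine h3.congr ?_
    filter_upwards [c.open_source.mem_nhds hx] with z hz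
    rw [normSq_chartRep hc (c.map_source hz), c.left_inv hz]
  obtain ⟨M, hM⟩ := isCompact_univ.exists_bound_of_continuousOn hcont.sqrt.continuousOn
  refine ⟨max M 0, le_max_right _ _, fun x => (le_abs_self _).trans ((hM x (mem_univ _)).trans
    (le_max_left _ _))⟩

end WeakDifferentials

end

section

open Filter Topology Metric

/-! ### Differentiation of the energy integral. -/

section FirstVariationIntegral

/-- The density is an exact quadratic in `t`, with coefficients controlled by `1 + a`. For `|t| < 1`
its derivative is therefore dominated by a multiple of the integrable `(1 + a)^(p/2)`. -/
theorem hasDerivAt_integral_rpow {X : Type*} [MeasurableSpace X] {μ : Measure X}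
    {a b c : X → ℝ} {p K : ℝ} (hp : 2 < p) (hK : 0 ≤ K) (ha : AEStronglyMeasurable a μ)
    (hb : AEStronglyMeasurable b μ) (hc : AEStronglyMeasurable c μ)
    (ha0 : ∀ᵐ x ∂μ, 0 ≤ a x) (hbK : ∀ᵐ x ∂μ, |b x| ≤ K * (1 + a x))
    (hcK : ∀ᵐ x ∂μ, |c x| ≤ K * (1 + a x))
    (hpos : ∀ᵐ x ∂μ, ∀ t : ℝ, 0 ≤ a x + 2 * t * b x + t ^ 2 * c x)
    (hint : Integrable (fun x => (1 + a x) ^ (p / 2)) μ) :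
    Integrable (fun x => (1 + a x) ^ (p / 2 - 1) * b x) μ ∧
      HasDerivAt (fun t : ℝ => ∫ x, (1 + (a x + 2 * t * b x + t ^ 2 * c x)) ^ (p / 2) ∂μ)
        (p * ∫ x, (1 + a x) ^ (p / 2 - 1) * b x ∂μ) 0 := by
  set Fn : ℝ → X → ℝ := fun t x => (1 + (a x + 2 * t * b x + t ^ 2 * c x)) ^ (p / 2)
  set F' : ℝ → X → ℝ := fun t x =>
    (2 * b x + 2 * t * c x) * (p / 2) * (1 + (a x + 2 * t * b x + t ^ 2 * c x)) ^ (p / 2 - 1)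
  have hmB : ∀ t : ℝ, AEStronglyMeasurable (fun x => 1 + (a x + 2 * t * b x + t ^ 2 * c x)) μ :=
    fun t => aestronglyMeasurable_const.add
      ((ha.add (hb.const_mul _)).add (hc.const_mul _))
  have hpow : ∀ (q : ℝ) (t : ℝ), AEStronglyMeasurable
      (fun x => (1 + (a x + 2 * t * b x + t ^ 2 * c x)) ^ q) μ := fun q t =>
    ((hmB t).aemeasurable.pow_const q).aestronglyMeasurable
  have key := hasDerivAt_integral_of_dominated_loc_of_deriv_le (μ := μ) (F := Fn) (F' := F')
    (x₀ := (0 : ℝ)) (s := ball 0 1)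
    -- The factor `4K` bounds `2b + 2tc`, and `1 + 3K` comes from `1 + a + 2tb + t²c ≤ (1 + 3K)(1 +
    -- a)`.
    (bound := fun x => (4 * K * (p / 2) * (1 + 3 * K) ^ (p / 2 - 1)) * (1 + a x) ^ (p / 2))
    (ball_mem_nhds _ one_pos) (Eventually.of_forall fun t => hpow _ t)
    (by simpa [Fn] using hint)
    (((hb.const_mul 2).add (hc.const_mul (2 * 0))).mul_const _ |>.mul (hpow _ 0)) ?_
    (hint.const_mul _) ?_
  · have h0 : ∀ x, F' 0 x = p * ((1 + a x) ^ (p / 2 - 1) * b x) := by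
      intro x
      simp only [F', mul_zero, zero_mul, add_zero, ne_eq, OfNat.ofNat_ne_zero, not_false_eq_true,
        zero_pow]
      ring
    rw [show F' 0 = _ from funext h0] at key
    refine ⟨?_, ?_⟩
    · refine (key.1.const_mul p⁻¹).congr (ae_of_all _ fun x => ?_)
      simp only
      field_simp
    · rw [← integral_const_mul]
      exact key.2
  · filter_upwards [ha0, hbK, hcK, hpos] with x hax hbx hcx hposx t ht
    have ht1 : |t| < 1 := by simpa using ht
    have ht2 : t ^ 2 ≤ 1 := by
      rw [← sq_abs]; nlinarith [abs_nonneg t]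
    have hB1 : 1 ≤ 1 + (a x + 2 * t * b x + t ^ 2 * c x) := by linarith [hposx t]
    have htb : |t * b x| ≤ K * (1 + a x) := by
      rw [abs_mul]; nlinarith [abs_nonneg t, abs_nonneg (b x)]
    have htc : |t * c x| ≤ K * (1 + a x) := by
      rw [abs_mul]; nlinarith [abs_nonneg t, abs_nonneg (c x)]
    have htc2 : t ^ 2 * c x ≤ K * (1 + a x) := by
      have := le_abs_self (c x)
      nlinarith [sq_nonneg t, abs_nonneg (c x)]
    have hB2 : 1 + (a x + 2 * t * b x + t ^ 2 * c x) ≤ (1 + 3 * K) * (1 + a x) := by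
      have := le_abs_self (t * b x)
      nlinarith
    have h1 : |2 * b x + 2 * t * c x| ≤ 4 * K * (1 + a x) := by
      calc |2 * b x + 2 * t * c x| ≤ |2 * b x| + |2 * (t * c x)| := by
            rw [← mul_assoc]; exact abs_add_le _ _
        _ ≤ _ := by rw [abs_mul, abs_mul 2, abs_two]; linarith
    have h2 : (1 + (a x + 2 * t * b x + t ^ 2 * c x)) ^ (p / 2 - 1) ≤
        (1 + 3 * K) ^ (p / 2 - 1) * (1 + a x) ^ (p / 2 - 1) := by
      rw [← Real.mul_rpow (by linarith) (by linarith)]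
      exact Real.rpow_le_rpow (by linarith) hB2 (by linarith)
    have h3 : (1 + a x) ^ (p / 2) = (1 + a x) * (1 + a x) ^ (p / 2 - 1) := by
      rw [Real.rpow_sub_one (by linarith)]
      field_simp
    have h4 : 0 ≤ (1 + (a x + 2 * t * b x + t ^ 2 * c x)) ^ (p / 2 - 1) :=
      Real.rpow_nonneg (by linarith) _
    simp only [F']
    rw [Real.norm_eq_abs, abs_mul, abs_mul, abs_of_nonneg h4, abs_of_nonneg
      (by linarith : 0 ≤ p / 2), h3]
    calc _ ≤ 4 * K * (1 + a x) * (p / 2) *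
          ((1 + 3 * K) ^ (p / 2 - 1) * (1 + a x) ^ (p / 2 - 1)) := by
          gcongr
      _ = _ := by ring
  · filter_upwards [hpos] with x hposx t _
    have h1 : HasDerivAt (fun t : ℝ => 1 + (a x + 2 * t * b x + t ^ 2 * c x))
        (2 * b x + 2 * t * c x) t := by
      have := ((((hasDerivAt_id t).const_mul 2).mul_const (b x)).const_add (a x)).add
        (((hasDerivAt_id t).pow 2).mul_const (c x)) |>.const_add 1
      refine this.congr_deriv ?_
      simp
    exact h1.rpow_const (Or.inl (by linarith [hposx t]))

end FirstVariationIntegral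

/-! ### One-parameter groups of rotations. -/

section Flow

open scoped Matrix.Norms.L2Operator

variable {m : ℕ}

local notation "Mat" => Matrix (Fin m) (Fin m) ℝ
local notation "Vec" => EuclideanSpace ℝ (Fin m)

/-- The one-parameter group generated by a matrix. -/
def flow (A : Mat) (σ : ℝ) : Vec →L[ℝ] Vec :=
  Matrix.toEuclideanCLM (n := Fin m) (𝕜 := ℝ) (NormedSpace.exp (σ • A))

theorem flow_apply (A : Mat) (σ : ℝ) (q : Vec) :
    flow A σ q = act (NormedSpace.exp (σ • A)) q := rfl

theorem flow_zero (A : Mat) (q : Vec) : flow A 0 q = q := by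
  rw [flow_apply, zero_smul, NormedSpace.exp_zero, act_one]

theorem contDiff_flow (A : Mat) : ContDiff ℝ ∞ (flow A) := by
  have h1 : ContDiff ℝ ∞ (NormedSpace.exp : Mat → Mat) :=
    contDiff_iff_contDiffAt.2 fun x => (NormedSpace.exp_analytic (𝕂 := ℝ) x).contDiffAt
  have h2 : ContDiff ℝ ∞ fun σ : ℝ => NormedSpace.exp (σ • A) :=
    h1.comp (contDiff_id.smul contDiff_const)
  exact (LinearMap.toContinuousLinearMap (Matrix.toEuclideanCLM (n := Fin m)
    (𝕜 := ℝ)).toAlgEquiv.toLinearEquiv.toLinearMap).contDiff.comp h2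

/-- The rotation factors out of the full differential, since `A` commutes with `exp (σ A)`; being an
isometry, it will disappear from the norm. -/
theorem hasFDerivAt_flow (A : Mat) (z : ℝ × Vec) :
    HasFDerivAt (fun z : ℝ × Vec => flow A z.1 z.2)
      ((flow A z.1).comp (ContinuousLinearMap.snd ℝ ℝ Vec +
        (ContinuousLinearMap.fst ℝ ℝ Vec).smulRight (act A z.2))) z := by
  have h0 : DifferentiableAt ℝ (flow A) z.1 := (contDiff_flow A).differentiable (by simp) _
  have h1 := (h0.hasFDerivAt.comp z hasFDerivAt_fst).clm_apply
    (hasFDerivAt_snd (𝕜 := ℝ) (E := ℝ) (F := Vec) (p := z))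
  refine h1.congr_fderiv ?_
  have h2 : fderiv ℝ (flow A) z.1 1 z.2 = flow A z.1 (act A z.2) := by
    have h3 : HasDerivAt (fun σ => flow A σ z.2) (fderiv ℝ (flow A) z.1 1 z.2) z.1 := by
      have := h0.hasFDerivAt.hasDerivAt.clm_apply (hasDerivAt_const z.1 z.2)
      simpa using this
    exact h3.unique (hasDerivAt_act_exp A z.2 z.1)
  refine ContinuousLinearMap.ext fun v => ?_
  have h4 : fderiv ℝ (flow A) z.1 v.1 = v.1 • fderiv ℝ (flow A) z.1 1 := by
    rw [← map_smul, smul_eq_mul, mul_one]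
  change flow A z.1 v.2 + fderiv ℝ (flow A) z.1 v.1 z.2 = flow A z.1 (v.2 + v.1 • act A z.2)
  rw [h4, map_add, map_smul, _root_.smul_apply, h2]

end Flow

set_option linter.unusedSectionVars false

/-! ### Tangency of weak differentials. -/

section Tangency

variable {S : Type u} [TopologicalSpace S] [ChartedSpace Plane S] [IsManifold 𝓘(ℝ, Plane) ∞ S]
  [MeasurableSpace S] [BorelSpace S] [CompactSpace S] {h : Metric2 S} {m n : ℕ}
  {N : Set (EuclideanSpace ℝ (Fin m))}

theorem ae_norm_le_of_mem {w : S → EuclideanSpace ℝ (Fin m)} (hNc : IsCompact N)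
    (hwN : ∀ᵐ x ∂(vol h), w x ∈ N) : ∃ R, ∀ᵐ x ∂(vol h), ‖w x‖ ≤ R := by
  obtain ⟨R, hR⟩ := hNc.isBounded.exists_norm_le
  exact ⟨R, hwN.mono fun x hx => hR _ hx⟩

/-- The weak differential of a map into a submanifold is tangent to it. -/
theorem IsSubmanifold.ae_mem_tangent (hNc : IsCompact N) (hN : IsSubmanifold n N)
    {w : S → EuclideanSpace ℝ (Fin m)} {D : OneForm S (EuclideanSpace ℝ (Fin m))}
    (hD : IsWeakDifferential w D) (hwN : ∀ᵐ x ∂(vol h), w x ∈ N) :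
    ∀ᵐ x ∂(vol h), ∀ v, formAt D x v ∈ tangent N (w x) := by
  obtain ⟨R, hR⟩ := ae_norm_le_of_mem hNc hwN
  have hloc : ∀ q ∈ N, ∃ W : Set (EuclideanSpace ℝ (Fin m)), IsOpen W ∧ q ∈ W ∧
      ∀ᵐ x ∂(vol h), w x ∈ W → ∀ v, formAt D x v ∈ tangent N (w x) := by
    intro q hq
    obtain ⟨k, U, f, -, hU, hqU, hf, hsurj, hNU⟩ := hN q hq
    obtain ⟨r, hr, hrU⟩ := nhds_basis_closedBall.mem_iff.1 (hU.mem_nhds hqU)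
    let χ : ContDiffBump q := ⟨r / 2, r, by linarith, by linarith⟩
    -- The cut-off defining function is globally smooth and vanishes on `N`, so `Φ ∘ w = 0` almost
    -- everywhere. The chain rule gives `dΦ(w) ∘ Dw = 0`, and `dΦ = df` where the cut-off is `1`.
    set Φ : EuclideanSpace ℝ (Fin m) → EuclideanSpace ℝ (Fin k) := fun z => χ z • f z
    have hχ : tsupport χ ⊆ U := by rw [χ.tsupport_eq]; exact hrU
    have hΦ : ContDiff ℝ ∞ Φ := by
      refine contDiff_iff_contDiffAt.2 fun z => ?_
      by_cases hz : z ∈ U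
      · exact χ.contDiff.contDiffAt.smul (hf.contDiffAt (hU.mem_nhds hz))
      · have : Φ =ᶠ[𝓝 z] fun _ => 0 := by
          have h1 : (tsupport χ)ᶜ ∈ 𝓝 z :=
            (isClosed_tsupport _).isOpen_compl.mem_nhds fun h => hz (hχ h)
          filter_upwards [h1] with y hy
          simp only [Φ]
          rw [image_eq_zero_of_notMem_tsupport (f := χ) hy, zero_smul]
        exact contDiffAt_const.congr_of_eventuallyEq this
    have hΦN : ∀ y ∈ N, Φ y = 0 := by
      intro y hy
      simp only [Φ]
      by_cases hyU : y ∈ U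
      · rw [(hNU y hyU).1 hy, smul_zero]
      · rw [image_eq_zero_of_notMem_tsupport (f := χ) fun h => hyU (hχ h), zero_smul]
    have h1 := hD.comp_smooth (hΦ.of_le (by simp)) hR
    have h0 : IsWeakDifferential (fun _ : S => (0 : EuclideanSpace ℝ (Fin k))) 0 := by
      intro c _
      refine (hasWeakDerivOn_of_contDiffOn c.open_target
        (f := fun _ => (0 : EuclideanSpace ℝ (Fin k))) contDiffOn_const).congr
        c.open_target.measurableSet (ae_of_all _ fun _ => rfl) (ae_of_all _ fun y => ?_)
      simp only [fderiv_fun_const, Pi.zero_apply]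
      rfl
    refine ⟨ball q (r / 2), isOpen_ball, mem_ball_self (by linarith), ?_⟩
    filter_upwards [h1.ae_eq h0 (hwN.mono fun x hx => hΦN _ hx), hwN] with x hx hxN hxW v
    have hxU : w x ∈ U := hrU (ball_subset_closedBall (ball_subset_ball (by linarith) hxW))
    have hΦf : Φ =ᶠ[𝓝 (w x)] f := by
      filter_upwards [isOpen_ball.mem_nhds hxW] with y hy
      simp only [Φ]
      rw [χ.one_of_mem_closedBall (ball_subset_closedBall hy), one_smul]
    refine mem_tangent_of_fderiv_eq_zero hU hf hsurj hNU hxU hxN ?_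
    rw [← hΦf.fderiv_eq]
    exact DFunLike.congr_fun hx v
  choose! W hWo hqW hW using hloc
  -- Finitely many neighbourhoods suffice by compactness, so the exceptional null sets can be
  -- united.
  obtain ⟨s, hs, hcov⟩ := hNc.elim_nhds_subcover W
    (fun q hq => (hWo q hq).mem_nhds (hqW q hq))
  have hall : ∀ᵐ x ∂(vol h), ∀ q ∈ s, w x ∈ W q → ∀ v, formAt D x v ∈ tangent N (w x) :=
    (ae_ball_iff s.countable_toSet).2 fun q hq => hW q (hs q hq)
  filter_upwards [hall, hwN] with x hx hxN
  obtain ⟨q, hq, hxq⟩ := mem_iUnion₂.1 (hcov hxN)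
  exact hx q hq hxq

end Tangency

end

/-! ### The first variation along rotations of variable angle. -/

section

open Filter Topology Metric

set_option linter.unusedSectionVars false

section FirstVariation

variable {S : Type u} [TopologicalSpace S] [ChartedSpace Plane S] [IsManifold 𝓘(ℝ, Plane) ∞ S]
  {h : Metric2 S} {m n : ℕ}
  {N : Set (EuclideanSpace ℝ (Fin m))} {G : Subgroup (Matrix.orthogonalGroup (Fin m) ℝ)}
  {A : Matrix (Fin m) (Fin m) ℝ} {p : ℝ} {w : S → EuclideanSpace ℝ (Fin m)}
  {ψ : S → ℝ} {η : EuclideanSpace ℝ (Fin m) → ℝ}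
  {F : Type*} [NormedAddCommGroup F] [InnerProductSpace ℝ F]

local notation "Vec" => EuclideanSpace ℝ (Fin m)

theorem pairing_smul_right (g : Matrix (Fin 2) (Fin 2) ℝ) (α : Plane →L[ℝ] ℝ)
    (D : Plane →L[ℝ] F) (r : ℝ) : pairing g α (r • D) = r • pairing g α D := by
  simp only [pairing, Finset.smul_sum, _root_.smul_apply]
  exact Finset.sum_congr rfl fun i _ => Finset.sum_congr rfl fun j _ => smul_comm _ _ _

theorem formNormSq_nonneg (h : Metric2 S) (D : OneForm S F) (x : S) : 0 ≤ formNormSq h D x :=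
  normSq_nonneg (gram_posDef h x) _

theorem weight_nonneg (h : Metric2 S) (p : ℝ) (w : S → Vec) (x : S) : 0 ≤ weight h p w x :=
  Real.rpow_nonneg (by linarith [formNormSq_nonneg h (wd w) x]) _

theorem norm_formPairing_le (h : Metric2 S) (α : OneForm S ℝ) (D : OneForm S F) (x : S) :
    ‖formPairing h α D x‖ ≤ √(formNormSq h α x) * √(formNormSq h D x) :=
  norm_pairing_le (gram_posDef h x) _ _

theorem sqrt_formNormSq_perpB_le (h : Metric2 S) (p : ℝ) (w : S → Vec)
    (A : Matrix (Fin m) (Fin m) ℝ) (x : S) :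
    √(formNormSq h (perpB h p w A) x) ≤
      ‖act A (w x)‖ * (weight h p w x * √(formNormSq h (wd w) x)) := by
  have h1 : formNormSq h (perpB h p w A) x = (-weight h p w x) ^ 2 *
      normSq (gram h x) ((innerSL ℝ (act A (w x))).comp (formAt (wd w) x)) := normSq_smul _ _
  have h2 := normSq_comp_le (gram_posDef h x) (innerSL ℝ (act A (w x))) (formAt (wd w) x)
  rw [innerSL_apply_norm] at h2
  rw [h1, neg_sq, Real.sqrt_mul (sq_nonneg _), Real.sqrt_sq (weight_nonneg h p w x)]
  calc _ ≤ weight h p w x * (‖act A (w x)‖ * √(formNormSq h (wd w) x)) :=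
        mul_le_mul_of_nonneg_left h2 (weight_nonneg h p w x)
    _ = _ := by ring

/-- The differential of `ψ · (η ∘ w)`. -/
def testForm (ψ : S → ℝ) (η : Vec → ℝ) (w : S → Vec) : OneForm S ℝ := fun x =>
  η (w x) • smoothD ψ x + ψ x • (fderiv ℝ η (w x)).comp (wd w x)

theorem contDiff_flow_apply (A : Matrix (Fin m) (Fin m) ℝ) :
    ContDiff ℝ ∞ fun z : ℝ × Vec => flow A z.1 z.2 :=
  ((contDiff_flow A).comp contDiff_fst).clm_apply contDiff_snd

theorem flow_mem (hG : ActsTransitively G N) (hA : A ∈ lieAlg G) (σ : ℝ) {q : Vec}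
    (hq : q ∈ N) : flow A σ q ∈ N :=
  act_mem_of_mem_matSet hG (hA σ) hq

theorem contMDiff_flow (hψ : ContMDiff 𝓘(ℝ, Plane) 𝓘(ℝ, ℝ) ∞ ψ) (hη : ContDiff ℝ ∞ η) :
    ContMDiff ((𝓘(ℝ, ℝ).prod 𝓘(ℝ, Plane)).prod 𝓘(ℝ, Vec)) 𝓘(ℝ, Vec) ∞
      (fun z : (ℝ × S) × Vec => flow A (z.1.1 * (ψ z.1.2 * η z.2)) z.2) := by
  have ht : ContMDiff ((𝓘(ℝ, ℝ).prod 𝓘(ℝ, Plane)).prod 𝓘(ℝ, Vec)) 𝓘(ℝ, ℝ) ∞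
      (fun z : (ℝ × S) × Vec => z.1.1) := contMDiff_fst.comp contMDiff_fst
  have hx : ContMDiff ((𝓘(ℝ, ℝ).prod 𝓘(ℝ, Plane)).prod 𝓘(ℝ, Vec)) 𝓘(ℝ, ℝ) ∞
      (fun z : (ℝ × S) × Vec => ψ z.1.2) := hψ.comp (contMDiff_snd.comp contMDiff_fst)
  have hq : ContMDiff ((𝓘(ℝ, ℝ).prod 𝓘(ℝ, Plane)).prod 𝓘(ℝ, Vec)) 𝓘(ℝ, Vec) ∞
      (fun z : (ℝ × S) × Vec => z.2) := contMDiff_snd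
  have h2 : ContMDiff ((𝓘(ℝ, ℝ).prod 𝓘(ℝ, Plane)).prod 𝓘(ℝ, Vec)) 𝓘(ℝ, ℝ) ∞
      (fun z : (ℝ × S) × Vec => z.1.1 * (ψ z.1.2 * η z.2)) :=
    ht.smul (hx.smul (hη.contMDiff.comp hq))
  have h3 := (contDiff_flow_apply A).contMDiff.comp (h2.prodMk_space hq)
  exact h3

/-- Since the angle also depends on the target point through `η`, the merely Sobolev test function
`ψ · (η ∘ w)` arises from a smooth variation. -/
theorem isTargetVariation_flow (hG : ActsTransitively G N) (hA : A ∈ lieAlg G)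
    (hψ : ContMDiff 𝓘(ℝ, Plane) 𝓘(ℝ, ℝ) ∞ ψ) (hη : ContDiff ℝ ∞ η) :
    IsTargetVariation N fun (t : ℝ) (x : S) q => flow A (t * (ψ x * η q)) q :=
  ⟨contMDiff_flow hψ hη, fun t x q hq => flow_mem hG hA _ hq, fun x q _ => by
    change flow A (0 * _) q = q
    rw [zero_mul, flow_zero]⟩

variable [MeasurableSpace S] [BorelSpace S] [CompactSpace S]

/-- By the factored differential of the flow, the gradient of the varied map is a rotation applied
to a rank-one perturbation of `∇w`. -/
theorem isWeakDifferential_flow (hψ : ContMDiff 𝓘(ℝ, Plane) 𝓘(ℝ, ℝ) ∞ ψ)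
    (hη : ContDiff ℝ ∞ η) (hw : IsWeakDifferential w (wd w)) {R : ℝ}
    (hR : ∀ᵐ x ∂(vol h), ‖w x‖ ≤ R) (t : ℝ) :
    IsWeakDifferential (fun x => flow A (t * (ψ x * η (w x))) (w x)) (fun x =>
      (flow A (t * (ψ x * η (w x)))).comp
        (formAt (wd w) x + t • (formAt (testForm ψ η w) x).smulRight (act A (w x)))) := by
  have h2 : ContDiff ℝ ∞ fun z : ℝ × Vec => (t * (z.1 * η z.2), z.2) :=
    (contDiff_const.mul (contDiff_fst.mul (hη.comp contDiff_snd))).prodMk contDiff_snd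
  have h3 := hw.comp_pair (h := h) hψ (((contDiff_flow_apply A).comp h2).of_le (by simp)) hR
  have key : ∀ x, (flow A (t * (ψ x * η (w x)))).comp
        (formAt (wd w) x + t • (formAt (testForm ψ η w) x).smulRight (act A (w x))) =
      (fderiv ℝ ((fun z : ℝ × Vec => flow A z.1 z.2) ∘
        fun z : ℝ × Vec => (t * (z.1 * η z.2), z.2)) (ψ x, w x)).comp
        ((formAt (smoothD ψ) x).prod (formAt (wd w) x)) := by
    intro x
    have hη' : HasFDerivAt η (fderiv ℝ η (w x)) (w x) :=
      (hη.differentiable (by simp) _).hasFDerivAt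
    have hd1 : HasFDerivAt (fun z : ℝ × Vec => z.1) (ContinuousLinearMap.fst ℝ ℝ Vec)
        (ψ x, w x) := hasFDerivAt_fst
    have hd2 : HasFDerivAt (fun z : ℝ × Vec => z.2) (ContinuousLinearMap.snd ℝ ℝ Vec)
        (ψ x, w x) := hasFDerivAt_snd
    have hd3 : HasFDerivAt (fun z : ℝ × Vec => η z.2)
        ((fderiv ℝ η (w x)).comp (ContinuousLinearMap.snd ℝ ℝ Vec)) (ψ x, w x) :=
      HasFDerivAt.comp (g := η) (ψ x, w x) hη' hd2
    have h4 := ((hd1.fun_mul hd3).const_mul t).prodMk hd2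
    have h5 := ((hasFDerivAt_flow A (t * (ψ x * η (w x)), w x)).comp (ψ x, w x) h4).fderiv
    rw [h5]
    refine ContinuousLinearMap.ext fun v => ?_
    have h6 : t • ((η (w x) * formAt (smoothD ψ) x v +
        ψ x * fderiv ℝ η (w x) (formAt (wd w) x v)) • act A (w x)) =
        (t * (ψ x * fderiv ℝ η (w x) (formAt (wd w) x v) +
          η (w x) * formAt (smoothD ψ) x v)) • act A (w x) := by
      rw [smul_smul, add_comm (η (w x) * _)]
    change flow A _ (formAt (wd w) x v + t • ((η (w x) * formAt (smoothD ψ) x v +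
      ψ x * fderiv ℝ η (w x) (formAt (wd w) x v)) • act A (w x))) = _
    rw [h6]
    rfl
  intro c hc
  refine (h3 c hc).congr c.open_target.measurableSet (ae_of_all _ fun y => rfl)
    (ae_of_all _ fun y => ?_)
  rw [chartRep_eq, chartRep_eq]
  exact congrArg (fun T : Plane →L[ℝ] Vec => T.comp (chartJac c y)) (key (c.symm y)).symm

/-- The isometry drops out of the norm and the quadratic expansion is exact. Orthogonality of `exp
(σ A)` is where `A ∈ lieAlg G` enters. -/
theorem energy_flow (hA : A ∈ lieAlg G)
    (hψ : ContMDiff 𝓘(ℝ, Plane) 𝓘(ℝ, ℝ) ∞ ψ)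
    (hη : ContDiff ℝ ∞ η) (hw : IsWeakDifferential w (wd w)) {R : ℝ}
    (hR : ∀ᵐ x ∂(vol h), ‖w x‖ ≤ R) (t : ℝ) :
    energy h p (fun x => flow A (t * (ψ x * η (w x))) (w x)) =
      ∫ x, (1 + (formNormSq h (wd w) x + 2 * t * formPairing h (testForm ψ η w)
        (fun x => (innerSL ℝ (act A (w x))).comp (wd w x)) x +
        t ^ 2 * (formNormSq h (testForm ψ η w) x * ‖act A (w x)‖ ^ 2))) ^ (p / 2) ∂(vol h) := by
  refine integral_congr_ae ?_
  filter_upwards [(isWeakDifferential_flow (A := A) hψ hη hw hR t).ae_eq_wd (h := h)] with x hx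
  have h1 : formNormSq h (wd fun x => flow A (t * (ψ x * η (w x))) (w x)) x =
      normSq (gram h x) ((flow A (t * (ψ x * η (w x)))).comp
        (formAt (wd w) x + t • (formAt (testForm ψ η w) x).smulRight (act A (w x)))) :=
    congrArg (normSq (gram h x)) hx
  rw [h1, normSq_comp_isometry _ (fun v z => inner_act_of_mem_matSet (hA _) v z),
    normSq_add_smul_smulRight (gram_posDef h x)]
  rfl

/-- From `1 + a ≤ (1 + √a)²`; the constant `1` belongs to `Lᵖ` because the volume is finite. -/
theorem MemW1p.integrable_rpow {f : S → F} (hp : 2 < p) (hf : MemW1p h p f) :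
    Integrable (fun x => (1 + formNormSq h (wd f) x) ^ (p / 2)) (vol h) := by
  have h1 : MemLp (fun x => 1 + √(formNormSq h (wd f) x)) (ENNReal.ofReal p) (vol h) :=
    MemLp.add (f := fun _ : S => (1 : ℝ)) (memLp_const 1) hf.2.2
  have h2 := h1.integrable_norm_rpow (by simp; linarith) ENNReal.ofReal_ne_top
  rw [ENNReal.toReal_ofReal (by linarith)] at h2
  have hm := aestronglyMeasurable_formNormSq (h := h)
    (isWeakDifferential_wd hf.2.1).isMeasurableForm
  refine h2.mono' ((aestronglyMeasurable_const.add hm).aemeasurable.pow_const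
    _).aestronglyMeasurable (ae_of_all _ fun x => ?_)
  have ha := formNormSq_nonneg h (wd f) x
  have hs := Real.sqrt_nonneg (formNormSq h (wd f) x)
  rw [Real.norm_of_nonneg (Real.rpow_nonneg (by linarith) _), Real.norm_of_nonneg (by linarith)]
  calc (1 + formNormSq h (wd f) x) ^ (p / 2) ≤ ((1 + √(formNormSq h (wd f) x)) ^ (2 : ℝ)) ^ (p / 2) := by
        refine Real.rpow_le_rpow (by linarith) ?_ (by linarith)
        rw [Real.rpow_two, add_sq, Real.sq_sqrt ha]
        linarith
    _ = _ := by rw [← Real.rpow_mul (by linarith)]; congr 1; ring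

theorem weight_mul_eq (h : Metric2 S) (p : ℝ) (w : S → Vec) (x : S) :
    weight h p w x * (1 + formNormSq h (wd w) x) = (1 + formNormSq h (wd w) x) ^ (p / 2) := by
  have := formNormSq_nonneg h (wd w) x
  rw [weight, Real.rpow_sub_one (by linarith)]
  field_simp

theorem aestronglyMeasurable_weight_chart (hw : IsWeakDifferential w (wd w))
    {c : OpenPartialHomeomorph S Plane} (hc : c ∈ charts S) :
    AEStronglyMeasurable (fun y => weight h p w (c.symm y)) (volume.restrict c.target) :=
  ((aestronglyMeasurable_const.add (aestronglyMeasurable_formNormSq_chart hw.isMeasurableForm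
    hc)).aemeasurable.pow_const _).aestronglyMeasurable

theorem IsWeakDifferential.isMeasurableForm_comp (hw : IsWeakDifferential w (wd w))
    {F' : Type*} [NormedAddCommGroup F'] [InnerProductSpace ℝ F'] {T : Vec → Vec →L[ℝ] F'}
    (hT : Continuous T) : IsMeasurableForm (fun x => (T (w x)).comp (wd w x)) :=
  hw.isMeasurableForm.clm_comp (T := fun x => T (w x)) fun c hc =>
    hT.comp_aestronglyMeasurable (hw c hc).aestronglyMeasurable

theorem IsWeakDifferential.isMeasurableForm_inner (hw : IsWeakDifferential w (wd w))
    (A : Matrix (Fin m) (Fin m) ℝ) :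
    IsMeasurableForm (fun x => (innerSL ℝ (act A (w x))).comp (wd w x)) :=
  hw.isMeasurableForm_comp (T := fun q => innerSL ℝ (act A q))
    ((innerSL ℝ).continuous.comp (contDiff_act A).continuous)

theorem isMeasurableForm_perpB (hw : IsWeakDifferential w (wd w))
    (A : Matrix (Fin m) (Fin m) ℝ) : IsMeasurableForm (perpB h p w A) :=
  (hw.isMeasurableForm_inner A).smul (a := fun x => -weight h p w x) fun _ hc =>
    (aestronglyMeasurable_weight_chart hw hc).neg

theorem isMeasurableForm_testForm (hψ : ContMDiff 𝓘(ℝ, Plane) 𝓘(ℝ, ℝ) ∞ ψ)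
    (hη : ContDiff ℝ ∞ η) (hw : IsWeakDifferential w (wd w)) :
    IsMeasurableForm (testForm ψ η w) :=
  ((isWeakDifferential_smoothD hψ).isMeasurableForm.smul fun c hc =>
    hη.continuous.comp_aestronglyMeasurable (hw c hc).aestronglyMeasurable).add
  ((hw.isMeasurableForm_comp (hη.continuous_fderiv (by simp))).smul fun c hc =>
    (isWeakDifferential_smoothD hψ c hc).aestronglyMeasurable)

theorem exists_formNormSq_testForm_le (hNc : IsCompact N)
    (hψ : ContMDiff 𝓘(ℝ, Plane) 𝓘(ℝ, ℝ) ∞ ψ) (hη : ContDiff ℝ ∞ η) :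
    ∃ K : ℝ, 0 ≤ K ∧ ∀ x, w x ∈ N →
      formNormSq h (testForm ψ η w) x ≤ K * (1 + formNormSq h (wd w) x) := by
  obtain ⟨M, hM0, hM⟩ := exists_norm_smoothD_le h hψ
  obtain ⟨M₁, hM₁⟩ := isCompact_univ.exists_bound_of_continuousOn hψ.continuous.continuousOn
  obtain ⟨M₂, hM₂⟩ := hNc.exists_bound_of_continuousOn hη.continuous.continuousOn
  obtain ⟨M₃, hM₃⟩ := hNc.exists_bound_of_continuousOn
    (hη.continuous_fderiv (by simp)).continuousOn
  refine ⟨2 * (M₂ ^ 2 * M ^ 2) + 2 * (M₁ ^ 2 * M₃ ^ 2), by positivity, fun x hx => ?_⟩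
  have ha := formNormSq_nonneg h (wd w) x
  have h1 : formNormSq h (testForm ψ η w) x ≤
      2 * ((η (w x)) ^ 2 * formNormSq h (smoothD ψ) x) + 2 * ((ψ x) ^ 2 *
        normSq (gram h x) ((fderiv ℝ η (w x)).comp (formAt (wd w) x))) := by
    have := normSq_add_le (gram_posDef h x) (η (w x) • formAt (smoothD ψ) x)
      (ψ x • (fderiv ℝ η (w x)).comp (formAt (wd w) x))
    rw [normSq_smul, normSq_smul] at this
    exact this
  have h2 : formNormSq h (smoothD ψ) x ≤ M ^ 2 := by
    rw [← Real.sqrt_le_left hM0]; exact hM x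
  have h3 : normSq (gram h x) ((fderiv ℝ η (w x)).comp (formAt (wd w) x)) ≤
      M₃ ^ 2 * formNormSq h (wd w) x := by
    have h4 := normSq_comp_le (gram_posDef h x) (fderiv ℝ η (w x)) (formAt (wd w) x)
    have h5 := normSq_nonneg (gram_posDef h x) ((fderiv ℝ η (w x)).comp (formAt (wd w) x))
    have h6 : √(normSq (gram h x) ((fderiv ℝ η (w x)).comp (formAt (wd w) x))) ≤
        M₃ * √(formNormSq h (wd w) x) :=
      h4.trans (mul_le_mul_of_nonneg_right (hM₃ _ hx) (Real.sqrt_nonneg _))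
    have h7 := pow_le_pow_left₀ (Real.sqrt_nonneg _) h6 2
    rwa [Real.sq_sqrt h5, mul_pow, Real.sq_sqrt ha] at h7
  have h4 : (η (w x)) ^ 2 ≤ M₂ ^ 2 := sq_le_sq' (by
    have := hM₂ _ hx; rw [Real.norm_eq_abs, abs_le] at this; exact this.1) (by
    have := hM₂ _ hx; rw [Real.norm_eq_abs, abs_le] at this; exact this.2)
  have h5 : (ψ x) ^ 2 ≤ M₁ ^ 2 := sq_le_sq' (by
    have := hM₁ x (mem_univ _); rw [Real.norm_eq_abs, abs_le] at this; exact this.1) (by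
    have := hM₁ x (mem_univ _); rw [Real.norm_eq_abs, abs_le] at this; exact this.2)
  have h6 : (η (w x)) ^ 2 * formNormSq h (smoothD ψ) x ≤ M₂ ^ 2 * M ^ 2 :=
    mul_le_mul h4 h2 (formNormSq_nonneg h _ x) (sq_nonneg _)
  have h7 : (ψ x) ^ 2 * normSq (gram h x) ((fderiv ℝ η (w x)).comp (formAt (wd w) x)) ≤
      M₁ ^ 2 * (M₃ ^ 2 * formNormSq h (wd w) x) :=
    mul_le_mul h5 h3 (normSq_nonneg (gram_posDef h x) _) (sq_nonneg _)
  have h8 : 0 ≤ M₂ ^ 2 * M ^ 2 * formNormSq h (wd w) x := by positivity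
  have h9 : 0 ≤ M₁ ^ 2 * M₃ ^ 2 := by positivity
  nlinarith

/-- The first variation of the energy along the flow of `ψ η A`. -/
theorem IsPHarmonic.integral_testForm_eq_zero (hNc : IsCompact N) (hG : ActsTransitively G N)
    (hA : A ∈ lieAlg G) (hp : 2 < p) (hw : IsPHarmonic h N p w)
    (hψ : ContMDiff 𝓘(ℝ, Plane) 𝓘(ℝ, ℝ) ∞ ψ) (hη : ContDiff ℝ ∞ η) :
    Integrable (formPairing h (testForm ψ η w) (perpB h p w A)) (vol h) ∧
      ∫ x, formPairing h (testForm ψ η w) (perpB h p w A) x ∂(vol h) = 0 := by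
  obtain ⟨hW, hwN, hcrit⟩ := hw
  have hwd := isWeakDifferential_wd hW.2.1
  obtain ⟨R, hR⟩ := ae_norm_le_of_mem hNc hwN
  obtain ⟨K, hK0, hK⟩ := exists_formNormSq_testForm_le (h := h) (w := w) hNc hψ hη
  obtain ⟨M, hM⟩ := hNc.exists_bound_of_continuousOn (contDiff_act A).continuous.continuousOn
  set a : S → ℝ := formNormSq h (wd w)
  set b : S → ℝ := formPairing h (testForm ψ η w)
    (fun x => (innerSL ℝ (act A (w x))).comp (wd w x))
  set c : S → ℝ := fun x => formNormSq h (testForm ψ η w) x * ‖act A (w x)‖ ^ 2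
  have hmt := isMeasurableForm_testForm hψ hη hwd
  have ha : AEStronglyMeasurable a (vol h) := aestronglyMeasurable_formNormSq hwd.isMeasurableForm
  have hb : AEStronglyMeasurable b (vol h) :=
    aestronglyMeasurable_formPairing hmt (hwd.isMeasurableForm_inner A)
  have hc : AEStronglyMeasurable c (vol h) :=
    (aestronglyMeasurable_formNormSq hmt).mul
      (((contDiff_act A).continuous.norm.pow 2).comp_aestronglyMeasurable hwd.aestronglyMeasurable)
  have ha0 : ∀ x, 0 ≤ a x := formNormSq_nonneg h _
  have hc0 : ∀ x, 0 ≤ c x := fun x => mul_nonneg (formNormSq_nonneg h _ x) (sq_nonneg _)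
  have hcb : ∀ x, w x ∈ N → c x ≤ K * M ^ 2 * (1 + a x) := by
    intro x hx
    have h1 : ‖act A (w x)‖ ^ 2 ≤ M ^ 2 := pow_le_pow_left₀ (norm_nonneg _) (hM _ hx) 2
    calc c x ≤ K * (1 + a x) * M ^ 2 := mul_le_mul (hK x hx) h1 (sq_nonneg _)
          (mul_nonneg hK0 (by linarith [ha0 x]))
      _ = _ := by ring
  -- Cauchy–Schwarz for the mixed coefficient, so that a bound on `c` also bounds `b`.
  have hb2 : ∀ x, (b x) ^ 2 ≤ c x * a x := by
    intro x
    have h1 : |b x| ≤ √(formNormSq h (testForm ψ η w) x) * (‖act A (w x)‖ * √(a x)) := by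
      refine (norm_formPairing_le h (testForm ψ η w)
        (fun x => (innerSL ℝ (act A (w x))).comp (wd w x)) x).trans
        (mul_le_mul_of_nonneg_left ?_ (Real.sqrt_nonneg _))
      have := normSq_comp_le (gram_posDef h x) (innerSL ℝ (act A (w x))) (formAt (wd w) x)
      rw [innerSL_apply_norm] at this
      exact this
    have h2 := pow_le_pow_left₀ (abs_nonneg _) h1 2
    rw [sq_abs, mul_pow, mul_pow, Real.sq_sqrt (formNormSq_nonneg h _ x),
      Real.sq_sqrt (ha0 x)] at h2
    simp only [c]
    linarith
  -- One constant for both coefficients: only `b² ≤ K M² (1 + a)²` is available, and the added `1`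
  -- ensures `K M² ≤ K'²`.
  set K' := K * M ^ 2 + 1
  have hKM : 0 ≤ K * M ^ 2 := by positivity
  have hpos : ∀ x t, 0 ≤ a x + 2 * t * b x + t ^ 2 * c x := by
    intro x t
    have h1 := normSq_nonneg (gram_posDef h x)
      (formAt (wd w) x + t • (formAt (testForm ψ η w) x).smulRight (act A (w x)))
    rwa [normSq_add_smul_smulRight (gram_posDef h x)] at h1
  obtain ⟨hint, hder⟩ := hasDerivAt_integral_rpow (μ := vol h) (K := K') hp (by positivity) ha hb hc
    (ae_of_all _ ha0) (by
      filter_upwards [hwN] with x hx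
      refine abs_le_of_sq_le_sq ?_ (by have := ha0 x; positivity)
      have h1 := hb2 x
      have h2 := hcb x hx
      have h3 : c x * a x ≤ K * M ^ 2 * (1 + a x) * (1 + a x) :=
        mul_le_mul h2 (by linarith) (ha0 x) (by have := ha0 x; positivity)
      have h4 : K * M ^ 2 ≤ K' ^ 2 := by simp only [K']; nlinarith
      calc (b x) ^ 2 ≤ K * M ^ 2 * (1 + a x) ^ 2 := by nlinarith
        _ ≤ K' ^ 2 * (1 + a x) ^ 2 := mul_le_mul_of_nonneg_right h4 (sq_nonneg _)
        _ = _ := by ring)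
    (by
      filter_upwards [hwN] with x hx
      rw [abs_of_nonneg (hc0 x)]
      refine (hcb x hx).trans (mul_le_mul_of_nonneg_right (by simp only [K']; linarith) ?_)
      linarith [ha0 x])
    (ae_of_all _ hpos) (hW.integrable_rpow hp)
  have henergy := hcrit _ (isTargetVariation_flow hG hA hψ hη)
  simp only [energy_flow hA hψ hη hwd hR] at henergy
  -- Criticality says that the derivative is `0`; differentiation under the integral says that it is
  -- `p` times the integral sought.
  have h0 := henergy.unique hder
  have h1 : ∀ x, formPairing h (testForm ψ η w) (perpB h p w A) x =
      -((1 + a x) ^ (p / 2 - 1) * b x) := by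
    intro x
    have h2 := pairing_smul_right (gram h x) (formAt (testForm ψ η w) x)
      ((innerSL ℝ (act A (w x))).comp (formAt (wd w) x)) (-weight h p w x)
    rw [smul_eq_mul, neg_mul] at h2
    exact h2
  have h2 : formPairing h (testForm ψ η w) (perpB h p w A) = fun x =>
      -((1 + a x) ^ (p / 2 - 1) * b x) := funext h1
  rw [h2]
  refine ⟨hint.neg, ?_⟩
  rw [integral_neg, neg_eq_zero]
  rcases mul_eq_zero.1 h0.symm with h3 | h3
  · linarith
  · exact h3

end FirstVariation

end

/-! ### Conservation laws and the equation. -/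

section

open Filter Topology Metric

set_option linter.unusedSectionVars false

section PairingIdentities

variable {F : Type*} [NormedAddCommGroup F] [InnerProductSpace ℝ F]
  {g : Matrix (Fin 2) (Fin 2) ℝ}

theorem pairing_add_left (α β : Plane →L[ℝ] ℝ) (D : Plane →L[ℝ] F) :
    pairing g (α + β) D = pairing g α D + pairing g β D := by
  simp only [pairing, ← Finset.sum_add_distrib, _root_.add_apply, mul_add, add_smul]

theorem pairing_smul_left (r : ℝ) (α : Plane →L[ℝ] ℝ) (D : Plane →L[ℝ] F) :
    pairing g (r • α) D = r • pairing g α D := by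
  simp only [pairing, Finset.smul_sum, _root_.smul_apply, smul_smul, smul_eq_mul]
  exact Finset.sum_congr rfl fun i _ => Finset.sum_congr rfl fun j _ => by congr 1; ring

theorem pairing_comm (hg : g.PosDef) (α β : Plane →L[ℝ] ℝ) :
    pairing g α β = pairing g β α := by
  obtain ⟨Q, hQ⟩ := exists_inv_eq_transpose_mul hg
  rw [pairing_eq_sum hQ, pairing_eq_sum hQ]
  exact Finset.sum_congr rfl fun a _ => mul_comm _ _

theorem inner_pairing (v : F) (α : Plane →L[ℝ] ℝ) (D : Plane →L[ℝ] F) :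
    ⟪v, pairing g α D⟫ = pairing g α ((innerSL ℝ v).comp D) := by
  simp only [pairing, inner_sum, inner_smul_right]
  rfl

theorem pairing_eq_sum_smul {ι : Type*} [Fintype ι] (α : Plane →L[ℝ] ℝ) {D : Plane →L[ℝ] F}
    {β : ι → Plane →L[ℝ] ℝ} {y : ι → F} (hD : ∀ z, D z = ∑ i, β i z • y i) :
    pairing g α D = ∑ i, pairing g α (β i) • y i := by
  simp only [pairing, hD, Fin.sum_univ_two, Finset.smul_sum, smul_smul, smul_eq_mul,
    ← Finset.sum_add_distrib, ← add_smul]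

/-- The pointwise algebra behind the equation. By the frame identity `hD` the terms with `α` add up
to the full gradient `D`; those with `s` are the contractions with the differentials of the frame
fields. -/
theorem sum_pairing_eq_inner (hg : g.PosDef) {ι : Type*} [Fintype ι] (α : Plane →L[ℝ] ℝ)
    {D : Plane →L[ℝ] F} {a y : ι → F} {T : ι → F →L[ℝ] F} (r s : ℝ) (v : F)
    (hD : ∀ z, D z = ∑ i, ⟪a i, D z⟫ • y i) :
    ∑ i, pairing g (⟪v, y i⟫ • α + s • ((innerSL ℝ v).comp (T i)).comp D)
        (-r • (innerSL ℝ (a i)).comp D) =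
      ⟪v, -(r • pairing g α D) +
        s • ∑ i, pairing g (-r • (innerSL ℝ (a i)).comp D) ((T i).comp D)⟫ := by
  have h1 := pairing_eq_sum_smul (g := g) α (D := D) (β := fun i => (innerSL ℝ (a i)).comp D)
    (y := y) hD
  rw [inner_add_right, inner_neg_right, inner_smul_right, inner_smul_right, inner_sum, h1,
    inner_sum, Finset.mul_sum, Finset.mul_sum, ← Finset.sum_neg_distrib, ← Finset.sum_add_distrib]
  refine Finset.sum_congr rfl fun i _ => ?_
  rw [pairing_add_left, pairing_smul_left, pairing_smul_left, pairing_smul_right,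
    inner_pairing, inner_smul_right,
    pairing_comm hg (-r • (innerSL ℝ (a i)).comp D), ContinuousLinearMap.comp_assoc]
  simp only [smul_eq_mul, pairing_smul_right]
  ring

end PairingIdentities

section Conservation

variable {S : Type u} [TopologicalSpace S] [ChartedSpace Plane S] [IsManifold 𝓘(ℝ, Plane) ∞ S]
  [MeasurableSpace S] [BorelSpace S] [CompactSpace S]
  {h : Metric2 S} {m n L : ℕ}
  {N : Set (EuclideanSpace ℝ (Fin m))} {G : Subgroup (Matrix.orthogonalGroup (Fin m) ℝ)}
  {A : Fin L → Matrix (Fin m) (Fin m) ℝ}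
  {Y : Fin L → EuclideanSpace ℝ (Fin m) → EuclideanSpace ℝ (Fin m)}
  {B : Matrix (Fin m) (Fin m) ℝ} {Z : EuclideanSpace ℝ (Fin m) → EuclideanSpace ℝ (Fin m)}
  {p C : ℝ} {w : S → EuclideanSpace ℝ (Fin m)} {ψ : S → ℝ}
  {c : OpenPartialHomeomorph S Plane}

local notation "Vec" => EuclideanSpace ℝ (Fin m)

theorem ae_wd_comp_eq (hNc : IsCompact N) (hw : IsPHarmonic h N p w) (hZ : ContDiff ℝ ∞ Z) :
    ∀ᵐ x ∂(vol h), formAt (wd (Z ∘ w)) x = (fderiv ℝ Z (w x)).comp (formAt (wd w) x) := by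
  obtain ⟨R, hR⟩ := ae_norm_le_of_mem hNc hw.2.1
  exact ((isWeakDifferential_wd hw.1.2.1).comp_smooth (hZ.of_le (by simp)) hR).ae_eq_wd

theorem IsPHarmonic.exists_isWeakDifferential_comp (hNc : IsCompact N)
    (hw : IsPHarmonic h N p w) (hZ : ContDiff ℝ ∞ Z) :
    ∃ D : OneForm S Vec, IsWeakDifferential (Z ∘ w) D := by
  obtain ⟨R, hR⟩ := ae_norm_le_of_mem hNc hw.2.1
  exact ⟨_, (isWeakDifferential_wd hw.1.2.1).comp_smooth (hZ.of_le (by simp)) hR⟩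

theorem ae_sqrt_formNormSq_comp_le (hNc : IsCompact N) (hw : IsPHarmonic h N p w)
    (hZ : ContDiff ℝ ∞ Z) (hC : ∀ q ∈ N, ‖fderiv ℝ Z q‖ ≤ C) :
    ∀ᵐ x ∂(vol h), √(formNormSq h (wd (Z ∘ w)) x) ≤ C * √(formNormSq h (wd w) x) := by
  filter_upwards [ae_wd_comp_eq hNc hw hZ, hw.2.1] with x hx hxN
  have h1 := normSq_comp_le (gram_posDef h x) (fderiv ℝ Z (w x)) (formAt (wd w) x)
  rw [← hx] at h1
  exact h1.trans (mul_le_mul_of_nonneg_right (hC _ hxN) (Real.sqrt_nonneg _))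

theorem ae_sqrt_formNormSq_perpB_le (hw : IsPHarmonic h N p w) (hC : ∀ q ∈ N, ‖act B q‖ ≤ C) :
    ∀ᵐ x ∂(vol h), √(formNormSq h (perpB h p w B) x) ≤
      C * (weight h p w x * √(formNormSq h (wd w) x)) := by
  filter_upwards [hw.2.1] with x hxN
  exact (sqrt_formNormSq_perpB_le h p w B x).trans (mul_le_mul_of_nonneg_right (hC _ hxN)
    (mul_nonneg (weight_nonneg h p w x) (Real.sqrt_nonneg _)))

theorem memW1p_comp (hNc : IsCompact N) (hw : IsPHarmonic h N p w)
    (hZ : ContDiff ℝ ∞ Z) : MemW1p h p (Z ∘ w) := by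
  have hD := hw.exists_isWeakDifferential_comp hNc hZ
  have hwd := isWeakDifferential_wd hD
  obtain ⟨M, hM⟩ := hNc.exists_bound_of_continuousOn hZ.continuous.continuousOn
  obtain ⟨C, hC⟩ := hNc.exists_bound_of_continuousOn
    (hZ.continuous_fderiv (by simp)).continuousOn
  refine ⟨MemLp.of_bound hwd.aestronglyMeasurable M (hw.2.1.mono fun x hx => hM _ hx), hD, ?_⟩
  refine hw.1.2.2.of_le_mul (c := C)
    (Real.continuous_sqrt.comp_aestronglyMeasurable
      (aestronglyMeasurable_formNormSq hwd.isMeasurableForm)) ?_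
  filter_upwards [ae_sqrt_formNormSq_comp_le hNc hw hZ hC] with x hx
  rwa [Real.norm_of_nonneg (Real.sqrt_nonneg _), Real.norm_of_nonneg (Real.sqrt_nonneg _)]

/-- Because `√a ≤ 1 + a`; the right-hand side is integrable for maps in `W^{1,p}`. -/
theorem weight_mul_sqrt_le (h : Metric2 S) (p : ℝ) (w : S → Vec) (x : S) :
    weight h p w x * √(formNormSq h (wd w) x) ≤ (1 + formNormSq h (wd w) x) ^ (p / 2) := by
  rw [← weight_mul_eq]
  refine mul_le_mul_of_nonneg_left ?_ (weight_nonneg h p w x)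
  have ha := formNormSq_nonneg h (wd w) x
  rw [Real.sqrt_le_left (by linarith)]
  nlinarith

theorem weight_mul_le (h : Metric2 S) (p : ℝ) (w : S → Vec) (x : S) :
    weight h p w x * formNormSq h (wd w) x ≤ (1 + formNormSq h (wd w) x) ^ (p / 2) := by
  rw [← weight_mul_eq]
  exact mul_le_mul_of_nonneg_left (by linarith) (weight_nonneg h p w x)

theorem aestronglyMeasurable_weight (hw : IsWeakDifferential w (wd w)) :
    AEStronglyMeasurable (weight h p w) (vol h) :=
  aestronglyMeasurable_vol fun _ hc => aestronglyMeasurable_weight_chart hw hc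

theorem integrable_weight_smul_formPairing (hp : 2 < p) (hw : IsPHarmonic h N p w)
    (hψ : ContMDiff 𝓘(ℝ, Plane) 𝓘(ℝ, ℝ) ∞ ψ) :
    Integrable (fun x => weight h p w x • formPairing h (smoothD ψ) (wd w) x) (vol h) := by
  have hwd := isWeakDifferential_wd hw.1.2.1
  obtain ⟨M, hM0, hM⟩ := exists_norm_smoothD_le h hψ
  refine ((hw.1.integrable_rpow hp).const_mul M).mono' ((aestronglyMeasurable_weight hwd).smul
    (aestronglyMeasurable_formPairing (isWeakDifferential_smoothD hψ).isMeasurableForm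
      hwd.isMeasurableForm)) (ae_of_all _ fun x => ?_)
  rw [norm_smul, Real.norm_of_nonneg (weight_nonneg h p w x)]
  calc _ ≤ weight h p w x * (M * √(formNormSq h (wd w) x)) := by
        refine mul_le_mul_of_nonneg_left ?_ (weight_nonneg h p w x)
        exact (norm_formPairing_le h _ _ x).trans
          (mul_le_mul_of_nonneg_right (hM x) (Real.sqrt_nonneg _))
    _ = M * (weight h p w x * √(formNormSq h (wd w) x)) := by ring
    _ ≤ _ := mul_le_mul_of_nonneg_left (weight_mul_sqrt_le h p w x) hM0

theorem integrable_smul_formPairing_perpB (hNc : IsCompact N) (hp : 2 < p)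
    (hw : IsPHarmonic h N p w) (hψ : ContMDiff 𝓘(ℝ, Plane) 𝓘(ℝ, ℝ) ∞ ψ)
    (hZ : ContDiff ℝ ∞ Z) :
    Integrable (fun x => ψ x • formPairing h (perpB h p w B) (wd (Z ∘ w)) x) (vol h) := by
  have hwd := isWeakDifferential_wd hw.1.2.1
  have hwZ := isWeakDifferential_wd (hw.exists_isWeakDifferential_comp hNc hZ)
  obtain ⟨M, hM⟩ := isCompact_univ.exists_bound_of_continuousOn hψ.continuous.continuousOn
  obtain ⟨C₁, hC₁⟩ := hNc.exists_bound_of_continuousOn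
    (hZ.continuous_fderiv (by simp)).continuousOn
  obtain ⟨C₂, hC₂⟩ := hNc.exists_bound_of_continuousOn (contDiff_act B).continuous.continuousOn
  refine ((hw.1.integrable_rpow hp).const_mul (|M| * (|C₂| * |C₁|))).mono'
    (hψ.continuous.aestronglyMeasurable.smul (aestronglyMeasurable_formPairing
      (isMeasurableForm_perpB hwd B) hwZ.isMeasurableForm)) ?_
  filter_upwards [ae_sqrt_formNormSq_comp_le hNc hw hZ hC₁,
    ae_sqrt_formNormSq_perpB_le (B := B) hw hC₂] with x hx₁ hx₂
  have hs := Real.sqrt_nonneg (formNormSq h (wd w) x)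
  have hW := weight_nonneg h p w x
  rw [norm_smul]
  have h1 : √(formNormSq h (wd (Z ∘ w)) x) ≤ |C₁| * √(formNormSq h (wd w) x) :=
    hx₁.trans (mul_le_mul_of_nonneg_right (le_abs_self _) hs)
  have h2 : √(formNormSq h (perpB h p w B) x) ≤
      |C₂| * (weight h p w x * √(formNormSq h (wd w) x)) :=
    hx₂.trans (mul_le_mul_of_nonneg_right (le_abs_self _) (mul_nonneg hW hs))
  calc ‖ψ x‖ * ‖formPairing h (perpB h p w B) (wd (Z ∘ w)) x‖
      ≤ |M| * ((|C₂| * (weight h p w x * √(formNormSq h (wd w) x))) *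
          (|C₁| * √(formNormSq h (wd w) x))) := by
        refine mul_le_mul ((hM x (mem_univ _)).trans (le_abs_self _)) ?_ (norm_nonneg _)
          (abs_nonneg _)
        exact (norm_formPairing_le h _ _ x).trans
          (mul_le_mul h2 h1 (Real.sqrt_nonneg _) (by positivity))
    _ = |M| * (|C₂| * |C₁|) * (weight h p w x *
          (√(formNormSq h (wd w) x) * √(formNormSq h (wd w) x))) := by ring
    _ ≤ _ := by
        rw [Real.mul_self_sqrt (formNormSq_nonneg h _ x)]
        exact mul_le_mul_of_nonneg_left (weight_mul_le h p w x) (by positivity)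

/-- The first variation with `η = 1`. -/
theorem IsPHarmonic.divFree (hNc : IsCompact N) (hG : ActsTransitively G N)
    (hB : B ∈ lieAlg G) (hp : 2 < p) (hw : IsPHarmonic h N p w)
    (hψ : ContMDiff 𝓘(ℝ, Plane) 𝓘(ℝ, ℝ) ∞ ψ) :
    Integrable (formPairing h (smoothD ψ) (perpB h p w B)) (vol h) ∧
      ∫ x, formPairing h (smoothD ψ) (perpB h p w B) x ∂(vol h) = 0 := by
  have h1 : testForm ψ (fun _ : Vec => (1 : ℝ)) w = smoothD ψ := by
    funext x
    change (1 : ℝ) • formAt (smoothD ψ) x + ψ x • (fderiv ℝ (fun _ : Vec => (1 : ℝ)) (w x)).comp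
      (formAt (wd w) x) = formAt (smoothD ψ) x
    simp
  have h2 := hw.integral_testForm_eq_zero hNc hG hB hp hψ (η := fun _ => 1) contDiff_const
  rwa [h1] at h2

/-- The frame identity holds for tangent vectors only; it applies because the weak differential of
`w` is almost everywhere tangent to `N`. -/
theorem ae_sum_formPairing_testForm (hNc : IsCompact N) (hN : IsSubmanifold n N)
    (hY : IsFrame N A Y) (hw : IsPHarmonic h N p w) (ψ : S → ℝ) (v : Vec) :
    ∀ᵐ x ∂(vol h),
      ∑ i, formPairing h (testForm ψ (fun q => ⟪v, Y i q⟫) w) (perpB h p w (A i)) x =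
        ⟪v, -(weight h p w x • formPairing h (smoothD ψ) (wd w) x) +
          ψ x • ∑ i, formPairing h (perpB h p w (A i)) (wd (Y i ∘ w)) x⟫ := by
  have hwd := isWeakDifferential_wd hw.1.2.1
  have hall : ∀ᵐ x ∂(vol h), ∀ i, formAt (wd (Y i ∘ w)) x =
      (fderiv ℝ (Y i) (w x)).comp (formAt (wd w) x) :=
    ae_all_iff.2 fun i => ae_wd_comp_eq hNc hw (hY.1 i)
  filter_upwards [hall, hw.2.1, hN.ae_mem_tangent hNc hwd hw.2.1] with x hx hxN hxT
  have h1 := sum_pairing_eq_inner (gram_posDef h x) (formAt (smoothD ψ) x)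
    (D := formAt (wd w) x) (a := fun i => act (A i) (w x)) (y := fun i => Y i (w x))
    (T := fun i => fderiv ℝ (Y i) (w x)) (weight h p w x) (ψ x) v
    (fun z => hY.2.2 _ hxN _ (hxT z))
  have h2 : ∀ i, formPairing h (perpB h p w (A i)) (wd (Y i ∘ w)) x =
      pairing (gram h x) (-weight h p w x • (innerSL ℝ (act (A i) (w x))).comp (formAt (wd w) x))
        ((fderiv ℝ (Y i) (w x)).comp (formAt (wd w) x)) := by
    intro i
    rw [← hx i]
    rfl
  have h3 : ∀ i, formPairing h (testForm ψ (fun q => ⟪v, Y i q⟫) w) (perpB h p w (A i)) x =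
      pairing (gram h x) (⟪v, Y i (w x)⟫ • formAt (smoothD ψ) x +
        ψ x • ((innerSL ℝ v).comp (fderiv ℝ (Y i) (w x))).comp (formAt (wd w) x))
        (-weight h p w x • (innerSL ℝ (act (A i) (w x))).comp (formAt (wd w) x)) := by
    intro i
    have h4 : fderiv ℝ (fun q => ⟪v, Y i q⟫) (w x) = (innerSL ℝ v).comp (fderiv ℝ (Y i) (w x)) :=
      (((innerSL ℝ v).hasFDerivAt).comp (w x)
        ((hY.1 i).differentiable (by simp) (w x)).hasFDerivAt).fderiv
    rw [← h4]
    rfl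
  simp only [h2, h3]
  exact h1

theorem IsPHarmonic.equation (hNc : IsCompact N) (hN : IsSubmanifold n N)
    (hG : ActsTransitively G N) (hA : ∀ i, A i ∈ lieAlg G) (hY : IsFrame N A Y) (hp : 2 < p)
    (hw : IsPHarmonic h N p w) (hψ : ContMDiff 𝓘(ℝ, Plane) 𝓘(ℝ, ℝ) ∞ ψ) :
    Integrable (fun x => weight h p w x • formPairing h (smoothD ψ) (wd w) x) (vol h) ∧
    Integrable (fun x => ψ x • ∑ i, formPairing h (perpB h p w (A i)) (wd (Y i ∘ w)) x) (vol h) ∧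
    ∫ x, weight h p w x • formPairing h (smoothD ψ) (wd w) x ∂(vol h) =
      ∫ x, ψ x • ∑ i, formPairing h (perpB h p w (A i)) (wd (Y i ∘ w)) x ∂(vol h) := by
  have hX₁ := integrable_weight_smul_formPairing hp hw hψ
  have hX₂ : Integrable (fun x => ψ x • ∑ i, formPairing h (perpB h p w (A i))
      (wd (Y i ∘ w)) x) (vol h) := by
    simp only [Finset.smul_sum]
    exact integrable_finsetSum _ fun i _ =>
      integrable_smul_formPairing_perpB hNc hp hw hψ (hY.1 i)
  refine ⟨hX₁, hX₂, ?_⟩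
  have hzero : ∫ x, (-(weight h p w x • formPairing h (smoothD ψ) (wd w) x) +
      ψ x • ∑ i, formPairing h (perpB h p w (A i)) (wd (Y i ∘ w)) x) ∂(vol h) = 0 := by
    -- Test the vector identity against a fixed `v`: the `i`-th summand is the first variation with
    -- `η = ⟨v, Y i⟩`.
    refine ext_inner_left ℝ fun v => ?_
    have hη : ∀ i, ContDiff ℝ ∞ fun q => ⟪v, Y i q⟫ := fun i => contDiff_const.inner ℝ (hY.1 i)
    have htest := fun i => hw.integral_testForm_eq_zero hNc hG (hA i) hp hψ (hη i)
    have hin := integral_inner (𝕜 := ℝ) (hX₁.neg.add hX₂) v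
    simp only [Pi.add_apply, Pi.neg_apply] at hin
    rw [inner_zero_right, ← hin,
      ← integral_congr_ae (ae_sum_formPairing_testForm hNc hN hY hw ψ v),
      integral_finsetSum _ fun i _ => (htest i).1]
    exact Finset.sum_eq_zero fun i _ => (htest i).2
  have h1 := integral_add hX₁.neg hX₂
  simp only [Pi.neg_apply, integral_neg] at h1
  rw [hzero] at h1
  exact (neg_add_eq_zero.1 h1.symm)

end Conservation

end

/-! ### Test functions supported in charts, potentials and assembly. -/

section

open Filter Topology Metric

set_option linter.unusedSectionVars false

section ChartTestFunctions

variable {S : Type u} [TopologicalSpace S] [ChartedSpace Plane S] [IsManifold 𝓘(ℝ, Plane) ∞ S]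
  {h : Metric2 S} {c : OpenPartialHomeomorph S Plane} {φ : Plane → ℝ}

/-- A function of the chart, extended by zero. -/
def chartExtend (c : OpenPartialHomeomorph S Plane) (φ : Plane → ℝ) : S → ℝ :=
  c.source.indicator fun x => φ (c x)

theorem chartExtend_symm {y : Plane} (hy : y ∈ c.target) : chartExtend c φ (c.symm y) = φ y := by
  rw [chartExtend, indicator_of_mem (c.map_target hy), c.right_inv hy]

/-- The Hausdorff property makes the compact image of the support closed; extension by zero is
therefore smooth across the boundary of the chart. -/
theorem chartExtend_eventually_eq_zero [T2Space S] (hφc : HasCompactSupport φ)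
    (hφU : tsupport φ ⊆ c.target) {x : S} (hx : x ∉ c.source) :
    chartExtend c φ =ᶠ[𝓝 x] fun _ => 0 := by
  have hK : IsClosed (c.symm '' tsupport φ) :=
    (hφc.isCompact.image_of_continuousOn (c.symm.continuousOn.mono hφU)).isClosed
  have hxK : x ∉ c.symm '' tsupport φ := by
    rintro ⟨y, hy, rfl⟩
    exact hx (c.map_target (hφU hy))
  filter_upwards [hK.isOpen_compl.mem_nhds hxK] with z hz
  by_cases hzs : z ∈ c.source
  · rw [chartExtend, indicator_of_mem hzs]
    exact image_eq_zero_of_notMem_tsupport fun hzt => hz ⟨c z, hzt, c.left_inv hzs⟩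
  · rw [chartExtend, indicator_of_notMem hzs]

theorem contMDiff_chartExtend [T2Space S] (hc : c ∈ charts S) (hφ : ContDiff ℝ ∞ φ)
    (hφc : HasCompactSupport φ) (hφU : tsupport φ ⊆ c.target) :
    ContMDiff 𝓘(ℝ, Plane) 𝓘(ℝ, ℝ) ∞ (chartExtend c φ) := by
  intro x
  by_cases hx : x ∈ c.source
  · have h1 : ContMDiffAt 𝓘(ℝ, Plane) 𝓘(ℝ, ℝ) ∞ (fun z => φ (c z)) x :=
      hφ.contMDiff.contMDiffAt.comp x (contMDiffAt_of_mem_maximalAtlas hc hx)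
    refine h1.congr_of_eventuallyEq ?_
    filter_upwards [c.open_source.mem_nhds hx] with z hz
    rw [chartExtend, indicator_of_mem hz]
  · exact contMDiffAt_const.congr_of_eventuallyEq (chartExtend_eventually_eq_zero hφc hφU hx)

theorem smoothD_chartExtend_of_notMem [T2Space S] (hφc : HasCompactSupport φ)
    (hφU : tsupport φ ⊆ c.target) {x : S} (hx : x ∉ c.source) :
    formAt (smoothD (chartExtend c φ)) x = 0 := by
  have h1 := (chartExtend_eventually_eq_zero hφc hφU hx).mfderiv_eq
    (I := 𝓘(ℝ, Plane)) (I' := 𝓘(ℝ, ℝ))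
  exact h1.trans mfderiv_const

theorem chartRep_smoothD_chartExtend [T2Space S] (hc : c ∈ charts S) (hφ : ContDiff ℝ ∞ φ)
    (hφc : HasCompactSupport φ) (hφU : tsupport φ ⊆ c.target) {y : Plane} (hy : y ∈ c.target) :
    chartRep c (smoothD (chartExtend c φ)) y = fderiv ℝ φ y := by
  rw [chartRep_smoothD (contMDiff_chartExtend hc hφ hφc hφU) hc hy]
  refine Filter.EventuallyEq.fderiv_eq ?_
  filter_upwards [c.open_target.mem_nhds hy] with z hz
  exact chartExtend_symm hz

end ChartTestFunctions

section PlaneForms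

variable {g : Matrix (Fin 2) (Fin 2) ℝ}

theorem apply_eq_sum_e (T : Plane →L[ℝ] ℝ) (v : Plane) : T v = v 0 * T (e 0) + v 1 * T (e 1) := by
  conv_lhs => rw [plane_eq_sum v]
  simp [Fin.sum_univ_two]

theorem norm_le_sum_e (T : Plane →L[ℝ] ℝ) : ‖T‖ ≤ ‖T (e 0)‖ + ‖T (e 1)‖ := by
  refine T.opNorm_le_bound (by positivity) fun v => ?_
  rw [apply_eq_sum_e]
  refine (norm_add_le _ _).trans ?_
  rw [norm_mul, norm_mul, add_mul]
  have h0 := PiLp.norm_apply_le v 0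
  have h1 := PiLp.norm_apply_le v 1
  nlinarith [norm_nonneg (T (e 0)), norm_nonneg (T (e 1))]

/-- `√det g · ⟨α, β⟩` is the wedge product of `unperp g β` and `α`. -/
theorem sqrt_det_mul_pairing (α β : Plane →L[ℝ] ℝ) :
    √g.det * pairing g α β = α (e 1) * unperp g β (e 0) - α (e 0) * unperp g β (e 1) := by
  rw [unperp_e_zero, unperp_e_one]
  simp [pairing, Fin.sum_univ_two]
  ring

/-- An alternating bilinear form on the plane is a multiple of the determinant, so weak closedness
needs checking in the basis directions only. -/
theorem wedge_apply (α η : Plane →L[ℝ] ℝ) (u v : Plane) :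
    α u * η v - α v * η u =
      (u 1 * v 0 - u 0 * v 1) * (α (e 1) * η (e 0) - α (e 0) * η (e 1)) := by
  rw [apply_eq_sum_e α u, apply_eq_sum_e α v, apply_eq_sum_e η u, apply_eq_sum_e η v]
  ring

end PlaneForms

section Potential

variable {S : Type u} [TopologicalSpace S] [ChartedSpace Plane S] [IsManifold 𝓘(ℝ, Plane) ∞ S]
  [MeasurableSpace S] [BorelSpace S] [CompactSpace S]
  {h : Metric2 S} {α : OneForm S ℝ} {c : OpenPartialHomeomorph S Plane}

theorem aestronglyMeasurable_unperp (hα : IsMeasurableForm α) (hc : c ∈ charts S) :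
    AEStronglyMeasurable (fun y => unperp (chartGram h c y) (chartRep c α y))
      (volume.restrict c.target) := by
  have hdet : AEStronglyMeasurable (fun y => √(chartGram h c y).det) (volume.restrict c.target) :=
    (continuousOn_density h hc).aestronglyMeasurable c.open_target.measurableSet
  have hs : ∀ i : Fin 2, AEStronglyMeasurable (fun y => √(chartGram h c y).det *
      ∑ j, (chartGram h c y)⁻¹ i j * chartRep c α y (e j)) (volume.restrict c.target) := fun i =>
    hdet.mul (Finset.aestronglyMeasurable_fun_sum _ fun j _ =>
      (aestronglyMeasurable_chartGram_inv_apply h hc i j).mul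
        ((ContinuousLinearMap.apply ℝ ℝ (e j)).continuous.comp_aestronglyMeasurable (hα c hc)))
  exact ((hs 1).smul aestronglyMeasurable_const).sub ((hs 0).smul aestronglyMeasurable_const)

theorem locallyIntegrableOn_unperp (hα : IsMeasurableForm α) (hc : c ∈ charts S)
    (hint : Integrable (fun x => √(formNormSq h α x)) (vol h)) :
    LocallyIntegrableOn (fun y => unperp (chartGram h c y) (chartRep c α y)) c.target := by
  have hcont : ContinuousOn (fun y => √(chartGram h c y 0 0) + √(chartGram h c y 1 1))
      c.target := by
    have h1 := continuousOn_chartGram h hc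
    have h2 : ∀ i : Fin 2, ContinuousOn (fun y => √(chartGram h c y i i)) c.target := fun i =>
      ((continuous_id (X := Matrix (Fin 2) (Fin 2) ℝ)).matrix_elem i i).sqrt.comp_continuousOn h1
    exact (h2 0).add (h2 1)
  have h1 := (locallyIntegrableOn_chart hc hint).continuousOn_mul hcont
    c.open_target.isLocallyClosed
  refine locallyIntegrableOn_of_norm_le c.open_target h1 (aestronglyMeasurable_unperp hα hc)
    (C := 1) ?_
  filter_upwards [ae_restrict_mem c.open_target.measurableSet] with y hy
  have hg := chartGram_posDef h hc hy
  have hn : normSq (chartGram h c y) (unperp (chartGram h c y) (chartRep c α y)) =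
      formNormSq h α (c.symm y) := by
    rw [normSq_unperp hg, normSq_chartRep hc hy]
  have h2 := fun i => norm_apply_basis_sq_le hg (unperp (chartGram h c y) (chartRep c α y)) i
  simp only [hn] at h2
  rw [one_mul, Real.norm_of_nonneg (by positivity), add_mul]
  exact (norm_le_sum_e _).trans (add_le_add (h2 0) (h2 1))

variable [T2Space S]

/-- Test the divergence with `φ` extended by zero; the density of the volume turns the contraction
into a wedge product. -/
theorem integral_wedge_unperp (hα : IsMeasurableForm α) (hc : c ∈ charts S)
    (hdiv : ∀ ψ : S → ℝ, ContMDiff 𝓘(ℝ, Plane) 𝓘(ℝ, ℝ) ∞ ψ →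
      ∫ x, formPairing h (smoothD ψ) α x ∂(vol h) = 0)
    {φ : Plane → ℝ} (hφ : ContDiff ℝ ∞ φ) (hφc : HasCompactSupport φ)
    (hφU : tsupport φ ⊆ c.target) :
    ∫ y, (fderiv ℝ φ y (e 1) * unperp (chartGram h c y) (chartRep c α y) (e 0) -
      fderiv ℝ φ y (e 0) * unperp (chartGram h c y) (chartRep c α y) (e 1)) = 0 := by
  have hψ := contMDiff_chartExtend hc hφ hφc hφU
  rw [← hdiv _ hψ]
  have h1 : ∫ x in c.source, formPairing h (smoothD (chartExtend c φ)) α x ∂(vol h) =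
      ∫ x, formPairing h (smoothD (chartExtend c φ)) α x ∂(vol h) := by
    refine setIntegral_eq_integral_of_forall_compl_eq_zero fun x hx => ?_
    have h2 : formPairing h (smoothD (chartExtend c φ)) α x =
        pairing (gram h x) (formAt (smoothD (chartExtend c φ)) x) (formAt α x) := rfl
    rw [h2, smoothD_chartExtend_of_notMem hφc hφU hx]
    simp [pairing]
  rw [← h1, setIntegral_chart hc (aestronglyMeasurable_formPairing
    (isWeakDifferential_smoothD hψ).isMeasurableForm hα),
    ← setIntegral_eq_integral_of_forall_compl_eq_zero (s := c.target)]
  · refine setIntegral_congr_fun c.open_target.measurableSet fun y hy => ?_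
    rw [← sqrt_det_mul_pairing, ← pairing_chartRep hc hy,
      chartRep_smoothD_chartExtend hc hφ hφc hφU hy, smul_eq_mul]
  · intro y hy
    have h2 : fderiv ℝ φ y = 0 :=
      image_eq_zero_of_notMem_tsupport fun hy' => hy (hφU (tsupport_fderiv_subset ℝ hy'))
    simp [h2]

theorem isWeaklyClosedOn_unperp (hα : IsMeasurableForm α) (hc : c ∈ charts S)
    (hint : Integrable (fun x => √(formNormSq h α x)) (vol h))
    (hdiv : ∀ ψ : S → ℝ, ContMDiff 𝓘(ℝ, Plane) 𝓘(ℝ, ℝ) ∞ ψ →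
      ∫ x, formPairing h (smoothD ψ) α x ∂(vol h) = 0) :
    IsWeaklyClosedOn c.target fun y => unperp (chartGram h c y) (chartRep c α y) := by
  intro φ hφ hφc hφU u v
  have hη := locallyIntegrableOn_unperp hα hc hint
  have hi : ∀ u v : Plane, Integrable fun y => (fderiv ℝ φ y u) •
      unperp (chartGram h c y) (chartRep c α y) v := fun u v =>
    integrable_smul_of_locallyIntegrableOn (LocallyIntegrableOn.clm_apply_const hη v)
      ((hφ.continuous_fderiv (by simp)).clm_apply continuous_const) (hφc.fderiv_apply ℝ u)
      ((tsupport_fderiv_apply_subset ℝ u).trans hφU)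
  rw [← sub_eq_zero, ← integral_sub (hi u v) (hi v u)]
  simp only [smul_eq_mul]
  rw [integral_congr_ae (ae_of_all _ fun y => wedge_apply (fderiv ℝ φ y)
    (unperp (chartGram h c y) (chartRep c α y)) u v), integral_const_mul, integral_wedge_unperp hα hc hdiv hφ hφc hφU, mul_zero]

end Potential

section Core

variable {S : Type u} [TopologicalSpace S] [ChartedSpace Plane S] [IsManifold 𝓘(ℝ, Plane) ∞ S]
  [MeasurableSpace S] [BorelSpace S] [CompactSpace S] [T2Space S]
  {h : Metric2 S} {m n L : ℕ}
  {N : Set (EuclideanSpace ℝ (Fin m))} {G : Subgroup (Matrix.orthogonalGroup (Fin m) ℝ)}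
  {A : Fin L → Matrix (Fin m) (Fin m) ℝ}
  {Y : Fin L → EuclideanSpace ℝ (Fin m) → EuclideanSpace ℝ (Fin m)}
  {p C : ℝ} {w : S → EuclideanSpace ℝ (Fin m)}

theorem integrable_sqrt_formNormSq_perpB {B : Matrix (Fin m) (Fin m) ℝ} (hp : 2 < p)
    (hw : IsPHarmonic h N p w) (hC0 : 0 ≤ C) (hC : ∀ q ∈ N, ‖act B q‖ ≤ C) :
    Integrable (fun x => √(formNormSq h (perpB h p w B) x)) (vol h) := by
  have hwd := isWeakDifferential_wd hw.1.2.1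
  refine ((hw.1.integrable_rpow hp).const_mul C).mono'
    (Real.continuous_sqrt.comp_aestronglyMeasurable
      (aestronglyMeasurable_formNormSq (isMeasurableForm_perpB hwd B))) ?_
  filter_upwards [ae_sqrt_formNormSq_perpB_le (B := B) hw hC] with x hx
  rw [Real.norm_of_nonneg (Real.sqrt_nonneg _)]
  exact hx.trans (mul_le_mul_of_nonneg_left (weight_mul_sqrt_le h p w x) hC0)

theorem IsPHarmonic.conservationLaw (hNc : IsCompact N) (hN : IsSubmanifold n N)
    (hG : ActsTransitively G N) (hA : ∀ i, A i ∈ lieAlg G) (hY : IsFrame N A Y) (hC0 : 0 ≤ C)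
    (hCA : ∀ i, ∀ q ∈ N, ‖act (A i) q‖ ≤ C) (hCY : ∀ i, ∀ q ∈ N, ‖fderiv ℝ (Y i) q‖ ≤ C)
    (hp : 2 < p) (hw : IsPHarmonic h N p w) : ConservationLaw h p w A Y C where
  memW1p i := memW1p_comp hNc hw (hY.1 i)
  equation _ hψ := hw.equation hNc hN hG hA hY hp hψ
  divFree i _ hψ := hw.divFree hNc hG (hA i) hp hψ
  potential i c hc y₀ r hball := by
    have hwd := isWeakDifferential_wd hw.1.2.1
    have hα := isMeasurableForm_perpB (h := h) (p := p) hwd (A i)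
    have hint := integrable_sqrt_formNormSq_perpB hp hw hC0 (hCA i)
    have hcl := isWeaklyClosedOn_unperp hα hc hint
      fun ψ hψ => (hw.divFree hNc hG (hA i) hp hψ).2
    -- The differential of `B` is prescribed to be the rotated field, so `∇^⊥ B = V` and `|∇B| =
    -- |V|` are pointwise identities.
    obtain ⟨B, hB⟩ := exists_potential
      ((locallyIntegrableOn_unperp hα hc hint).mono_set hball)
      (fun φ hφ hφc hφU u v => hcl φ hφ hφc (hφU.trans hball) u v)
    refine ⟨B, _, hB, ?_⟩
    have hb := ae_mono (Measure.restrict_mono hball le_rfl)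
      (ae_vol_chart hc (ae_sqrt_formNormSq_perpB_le (B := A i) hw (hCA i)))
    filter_upwards [hb, ae_restrict_mem measurableSet_ball] with y hy hyb
    have hg := chartGram_posDef h hc (hball hyb)
    refine ⟨fun v => perp_unperp hg _ v, ?_⟩
    rwa [normSq_unperp hg, normSq_chartRep hc (hball hyb)]
  bound_B i := ae_sqrt_formNormSq_perpB_le hw (hCA i)
  bound_Y i := ae_sqrt_formNormSq_comp_le hNc hw (hY.1 i) (hCY i)

end Core

end

/-! ### Bounds on frames, uniform over orthonormal bases. -/

section

section FrameBounds

variable {m L : ℕ} {N : Set (EuclideanSpace ℝ (Fin m))}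
  {G : Subgroup (Matrix.orthogonalGroup (Fin m) ℝ)}

theorem exists_norm_fderiv_le (hNc : IsCompact N)
    {Y : Fin L → EuclideanSpace ℝ (Fin m) → EuclideanSpace ℝ (Fin m)}
    (hY : ∀ i, ContDiff ℝ ∞ (Y i)) :
    ∃ M : ℝ, 0 ≤ M ∧ ∀ i, ∀ q ∈ N, ‖fderiv ℝ (Y i) q‖ ≤ M := by
  choose M hM using fun i => hNc.exists_bound_of_continuousOn
    ((hY i).continuous_fderiv (by simp)).continuousOn
  refine ⟨∑ i, |M i|, Finset.sum_nonneg fun i _ => abs_nonneg _, fun i q hq => ?_⟩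
  exact (hM i q hq).trans ((le_abs_self _).trans
    (Finset.single_le_sum (f := fun i => |M i|) (fun i _ => abs_nonneg _) (Finset.mem_univ i)))

/-- Cauchy–Schwarz for unit vectors, from `2 |xy| ≤ x² + y²` entry by entry. -/
theorem abs_frob_le_one {A B : Matrix (Fin m) (Fin m) ℝ} (hA : frob A A = 1)
    (hB : frob B B = 1) : |frob A B| ≤ 1 := by
  have h1 : |frob A B| ≤ ∑ j, ∑ k, (A j k * A j k + B j k * B j k) / 2 := by
    refine (Finset.abs_sum_le_sum_abs _ _).trans (Finset.sum_le_sum fun j _ =>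
      (Finset.abs_sum_le_sum_abs _ _).trans (Finset.sum_le_sum fun k _ => ?_))
    rw [abs_le]
    constructor <;> nlinarith [sq_nonneg (A j k + B j k), sq_nonneg (A j k - B j k)]
  have h2 : ∑ j, ∑ k, (A j k * A j k + B j k * B j k) / 2 = (frob A A + frob B B) / 2 := by
    simp only [frob, Finset.sum_div, ← Finset.sum_add_distrib, add_div]
  rw [h2, hA, hB] at h1
  linarith

/-- Frames with derivatives bounded uniformly over all orthonormal bases. -/
theorem exists_isFrame_uniform (hNc : IsCompact N)
    (hGc : IsClosed (G : Set (Matrix.orthogonalGroup (Fin m) ℝ)))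
    (hG : ActsTransitively G N) :
    ∃ M : ℝ, 0 ≤ M ∧ ∀ (L : ℕ) (B : Fin L → Matrix (Fin m) (Fin m) ℝ),
      IsLieOrthonormalBasis G B → ∃ Y, IsFrame N B Y ∧
        ∀ i, ∀ q ∈ N, ‖fderiv ℝ (Y i) q‖ ≤ M := by
  -- The bound must be fixed before the basis is given. It comes from one reference basis with a
  -- frame, carried to all others by `change_basis`; without any basis the claim is vacuous.
  by_cases hex : ∃ (L : ℕ) (A : Fin L → Matrix (Fin m) (Fin m) ℝ), IsLieOrthonormalBasis G A
  · obtain ⟨L₀, A, hA⟩ := hex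
    obtain ⟨Y, hY⟩ := exists_isFrame hGc hG hA
    obtain ⟨M, hM0, hM⟩ := exists_norm_fderiv_le hNc hY.1
    refine ⟨L₀ * M, by positivity, fun L B hB => ⟨_, hY.change_basis hGc hG hA hB, ?_⟩⟩
    intro i q hq
    have hd : HasFDerivAt (fun q => ∑ j, frob (B i) (A j) • Y j q)
        (∑ j, frob (B i) (A j) • fderiv ℝ (Y j) q) q :=
      HasFDerivAt.fun_sum fun j _ =>
        (((hY.1 j).differentiable (by simp)) q).hasFDerivAt.fun_const_smul _
    rw [hd.fderiv]
    refine (norm_sum_le _ _).trans ?_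
    calc _ ≤ ∑ _j : Fin L₀, M := by
          refine Finset.sum_le_sum fun j _ => ?_
          rw [norm_smul, Real.norm_eq_abs]
          have h1 : |frob (B i) (A j)| ≤ 1 :=
            abs_frob_le_one (by simp [hB.frob_eq]) (by simp [hA.frob_eq])
          exact (mul_le_mul h1 (hM j q hq) (norm_nonneg _) zero_le_one).trans_eq (one_mul _)
      _ = _ := by simp
  · exact ⟨0, le_rfl, fun L B hB => absurd ⟨L, B, hB⟩ hex⟩

end FrameBounds

end

end PHarm

end

theorem mainTheorem7 {m n : ℕ} (N : Set (EuclideanSpace ℝ (Fin m))) (hNc : IsCompact N)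
    (hN : PHarm.IsSubmanifold n N)
    (G : Subgroup (Matrix.orthogonalGroup (Fin m) ℝ))
    (hGc : IsClosed (G : Set (Matrix.orthogonalGroup (Fin m) ℝ)))
    (hG : PHarm.ActsTransitively G N) :
    -- a frame with a constant depending on `N` and `G` only, for every orthonormal basis
    (∃ C : ℝ, 0 < C ∧ ∀ (L : ℕ) (A : Fin L → Matrix (Fin m) (Fin m) ℝ),
      PHarm.IsLieOrthonormalBasis G A →
      ∃ Y : Fin L → EuclideanSpace ℝ (Fin m) → EuclideanSpace ℝ (Fin m),
        PHarm.IsFrame N A Y ∧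
        ∀ (S : Type u) [TopologicalSpace S] [T2Space S] [CompactSpace S]
          [ChartedSpace PHarm.Plane S] [IsManifold 𝓘(ℝ, PHarm.Plane) ∞ S]
          [MeasurableSpace S] [BorelSpace S] (h : PHarm.Metric2 S)
          (p : ℝ) (_ : 2 < p) (w : S → EuclideanSpace ℝ (Fin m)),
          PHarm.IsPHarmonic h N p w → PHarm.ConservationLaw h p w A Y C) ∧
    -- the same for an arbitrary frame, the constant depending on `N`, `G` and the frame only
    (∀ (L : ℕ) (A : Fin L → Matrix (Fin m) (Fin m) ℝ), PHarm.IsLieOrthonormalBasis G A →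
      ∀ Y : Fin L → EuclideanSpace ℝ (Fin m) → EuclideanSpace ℝ (Fin m), PHarm.IsFrame N A Y →
      ∃ C : ℝ, 0 < C ∧
        ∀ (S : Type u) [TopologicalSpace S] [T2Space S] [CompactSpace S]
          [ChartedSpace PHarm.Plane S] [IsManifold 𝓘(ℝ, PHarm.Plane) ∞ S]
          [MeasurableSpace S] [BorelSpace S] (h : PHarm.Metric2 S)
          (p : ℝ) (_ : 2 < p) (w : S → EuclideanSpace ℝ (Fin m)),
          PHarm.IsPHarmonic h N p w → PHarm.ConservationLaw h p w A Y C) := by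
  obtain ⟨R, hR⟩ := hNc.isBounded.exists_norm_le
  have hact : ∀ {L : ℕ} {A : Fin L → Matrix (Fin m) (Fin m) ℝ},
      PHarm.IsLieOrthonormalBasis G A → ∀ i, ∀ q ∈ N, ‖PHarm.act (A i) q‖ ≤ |R| :=
    fun hA i q hq => (hA.norm_act_le i q).trans ((hR q hq).trans (le_abs_self R))
  refine ⟨?_, fun L A hA Y hY => ?_⟩
  · obtain ⟨M, hM0, hM⟩ := PHarm.exists_isFrame_uniform hNc hGc hG
    have hR0 := abs_nonneg R
    -- `|R|` bounds `Aⁱ q` on `N` and `M` the derivatives of the frame; the `1` is there for strict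
    -- positivity only.
    refine ⟨|R| + M + 1, by linarith, fun L A hA => ?_⟩
    obtain ⟨Y, hY, hYM⟩ := hM L A hA
    refine ⟨Y, hY, fun S _ _ _ _ _ _ _ h p hp w hw => ?_⟩
    exact hw.conservationLaw hNc hN hG hA.mem hY (by linarith)
      (fun i q hq => (hact hA i q hq).trans (by linarith))
      (fun i q hq => (hYM i q hq).trans (by linarith)) hp
  · obtain ⟨M, hM0, hM⟩ := PHarm.exists_norm_fderiv_le hNc hY.1
    have hR0 := abs_nonneg R
    refine ⟨|R| + M + 1, by linarith, fun S _ _ _ _ _ _ _ h p hp w hw => ?_⟩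
    exact hw.conservationLaw hNc hN hG hA.mem hY (by linarith)
      (fun i q hq => (hact hA i q hq).trans (by linarith))
      (fun i q hq => (hM i q hq).trans (by linarith)) hp
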